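/- There is a deterministic algorithm whose running time, measured in bit operations, is polynomial in $\log N$ and which does the following. Let $N$ be a squarefree positive integer with at least three distinct prime factors, and let $p_1$ be its largest prime factor. Write $p_1 = N^{\alpha_1}$ and suppose that $\alpha_1 > 1/2$, that is, $p_1 > \sqrt{N}$. Then, given $N$ together with an integer $M$ equal either to $\varphi(N)$ (Euler's totient) or to $\lambda(N)$ (Carmichael's function, the exponent of $(\mathbb{Z}/N\mathbb{Z})^\times$), the algorithm outputs $p_1$. Explicitly: there are a fixed program $\mathcal{A}$, for a deterministic machine with integer variables and integer-indexed arrays whose operations are charged according to the bit lengths of the numbers they handle (polynomially equivalent to a Turing machine), and a fixed real polynomial $q$ such that, for all such $N$ and $M$, the program $\mathcal{A}$ on input $(N, M)$ halts with output $p_1$ after a computation of cost at most $q(\log N)$. -/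

import Mathlib

/-!
# A machine model with logarithmic (bit) cost

Deterministic structured programs over integer variables and integer-indexed arrays.  A program
mentions finitely many variables and arrays.  Every step is charged at least the bit lengths of all
numbers (operands, results, addresses) that it handles, and arithmetic operations are charged the
bit cost of schoolbook multiplication, so that the cost is a bit-complexity running time and is
polynomially related to the running time of a Turing machine.
-/

namespace LogCost

/-- The bit length of an integer. -/
def bits (z : ℤ) : ℕ := Nat.size z.natAbs

/-- The primitive operations.  `div` and `mod` are Euclidean division of integers
(with `a / 0 = 0` and `a % 0 = a`); `le` and `eq` return `1` for true and `0` for false. -/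
inductive Op where
  | add | sub | mul | div | mod | le | eq

/-- The value of a primitive operation. -/
def Op.eval : Op → ℤ → ℤ → ℤ
  | .add, a, b => a + b
  | .sub, a, b => a - b
  | .mul, a, b => a * b
  | .div, a, b => a / b
  | .mod, a, b => a % b
  | .le, a, b => if a ≤ b then 1 else 0
  | .eq, a, b => if a = b then 1 else 0

/-- A memory state: the contents of the variables `0, 1, 2, …` and of the arrays `0, 1, 2, …`,
whose cells are indexed by integers. -/
@[ext] structure State where
  var : ℕ → ℤ
  arr : ℕ → ℤ → ℤ

/-- Overwrite variable `x` by `v`. -/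
def State.setVar (s : State) (x : ℕ) (v : ℤ) : State :=
  { s with var := Function.update s.var x v }

/-- Overwrite cell `i` of array `a` by `v`. -/
def State.setArr (s : State) (a : ℕ) (i v : ℤ) : State :=
  { s with arr := Function.update s.arr a (Function.update (s.arr a) i v) }

/-- The initial state: variables `0, …, l.length - 1` hold the input list `l`, and
everything else is zero. -/
def State.init (l : List ℤ) : State where
  var x := l.getD x 0
  arr _ _ := 0

/-- Expressions: constants, variables, array cells with a computed index, and operations. -/
inductive Expr where
  | const (z : ℤ)
  | var (x : ℕ)
  | get (a : ℕ) (i : Expr)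
  | op (o : Op) (e₁ e₂ : Expr)

/-- The value of an expression. -/
def Expr.eval (s : State) : Expr → ℤ
  | .const z => z
  | .var x => s.var x
  | .get a i => s.arr a (i.eval s)
  | .op o e₁ e₂ => o.eval (e₁.eval s) (e₂.eval s)

/-- The bit cost of evaluating an expression. -/
def Expr.cost (s : State) : Expr → ℕ
  | .const z => 1 + bits z
  | .var x => 1 + bits (s.var x)
  | .get a i => i.cost s + (1 + bits (i.eval s) + bits (s.arr a (i.eval s)))
  | .op _ e₁ e₂ => e₁.cost s + e₂.cost s + (1 + bits (e₁.eval s)) * (1 + bits (e₂.eval s))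

/-- Programs: no operation, assignment to a variable, assignment to an array cell, sequential
composition, branching (on whether the test is nonzero), and repetition (while the test is
nonzero). -/
inductive Prog where
  | skip
  | assign (x : ℕ) (e : Expr)
  | store (a : ℕ) (i e : Expr)
  | seq (c₁ c₂ : Prog)
  | branch (e : Expr) (c₁ c₂ : Prog)
  | loop (e : Expr) (c : Prog)

/-- `Exec c s s' t`: started in state `s`, the program `c` halts in state `s'` after a
computation of total bit cost `t`. -/
inductive Exec : Prog → State → State → ℕ → Prop
  | skip (s : State) : Exec .skip s s 1
  | assign (s : State) (x : ℕ) (e : Expr) :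
      Exec (.assign x e) s (s.setVar x (e.eval s)) (e.cost s + (1 + bits (e.eval s)))
  | store (s : State) (a : ℕ) (i e : Expr) :
      Exec (.store a i e) s (s.setArr a (i.eval s) (e.eval s))
        (i.cost s + e.cost s + (1 + bits (i.eval s) + bits (e.eval s)))
  | seq {c₁ c₂ : Prog} {s s' s'' : State} {t₁ t₂ : ℕ} :
      Exec c₁ s s' t₁ → Exec c₂ s' s'' t₂ → Exec (.seq c₁ c₂) s s'' (t₁ + t₂)
  | branch_true {e : Expr} {c₁ c₂ : Prog} {s s' : State} {t : ℕ} :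
      e.eval s ≠ 0 → Exec c₁ s s' t → Exec (.branch e c₁ c₂) s s' (e.cost s + 1 + t)
  | branch_false {e : Expr} {c₁ c₂ : Prog} {s s' : State} {t : ℕ} :
      e.eval s = 0 → Exec c₂ s s' t → Exec (.branch e c₁ c₂) s s' (e.cost s + 1 + t)
  | loop_true {e : Expr} {c : Prog} {s s' s'' : State} {t₁ t₂ : ℕ} :
      e.eval s ≠ 0 → Exec c s s' t₁ → Exec (.loop e c) s' s'' t₂ →
        Exec (.loop e c) s s'' (e.cost s + 1 + t₁ + t₂)
  | loop_false {e : Expr} {c : Prog} {s : State} :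
      e.eval s = 0 → Exec (.loop e c) s s (e.cost s + 1)

/-- `Outputs c l z t`: on the input list `l`, the program `c` halts after a computation of total
bit cost `t` and leaves the output `z` in variable `0`. -/
def Outputs (c : Prog) (l : List ℤ) (z : ℤ) (t : ℕ) : Prop :=
  ∃ s : State, Exec c (State.init l) s t ∧ s.var 0 = z

end LogCost

/-! ### Expressions, bit-length estimates and a command language with built-in cost bounds. -/

namespace LogCost

/-! Write `m = N / p₁` and `K = M * N`. Since `p₁ - 1` divides `M`, the number `N - m = m * (p₁ -
1)` divides `K` (`Cofactor.sub_dvd_mul`). So `K ≤ N ^ 2` is a known integer with a divisor of size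
at least `N / 2`, hence at least `√K / 2`, whose distance `m < √N` from the known number `N` is to
be found. This is the setting of Coppersmith's method in the form of Howgrave-Graham: a divisor of
`K` of size about `K ^ (1/2)` can be found if it is known up to an error of about `K ^ (1/4)`, and
`N ^ (1/2)` is just within this range up to a constant factor.

The constant is absorbed by cutting the range of `m` into at most 16 intervals `[a, a + X)` with `64
* X ^ 2 ≤ N < 256 * X ^ 2`. For one interval put `P₀ = N - a`. At `x = m - a` the polynomials `K ^
(t - i) * (P₀ - x) ^ i`, `i < L = 2 * t`, are all divisible by `(N - m) ^ t`. A short vector in the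
lattice of their coefficients (`run_reduction`) is a nonzero polynomial whose value at `m - a` is
divisible by `(N - m) ^ t` and smaller than it, hence zero (`parameters_lt`,
`sum_eq_zero_of_vanishing`, `run_shortVector`). Taking `t` larger than the binary logarithm of `N`
keeps the losses that depend on the dimension bounded.

The integer zero is found by exact arithmetic: the square of the polynomial is nonnegative, and
binary searches on its forward differences, from the highest order down, cut the interval into cells
on which being positive does not change (`run_separate`). A zero is then less than `L` steps from
the left end of its cell (`run_roots`). A divisor `d` of `N` with `d ^ 2 < N` is not divisible by
`p₁`, hence is at most `m` (`Cofactor.le_of_dvd_of_sq_lt`). So the largest number that passes this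
test is `m`, and spurious candidates do no harm.

Cost and correctness are separated. In a `Cmd` every stored value is reduced modulo `2 * Q` and
every loop is bounded by a read-only variable, so the cost is polynomial whatever the command
computes (`Cmd.exec_toProg`). Correctness then only needs the true values to stay below `Q`.
Variables `0, …, 5` hold `N`, `M`, `L`, `2 * L`, `L ^ 8` and `Q = 2 ^ L ^ 8`. Variable `6` is the
best cofactor so far, `7` is `X`, `8` numbers the intervals, `9` is `a` and `17` is `K`. -/

instance : Add Expr := ⟨Expr.op .add⟩
instance : Sub Expr := ⟨Expr.op .sub⟩
instance : Mul Expr := ⟨Expr.op .mul⟩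
instance : Div Expr := ⟨Expr.op .div⟩
instance : Mod Expr := ⟨Expr.op .mod⟩
instance (n : ℕ) : OfNat Expr n := ⟨Expr.const n⟩

/-- The test `e₁ ≤ e₂`. -/
def Expr.le (e₁ e₂ : Expr) : Expr := .op .le e₁ e₂

/-- The test `e₁ = e₂`. -/
def Expr.equals (e₁ e₂ : Expr) : Expr := .op .eq e₁ e₂

/-- The contents of the variable `x`, as an expression. -/
abbrev v (x : ℕ) : Expr := .var x

@[simp] theorem Expr.eval_add (s : State) (e₁ e₂ : Expr) :
    (e₁ + e₂).eval s = e₁.eval s + e₂.eval s := rfl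
@[simp] theorem Expr.eval_sub (s : State) (e₁ e₂ : Expr) :
    (e₁ - e₂).eval s = e₁.eval s - e₂.eval s := rfl
@[simp] theorem Expr.eval_mul (s : State) (e₁ e₂ : Expr) :
    (e₁ * e₂).eval s = e₁.eval s * e₂.eval s := rfl
@[simp] theorem Expr.eval_div (s : State) (e₁ e₂ : Expr) :
    (e₁ / e₂).eval s = e₁.eval s / e₂.eval s := rfl
@[simp] theorem Expr.eval_mod (s : State) (e₁ e₂ : Expr) :
    (e₁ % e₂).eval s = e₁.eval s % e₂.eval s := rfl
@[simp] theorem Expr.eval_two (s : State) : (2 : Expr).eval s = 2 := rfl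
@[simp] theorem Expr.eval_256 (s : State) : (256 : Expr).eval s = 256 := rfl
@[simp] theorem Expr.eval_zero (s : State) : (0 : Expr).eval s = 0 := rfl
@[simp] theorem Expr.eval_one (s : State) : (1 : Expr).eval s = 1 := rfl
@[simp] theorem Expr.eval_var (s : State) (x : ℕ) : (Expr.var x).eval s = s.var x := rfl
@[simp] theorem Expr.eval_get (s : State) (a : ℕ) (i : Expr) :
    (Expr.get a i).eval s = s.arr a (i.eval s) := rfl
@[simp] theorem Expr.eval_le (s : State) (e₁ e₂ : Expr) :
    (e₁.le e₂).eval s = if e₁.eval s ≤ e₂.eval s then 1 else 0 := rfl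
@[simp] theorem Expr.eval_equals (s : State) (e₁ e₂ : Expr) :
    (e₁.equals e₂).eval s = if e₁.eval s = e₂.eval s then 1 else 0 := rfl

/-! ### Bit lengths -/

theorem bits_le_iff {z : ℤ} {n : ℕ} : bits z ≤ n ↔ |z| < 2 ^ n := by
  rw [bits, Nat.size_le, ← Int.natCast_natAbs]
  exact_mod_cast Iff.rfl

theorem abs_lt_two_pow_bits (z : ℤ) : |z| < 2 ^ bits z := bits_le_iff.1 le_rfl

theorem bits_mono {a b : ℤ} (h : |a| ≤ |b|) : bits a ≤ bits b :=
  bits_le_iff.2 (h.trans_lt (abs_lt_two_pow_bits b))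

theorem bits_add_le (a b : ℤ) : bits (a + b) ≤ bits a + bits b + 1 := by
  rw [bits_le_iff]
  have h₁ := abs_lt_two_pow_bits a
  have h₂ := abs_lt_two_pow_bits b
  have h₃ : (2 : ℤ) ^ bits a ≤ 2 ^ (bits a + bits b) := pow_le_pow_right₀ (by norm_num) (by omega)
  have h₄ : (2 : ℤ) ^ bits b ≤ 2 ^ (bits a + bits b) := pow_le_pow_right₀ (by norm_num) (by omega)
  have := abs_add_le a b
  rw [pow_succ]
  linarith

theorem bits_neg (a : ℤ) : bits (-a) = bits a := by simp [bits]

theorem bits_eval_le (o : Op) (a b : ℤ) : bits (o.eval a b) ≤ bits a + bits b + 1 := by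
  cases o with
  | add => exact bits_add_le a b
  | sub =>
    have := bits_add_le a (-b)
    rwa [bits_neg] at this
  | mul =>
    change bits (a * b) ≤ _
    rw [bits_le_iff, abs_mul]
    have h₁ := abs_lt_two_pow_bits a
    have h₂ := abs_lt_two_pow_bits b
    calc |a| * |b| ≤ 2 ^ bits a * 2 ^ bits b := by gcongr
      _ = 2 ^ (bits a + bits b) := (pow_add _ _ _).symm
      _ < _ := pow_lt_pow_right₀ (by norm_num) (by omega)
  | div =>
    have : bits (a / b) ≤ bits a := bits_mono (by
      rw [← Int.natCast_natAbs, ← Int.natCast_natAbs]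
      exact_mod_cast Int.natAbs_ediv_le_natAbs a b)
    exact this.trans (by omega)
  | mod =>
    by_cases hb : b = 0
    · subst hb
      change bits (a % 0) ≤ _
      rw [Int.emod_zero]; omega
    · have : bits (a % b) ≤ bits b := bits_mono (by
        rw [abs_of_nonneg (Int.emod_nonneg a hb)]
        exact (Int.emod_lt_abs a hb).le)
      exact this.trans (by omega)
  | le =>
    change bits (if a ≤ b then 1 else 0) ≤ _
    have : bits (if a ≤ b then 1 else 0) ≤ 1 := by split_ifs <;> simp [bits]
    omega
  | eq =>
    change bits (if a = b then 1 else 0) ≤ _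
    have : bits (if a = b then 1 else 0) ≤ 1 := by split_ifs <;> simp [bits]
    omega

/-- All numbers stored in `s` have at most `B` bits. -/
def State.Bounded (B : ℕ) (s : State) : Prop :=
  (∀ x, bits (s.var x) ≤ B) ∧ ∀ a i, bits (s.arr a i) ≤ B

/-- Each operation at most adds the bit lengths of its operands and one more bit, so growth is
linear with a factor that depends on the expression alone. -/
theorem Expr.exists_bits_le (e : Expr) :
    ∃ W, ∀ B s, State.Bounded B s → bits (e.eval s) ≤ W * (B + 1) := by
  induction e with
  | const z =>
    refine ⟨bits z, fun B s _ => ?_⟩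
    change bits z ≤ _
    nlinarith
  | var x => exact ⟨1, fun B s h => by have := h.1 x; simp only [Expr.eval_var]; omega⟩
  | get a i _ => exact ⟨1, fun B s h => by
      have := h.2 a (i.eval s); simp only [Expr.eval_get]; omega⟩
  | op o e₁ e₂ h₁ h₂ =>
    obtain ⟨W₁, h₁⟩ := h₁
    obtain ⟨W₂, h₂⟩ := h₂
    refine ⟨W₁ + W₂ + 1, fun B s h => ?_⟩
    have := bits_eval_le o (e₁.eval s) (e₂.eval s)
    have := h₁ B s h
    have := h₂ B s h
    change bits (o.eval _ _) ≤ _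
    nlinarith

/-- Quadratic because an operation is charged the product of two bit lengths, each of them linear in
`B` by `Expr.exists_bits_le`. -/
theorem Expr.exists_cost_le (e : Expr) :
    ∃ A, ∀ B s, State.Bounded B s → e.cost s ≤ A * (B + 1) ^ 2 := by
  induction e with
  | const z =>
    refine ⟨1 + bits z, fun B s _ => ?_⟩
    change 1 + bits z ≤ _
    exact Nat.le_mul_of_pos_right _ (by positivity)
  | var x =>
    refine ⟨1, fun B s h => ?_⟩
    have := h.1 x
    change 1 + bits (s.var x) ≤ _
    nlinarith
  | get a i hi =>
    obtain ⟨A, hA⟩ := hi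
    obtain ⟨W, hW⟩ := i.exists_bits_le
    refine ⟨A + W + 1, fun B s h => ?_⟩
    have h₁ := hA B s h
    have h₂ := hW B s h
    have h₃ := h.2 a (i.eval s)
    change i.cost s + (1 + bits (i.eval s) + bits (s.arr a (i.eval s))) ≤ _
    have h₄ : W * (B + 1) ≤ W * (B + 1) ^ 2 := Nat.mul_le_mul_left _ (Nat.le_self_pow (by norm_num) _)
    nlinarith
  | op o e₁ e₂ h₁ h₂ =>
    obtain ⟨A₁, h₁⟩ := h₁
    obtain ⟨A₂, h₂⟩ := h₂
    obtain ⟨W₁, g₁⟩ := e₁.exists_bits_le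
    obtain ⟨W₂, g₂⟩ := e₂.exists_bits_le
    refine ⟨A₁ + A₂ + (1 + W₁) * (1 + W₂), fun B s h => ?_⟩
    change e₁.cost s + e₂.cost s + (1 + bits (e₁.eval s)) * (1 + bits (e₂.eval s)) ≤ _
    have k₁ : 1 + bits (e₁.eval s) ≤ (1 + W₁) * (B + 1) := by have := g₁ B s h; nlinarith
    have k₂ : 1 + bits (e₂.eval s) ≤ (1 + W₂) * (B + 1) := by have := g₂ B s h; nlinarith
    have := Nat.mul_le_mul k₁ k₂
    have := h₁ B s h
    have := h₂ B s h
    nlinarith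

/-! ### Commands with clamped assignments and bounded loops -/

/-- Structured commands.  Assigned values are reduced to the interval `[-Q, Q)`, where `Q` is the
content of variable `5`; `rep x b c` repeats `c` for `x = 0, 1, …`, as often as the content of
variable `b` says. -/
inductive Cmd where
  | set (x : ℕ) (e : Expr)
  | put (a : ℕ) (i e : Expr)
  | seq (c₁ c₂ : Cmd)
  | ite (e : Expr) (c₁ c₂ : Cmd)
  | nop
  | rep (x b : ℕ) (c : Cmd)

infixr:60 " ;; " => Cmd.seq

/-- The representative of `z` modulo `2 * Q` in `[-Q, Q)`. -/
def clamp (Q z : ℤ) : ℤ := (z + Q) % (2 * Q) - Q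

/-- All correctness proofs use this: clamping is invisible as long as the intended value is below
`Q`. -/
theorem clamp_eq {Q z : ℤ} (h : |z| < Q) : clamp Q z = z := by
  have := abs_lt.1 h
  rw [clamp, Int.emod_eq_of_lt (by linarith) (by linarith)]
  ring

theorem abs_clamp_le {Q : ℤ} (hQ : 0 < Q) (z : ℤ) : |clamp Q z| ≤ Q := by
  have h₁ := Int.emod_nonneg (z + Q) (b := 2 * Q) (by linarith)
  have h₂ := Int.emod_lt_of_pos (z + Q) (b := 2 * Q) (by linarith)
  rw [abs_le, clamp]
  constructor <;> linarith

/-- The expression whose value is the clamped value of `e`. -/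
def Expr.clamped (e : Expr) : Expr := (e + v 5) % (2 * v 5) - v 5

@[simp] theorem Expr.eval_clamped (s : State) (e : Expr) :
    e.clamped.eval s = clamp (s.var 5) (e.eval s) := rfl

/-- Iteration of a state transformer with a visible counter `x`. -/
def forIter (x : ℕ) (f : State → State) : ℕ → State → State
  | 0, s => s.setVar x 0
  | k + 1, s => (f (forIter x f k s)).setVar x (k + 1)

/-- The state transformation that a command computes. -/
def Cmd.run : Cmd → State → State
  | .set x e, s => s.setVar x (clamp (s.var 5) (e.eval s))
  | .put a i e, s => s.setArr a (i.eval s) (clamp (s.var 5) (e.eval s))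
  | .seq c₁ c₂, s => c₂.run (c₁.run s)
  | .ite e c₁ c₂, s => if e.eval s ≠ 0 then c₁.run s else c₂.run s
  | .nop, s => s
  | .rep x b c, s => forIter x c.run (s.var b).toNat s

/-- The program that a command stands for. -/
def Cmd.toProg : Cmd → Prog
  | .set x e => .assign x e.clamped
  | .put a i e => .store a i e.clamped
  | .seq c₁ c₂ => .seq c₁.toProg c₂.toProg
  | .ite e c₁ c₂ => .branch e c₁.toProg c₂.toProg
  | .nop => .skip
  | .rep x b c => .seq (.assign x 0)
      (.loop (Expr.le (v x + 1) (v b)) (.seq c.toProg (.assign x (v x + 1))))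

/-- Whether the command assigns to the variable `x`. -/
def Cmd.writes (x : ℕ) : Cmd → Bool
  | .set y _ => x == y
  | .put _ _ _ => false
  | .seq c₁ c₂ => c₁.writes x || c₂.writes x
  | .ite _ c₁ c₂ => c₁.writes x || c₂.writes x
  | .nop => false
  | .rep y _ c => x == y || c.writes x

/-- Whether the command stores into the array `a`. -/
def Cmd.stores (a : ℕ) : Cmd → Bool
  | .set _ _ => false
  | .put b _ _ => a == b
  | .seq c₁ c₂ => c₁.stores a || c₂.stores a
  | .ite _ c₁ c₂ => c₁.stores a || c₂.stores a
  | .nop => false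
  | .rep _ _ c => c.stores a

/-- The variables `0, …, 5` are never assigned to, loops are bounded by the variables `2, 3, 4`, and
loop counters are not assigned to in the loop. -/
def Cmd.wf : Cmd → Bool
  | .set x _ => decide (6 ≤ x)
  | .put _ _ _ => true
  | .seq c₁ c₂ => c₁.wf && c₂.wf
  | .ite _ c₁ c₂ => c₁.wf && c₂.wf
  | .nop => true
  | .rep x b c => decide (6 ≤ x) && decide (2 ≤ b) && decide (b ≤ 4) && !c.writes x && c.wf

/-- A frame rule whose hypothesis is decided by computation, so that for concrete commands it is
proved by `rfl`. -/
theorem Cmd.run_var (c : Cmd) {x : ℕ} (h : c.writes x = false) (s : State) :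
    (c.run s).var x = s.var x := by
  induction c generalizing s with
  | set y e =>
    have : x ≠ y := by simpa [Cmd.writes] using h
    simp [Cmd.run, State.setVar, this]
  | put a i e => rfl
  | seq c₁ c₂ h₁ h₂ =>
    simp only [Cmd.writes, Bool.or_eq_false_iff] at h
    simp only [Cmd.run]
    rw [h₂ h.2, h₁ h.1]
  | ite e c₁ c₂ h₁ h₂ =>
    simp only [Cmd.writes, Bool.or_eq_false_iff] at h
    simp only [Cmd.run]
    split_ifs
    exacts [h₁ h.1 s, h₂ h.2 s]
  | nop => rfl
  | rep y b c hc =>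
    simp only [Cmd.writes, Bool.or_eq_false_iff, beq_eq_false_iff_ne] at h
    simp only [Cmd.run]
    induction (s.var b).toNat with
    | zero => simp [forIter, State.setVar, h.1]
    | succ k ih => simp [forIter, State.setVar, h.1, hc h.2, ih]

theorem Cmd.run_arr (c : Cmd) {a : ℕ} (h : c.stores a = false) (s : State) :
    (c.run s).arr a = s.arr a := by
  induction c generalizing s with
  | set y e => rfl
  | put b i e =>
    have : a ≠ b := by simpa [Cmd.stores] using h
    simp [Cmd.run, State.setArr, this]
  | seq c₁ c₂ h₁ h₂ =>
    simp only [Cmd.stores, Bool.or_eq_false_iff] at h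
    simp only [Cmd.run]
    rw [h₂ h.2, h₁ h.1]
  | ite e c₁ c₂ h₁ h₂ =>
    simp only [Cmd.stores, Bool.or_eq_false_iff] at h
    simp only [Cmd.run]
    split_ifs
    exacts [h₁ h.1 s, h₂ h.2 s]
  | nop => rfl
  | rep y b c hc =>
    simp only [Cmd.stores] at h
    simp only [Cmd.run]
    induction (s.var b).toNat with
    | zero => simp [forIter, State.setVar]
    | succ k ih => simp [forIter, State.setVar, hc h, ih]

/-- The loop bounds and the modulus `Q` therefore survive every well-formed command, which makes
`State.Ready` persist. -/
theorem Cmd.writes_of_wf {c : Cmd} (h : c.wf) {x : ℕ} (hx : x < 6) : c.writes x = false := by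
  induction c with
  | set y e => simp only [Cmd.wf, decide_eq_true_eq] at h; simp [Cmd.writes]; omega
  | put a i e => rfl
  | seq c₁ c₂ h₁ h₂ =>
    simp only [Cmd.wf, Bool.and_eq_true] at h
    simp [Cmd.writes, h₁ h.1, h₂ h.2]
  | ite e c₁ c₂ h₁ h₂ =>
    simp only [Cmd.wf, Bool.and_eq_true] at h
    simp [Cmd.writes, h₁ h.1, h₂ h.2]
  | nop => rfl
  | rep y b c hc =>
    simp only [Cmd.wf, Bool.and_eq_true, decide_eq_true_eq] at h
    simp [Cmd.writes, hc h.2]; omega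

theorem State.Bounded.setVar {B : ℕ} {s : State} (h : s.Bounded B) (x : ℕ) {z : ℤ}
    (hz : bits z ≤ B) : (s.setVar x z).Bounded B :=
  ⟨fun y => by
    by_cases hy : y = x
    · subst hy; simpa [State.setVar] using hz
    · simpa [State.setVar, hy] using h.1 y, h.2⟩

theorem State.Bounded.setArr {B : ℕ} {s : State} (h : s.Bounded B) (a : ℕ) (i : ℤ) {z : ℤ}
    (hz : bits z ≤ B) : (s.setArr a i z).Bounded B := by
  refine ⟨h.1, fun b j => ?_⟩
  by_cases hb : b = a
  · subst hb
    by_cases hj : j = i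
    · subst hj; simpa [State.setArr] using hz
    · simpa [State.setArr, hj] using h.2 b j
  · simpa [State.setArr, hb] using h.2 b j

theorem exec_loop {e : Expr} {c : Prog} {n C : ℕ} {S : ℕ → State}
    (hstep : ∀ k < n, e.eval (S k) ≠ 0 ∧ ∃ t ≤ C, Exec c (S k) (S (k + 1)) t)
    (hend : e.eval (S n) = 0) (hcost : ∀ k ≤ n, e.cost (S k) ≤ C) :
    ∃ t ≤ (n + 1) * (2 * C + 1), Exec (.loop e c) (S 0) (S n) t := by
  induction n generalizing S with
  | zero =>
    refine ⟨_, ?_, Exec.loop_false hend⟩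
    have := hcost 0 le_rfl
    omega
  | succ n ih =>
    obtain ⟨h₀, t₀, ht₀, hex⟩ := hstep 0 (by omega)
    obtain ⟨t, ht, h⟩ := ih (S := fun k => S (k + 1)) (fun k hk => hstep (k + 1) (by omega)) hend
      (fun k hk => hcost (k + 1) (by omega))
    refine ⟨_, ?_, Exec.loop_true h₀ hex h⟩
    have := hcost 0 (by omega)
    nlinarith

/-- The conditions on the read-only variables under which commands run within a polynomial bound. -/
structure State.Ready (B : ℕ) (s : State) : Prop where
  bounded : s.Bounded B
  pos : 0 < s.var 5
  bound : ∀ b, 2 ≤ b → b ≤ 4 → s.var b ≤ B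

theorem bits_natCast_le (n : ℕ) : bits n ≤ n := by
  rw [bits_le_iff]
  simpa using (by exact_mod_cast Nat.lt_two_pow_self : (n : ℤ) < 2 ^ n)

/-- Clamping keeps all stored numbers below the bit length of `Q`, at most `B`, and every loop has
at most `B` rounds. The nesting depth is fixed by the command, so the cost is polynomial in `B`,
without any information on what is computed. -/
theorem Cmd.exec_toProg (c : Cmd) (hc : c.wf) :
    ∃ A k, ∀ B s, State.Ready B s →
      (c.run s).Bounded B ∧ ∃ t ≤ A * (B + 1) ^ k, Exec c.toProg s (c.run s) t := by
  induction c with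
  | set x e =>
    obtain ⟨A, hA⟩ := e.clamped.exists_cost_le
    refine ⟨A + 1, 2, fun B s h => ?_⟩
    have hb : bits (clamp (s.var 5) (e.eval s)) ≤ B :=
      (bits_mono ((abs_clamp_le h.pos _).trans (le_abs_self _))).trans (h.bounded.1 5)
    refine ⟨h.bounded.setVar _ hb, _, ?_, Exec.assign _ _ _⟩
    have := hA B s h.bounded
    rw [Expr.eval_clamped]
    nlinarith
  | put a i e =>
    obtain ⟨A, hA⟩ := e.clamped.exists_cost_le
    obtain ⟨A', hA'⟩ := i.exists_cost_le
    obtain ⟨W, hW⟩ := i.exists_bits_le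
    refine ⟨A + A' + W + 1, 2, fun B s h => ?_⟩
    have hb : bits (clamp (s.var 5) (e.eval s)) ≤ B :=
      (bits_mono ((abs_clamp_le h.pos _).trans (le_abs_self _))).trans (h.bounded.1 5)
    refine ⟨h.bounded.setArr _ _ hb, _, ?_, Exec.store _ _ _ _⟩
    have := hA B s h.bounded
    have := hA' B s h.bounded
    have := hW B s h.bounded
    have : W * (B + 1) ≤ W * (B + 1) ^ 2 :=
      Nat.mul_le_mul_left _ (Nat.le_self_pow (by norm_num) _)
    rw [Expr.eval_clamped]
    nlinarith
  | seq c₁ c₂ h₁ h₂ =>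
    simp only [Cmd.wf, Bool.and_eq_true] at hc
    obtain ⟨A₁, k₁, h₁⟩ := h₁ hc.1
    obtain ⟨A₂, k₂, h₂⟩ := h₂ hc.2
    refine ⟨A₁ + A₂, k₁ + k₂, fun B s h => ?_⟩
    obtain ⟨hb₁, t₁, ht₁, e₁⟩ := h₁ B s h
    have hr : State.Ready B (c₁.run s) := ⟨hb₁, by
      rw [c₁.run_var (Cmd.writes_of_wf hc.1 (by norm_num))]; exact h.pos, fun b hb hb' => by
      rw [c₁.run_var (Cmd.writes_of_wf hc.1 (by omega))]; exact h.bound b hb hb'⟩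
    obtain ⟨hb₂, t₂, ht₂, e₂⟩ := h₂ B _ hr
    refine ⟨hb₂, _, ?_, Exec.seq e₁ e₂⟩
    have l₁ : (B + 1) ^ k₁ ≤ (B + 1) ^ (k₁ + k₂) := Nat.pow_le_pow_right (by omega) (by omega)
    have l₂ : (B + 1) ^ k₂ ≤ (B + 1) ^ (k₁ + k₂) := Nat.pow_le_pow_right (by omega) (by omega)
    have := Nat.mul_le_mul_left A₁ l₁
    have := Nat.mul_le_mul_left A₂ l₂
    rw [add_mul]
    omega
  | ite e c₁ c₂ h₁ h₂ =>
    simp only [Cmd.wf, Bool.and_eq_true] at hc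
    obtain ⟨A₁, k₁, h₁⟩ := h₁ hc.1
    obtain ⟨A₂, k₂, h₂⟩ := h₂ hc.2
    obtain ⟨A, hA⟩ := e.exists_cost_le
    refine ⟨A₁ + A₂ + A + 1, k₁ + k₂ + 2, fun B s h => ?_⟩
    obtain ⟨hb₁, t₁, ht₁, e₁⟩ := h₁ B s h
    obtain ⟨hb₂, t₂, ht₂, e₂⟩ := h₂ B s h
    have l₁ : (B + 1) ^ k₁ ≤ (B + 1) ^ (k₁ + k₂ + 2) := Nat.pow_le_pow_right (by omega) (by omega)
    have l₂ : (B + 1) ^ k₂ ≤ (B + 1) ^ (k₁ + k₂ + 2) := Nat.pow_le_pow_right (by omega) (by omega)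
    have l₃ : (B + 1) ^ 2 ≤ (B + 1) ^ (k₁ + k₂ + 2) := Nat.pow_le_pow_right (by omega) (by omega)
    have := Nat.mul_le_mul_left A₁ l₁
    have := Nat.mul_le_mul_left A₂ l₂
    have := Nat.mul_le_mul_left A l₃
    have : 1 ≤ (B + 1) ^ (k₁ + k₂ + 2) := Nat.one_le_pow _ _ (by omega)
    have := hA B s h.bounded
    simp only [Cmd.run]
    split_ifs with he
    · exact ⟨hb₁, _, by rw [add_mul, add_mul, add_mul]; omega, Exec.branch_true he e₁⟩
    · exact ⟨hb₂, _, by rw [add_mul, add_mul, add_mul]; omega,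
        Exec.branch_false (not_not.1 he) e₂⟩
  | nop => exact ⟨1, 0, fun B s h => ⟨h.bounded, 1, by simp, Exec.skip _⟩⟩
  | rep x b c ih =>
    simp only [Cmd.wf, Bool.and_eq_true, decide_eq_true_eq, Bool.not_eq_true'] at hc
    obtain ⟨⟨⟨⟨hx, hb2⟩, hb4⟩, hcx⟩, hcw⟩ := hc
    obtain ⟨A, k, ih⟩ := ih hcw
    obtain ⟨A₁, hA₁⟩ := (Expr.le (v x + 1) (v b)).exists_cost_le
    obtain ⟨A₂, hA₂⟩ := (v x + 1).exists_cost_le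
    -- One round, and each test, costs at most `(A + A₁ + A₂ + 1) * (B + 1) ^ (k + 2)`. The at most
    -- `B` rounds and the last test contribute one more power of `B + 1`.
    refine ⟨2 + 2 * (A + A₁ + A₂ + 1) + 1, k + 3, fun B s h => ?_⟩
    set n := (s.var b).toNat with hn
    have hnB : n ≤ B := by have := h.bound b hb2 hb4; omega
    let S : ℕ → State := fun j => forIter x c.run j s
    have hro : ∀ j, ∀ y, y < 6 → (S j).var y = s.var y := by
      intro j y hy
      have hyx : y ≠ x := by omega
      induction j with
      | zero => simp [S, forIter, State.setVar, hyx]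
      | succ j ihj =>
        have := c.run_var (Cmd.writes_of_wf hcw hy) (S j)
        simp [S, forIter, State.setVar, hyx] at this ihj ⊢
        rw [this, ihj]
    have hSx : ∀ j, (S j).var x = j := by
      intro j
      cases j <;> simp [S, forIter, State.setVar]
    have hbits : ∀ j ≤ n, bits (j : ℤ) ≤ B := fun j hj => (bits_natCast_le j).trans (by omega)
    have hready : ∀ j ≤ n, (S j).Ready B := by
      intro j hj
      refine ⟨?_, by rw [hro j 5 (by norm_num)]; exact h.pos, fun b hb hb' => by
        rw [hro j b (by omega)]; exact h.bound b hb hb'⟩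
      induction j with
      | zero => exact h.bounded.setVar x (by simp [bits])
      | succ j ihj =>
        have hj' := ihj (by omega)
        have hr : (S j).Ready B := ⟨hj', by rw [hro j 5 (by norm_num)]; exact h.pos,
          fun b hb hb' => by rw [hro j b (by omega)]; exact h.bound b hb hb'⟩
        exact (ih B _ hr).1.setVar x (by exact_mod_cast hbits (j + 1) hj)
    have hB2 : 1 ≤ (B + 1) ^ (k + 2) := Nat.one_le_pow _ _ (by omega)
    have hB1 : B + 1 ≤ (B + 1) ^ (k + 2) := Nat.le_self_pow (by omega) _
    have l₂ : (B + 1) ^ k ≤ (B + 1) ^ (k + 2) := Nat.pow_le_pow_right (by omega) (by omega)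
    have l₃ : (B + 1) ^ 2 ≤ (B + 1) ^ (k + 2) := Nat.pow_le_pow_right (by omega) (by omega)
    have hloop := exec_loop (e := Expr.le (v x + 1) (v b)) (c := .seq c.toProg (.assign x (v x + 1)))
      (n := n) (C := (A + A₁ + A₂ + 1) * (B + 1) ^ (k + 2)) (S := S) (fun j hj => by
        constructor
        · have : (j : ℤ) + 1 ≤ s.var b := by omega
          simp [hSx, hro j b (by omega), this]
        · obtain ⟨-, t, ht, hex⟩ := ih B _ (hready j hj.le)
          have hx' : (c.run (S j)).var x = j := by rw [c.run_var hcx, hSx]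
          have hev : (v x + 1).eval (c.run (S j)) = j + 1 := by simp [hx']
          have hS : S (j + 1) = (c.run (S j)).setVar x ((v x + 1).eval (c.run (S j))) := by
            rw [hev]; rfl
          have hbd := (ih B _ (hready j hj.le)).1
          refine ⟨_, ?_, hS ▸ Exec.seq hex (Exec.assign _ _ _)⟩
          have := hA₂ B _ hbd
          have h1 := hbits (j + 1) hj
          push_cast at h1
          rw [hev]
          have := Nat.mul_le_mul_left A l₂
          have := Nat.mul_le_mul_left A₂ l₃
          have := Nat.zero_le (A₁ * (B + 1) ^ (k + 2))
          rw [add_mul, add_mul, add_mul]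
          omega) (by
        have : ¬ ((n : ℤ) + 1 ≤ s.var b) := by omega
        simp [hSx, hro n b (by omega), this]) (fun j hj => by
        have := hA₁ B _ (hready j hj).bounded
        have := Nat.mul_le_mul_left A₁ l₃
        rw [add_mul, add_mul, add_mul]
        have := Nat.zero_le (A * (B + 1) ^ (k + 2))
        have := Nat.zero_le (A₂ * (B + 1) ^ (k + 2))
        omega)
    obtain ⟨t, ht, hex⟩ := hloop
    refine ⟨(hready n le_rfl).bounded, _, ?_, Exec.seq (Exec.assign s x 0) hex⟩
    have hc0 : (0 : Expr).cost s = 1 := rfl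
    have hb0 : bits ((0 : Expr).eval s) = 0 := rfl
    rw [hc0, hb0]
    have h3 : (B + 1) ^ (k + 3) = (B + 1) * (B + 1) ^ (k + 2) := by ring
    have hn1 : (n + 1) * (2 * ((A + A₁ + A₂ + 1) * (B + 1) ^ (k + 2)) + 1) ≤
        (B + 1) * (2 * ((A + A₁ + A₂ + 1) * (B + 1) ^ (k + 2)) + 1) :=
      Nat.mul_le_mul_right _ (by omega)
    rw [h3]
    have : B + 1 ≤ (B + 1) * (B + 1) ^ (k + 2) := Nat.le_mul_of_pos_right _ (by omega)
    calc 1 + (1 + 0) + t ≤ 2 + (B + 1) * (2 * ((A + A₁ + A₂ + 1) * (B + 1) ^ (k + 2)) + 1) := by omega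
      _ = 2 + 2 * (A + A₁ + A₂ + 1) * ((B + 1) * (B + 1) ^ (k + 2)) + (B + 1) := by ring
      _ ≤ _ := by
        generalize (B + 1) * (B + 1) ^ (k + 2) = Y at *
        have : 1 ≤ Y := by omega
        nlinarith

end LogCost

/-! ### Gram–Schmidt vectors, Gram determinants and the effect of a swap. -/

namespace LatticeReduction

open scoped RealInnerProductSpace

set_option linter.unusedSectionVars false

variable {E : Type*} [NormedAddCommGroup E] [InnerProductSpace ℝ E] [FiniteDimensional ℝ E]

/-- The span of the first `k` vectors. -/
def spanLT (b : ℕ → E) (k : ℕ) : Submodule ℝ E := Submodule.span ℝ (b '' Set.Iio k)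

/-- The component of `x` orthogonal to the first `k` vectors. -/
noncomputable def prj (b : ℕ → E) (k : ℕ) (x : E) : E := x - (spanLT b k).starProjection x

/-- The Gram–Schmidt vectors. -/
noncomputable def gs (b : ℕ → E) (k : ℕ) : E := prj b k (b k)

/-- The Gram determinants, as products of squared lengths of Gram–Schmidt vectors. -/
noncomputable def gramDet (b : ℕ → E) (k : ℕ) : ℝ := ∏ j ∈ Finset.range k, ‖gs b j‖ ^ 2

theorem mem_spanLT (b : ℕ → E) {j k : ℕ} (h : j < k) : b j ∈ spanLT b k :=
  Submodule.subset_span ⟨j, h, rfl⟩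

theorem spanLT_mono (b : ℕ → E) {j k : ℕ} (h : j ≤ k) : spanLT b j ≤ spanLT b k :=
  Submodule.span_mono (Set.image_mono (Set.Iio_subset_Iio h))

theorem spanLT_succ (b : ℕ → E) (k : ℕ) : spanLT b (k + 1) = spanLT b k ⊔ Submodule.span ℝ {b k} := by
  rw [spanLT, spanLT, ← Submodule.span_union, ← Set.image_singleton, ← Set.image_union]
  congr 2
  ext j
  simp only [Set.mem_Iio, Set.mem_union, Set.mem_singleton_iff]
  omega

theorem inner_prj (b : ℕ → E) (k : ℕ) (x : E) {y : E} (hy : y ∈ spanLT b k) :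
    ⟪prj b k x, y⟫ = 0 :=
  Submodule.starProjection_inner_eq_zero x y hy

theorem sub_prj_mem (b : ℕ → E) (k : ℕ) (x : E) : x - prj b k x ∈ spanLT b k := by
  rw [prj, sub_sub_cancel]
  exact Submodule.starProjection_apply_mem _ _

/-- The two conditions characterize the orthogonal component; later identities between projections
are obtained by checking them. -/
theorem eq_prj (b : ℕ → E) (k : ℕ) {x z : E} (h₁ : x - z ∈ spanLT b k)
    (h₂ : ∀ y ∈ spanLT b k, ⟪z, y⟫ = 0) : z = prj b k x := by
  have := Submodule.eq_starProjection_of_mem_of_inner_eq_zero (u := x) h₁ (by simpa using h₂)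
  rw [prj, this, sub_sub_cancel]

theorem prj_eq_zero (b : ℕ → E) {k : ℕ} {x : E} (h : x ∈ spanLT b k) : prj b k x = 0 :=
  (eq_prj b k (by simpa using h) (by simp)).symm

@[simp] theorem prj_zero (b : ℕ → E) (x : E) : prj b 0 x = x := by
  refine (eq_prj b 0 (by simp) fun y hy => ?_).symm
  have : y = 0 := by simpa [spanLT] using hy
  simp [this]

/-- The projection depends only on the span and on `x` modulo it. Size reduction and swaps preserve
most Gram–Schmidt vectors for this reason. -/
theorem prj_congr {b b' : ℕ → E} {k : ℕ} (h : spanLT b' k = spanLT b k) {x y : E}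
    (hx : x - y ∈ spanLT b k) : prj b' k x = prj b k y := by
  refine eq_prj b k ?_ fun z hz => inner_prj b' k x (h ▸ hz)
  have h₁ := sub_prj_mem b' k x
  rw [h] at h₁
  have := Submodule.sub_mem _ h₁ hx
  simpa using this

theorem inner_prj_prj (b : ℕ → E) (k : ℕ) (x y : E) : ⟪prj b k x, prj b k y⟫ = ⟪x, prj b k y⟫ := by
  have := inner_prj b k y (sub_prj_mem b k x)
  rw [real_inner_comm, inner_sub_left] at this
  linarith

theorem inner_gs_self (b : ℕ → E) (k : ℕ) : ⟪b k, gs b k⟫ = ‖gs b k‖ ^ 2 := by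
  rw [gs, ← inner_prj_prj, real_inner_self_eq_norm_sq]

theorem gs_mem (b : ℕ → E) {j k : ℕ} (h : j < k) : gs b j ∈ spanLT b k := by
  have h₁ := spanLT_mono b h.le (sub_prj_mem b j (b j))
  have := Submodule.sub_mem _ (mem_spanLT b h) h₁
  simpa [gs] using this

theorem inner_gs_of_lt (b : ℕ → E) {j k : ℕ} (h : j < k) : ⟪b j, gs b k⟫ = 0 := by
  rw [real_inner_comm]
  exact inner_prj b k _ (mem_spanLT b h)

theorem prj_succ (b : ℕ → E) (k : ℕ) (x : E) :
    prj b (k + 1) x = prj b k x - (⟪x, gs b k⟫ / ‖gs b k‖ ^ 2) • gs b k := by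
  symm
  -- If `gs b k = 0`, both sides are zero, as division by zero gives zero. So no linear independence
  -- is needed.
  have hc : ⟪x, gs b k⟫ / ‖gs b k‖ ^ 2 * ‖gs b k‖ ^ 2 = ⟪x, gs b k⟫ := by
    by_cases h : gs b k = 0
    · simp [h]
    · exact div_mul_cancel₀ _ (by positivity)
  apply eq_prj
  · rw [sub_sub_eq_add_sub, add_sub_right_comm]
    exact Submodule.add_mem _ (spanLT_mono b k.le_succ (sub_prj_mem b k x))
      (Submodule.smul_mem _ _ (gs_mem b k.lt_succ_self))
  · intro y hy
    rw [spanLT_succ, Submodule.mem_sup] at hy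
    obtain ⟨u, hu, w, hw, rfl⟩ := hy
    obtain ⟨r, rfl⟩ := Submodule.mem_span_singleton.1 hw
    have h₁ : ⟪prj b k x, u⟫ = 0 := inner_prj b k x hu
    have h₂ : ⟪gs b k, u⟫ = 0 := inner_prj b k _ hu
    have h₃ : ⟪gs b k, b k⟫ = ‖gs b k‖ ^ 2 := by rw [real_inner_comm, inner_gs_self]
    have h₄ : ⟪prj b k x, b k⟫ = ⟪x, gs b k⟫ := by
      rw [real_inner_comm, ← inner_prj_prj, real_inner_comm, inner_prj_prj, gs]
    rw [inner_add_right, inner_smul_right, inner_sub_left, inner_sub_left, inner_smul_left,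
      inner_smul_left, h₁, h₂, h₃, h₄]
    simp [hc]

theorem inner_prj_eq (b : ℕ → E) (k : ℕ) (x y : E) :
    ⟪prj b k x, y⟫ = ⟪x, y⟫ - ∑ j ∈ Finset.range k, ⟪x, gs b j⟫ * ⟪y, gs b j⟫ / ‖gs b j‖ ^ 2 := by
  induction k with
  | zero => simp
  | succ k ih =>
    rw [prj_succ, inner_sub_left, ih, Finset.sum_range_succ, inner_smul_left,
      real_inner_comm y (gs b k)]
    simp only [conj_trivial]
    ring

theorem norm_sq_prj (b : ℕ → E) (k : ℕ) (x : E) :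
    ‖prj b k x‖ ^ 2 = ‖x‖ ^ 2 - ∑ j ∈ Finset.range k, ⟪x, gs b j⟫ ^ 2 / ‖gs b j‖ ^ 2 := by
  have := inner_prj_eq b k x (prj b k x)
  rw [← real_inner_self_eq_norm_sq, inner_prj_prj, real_inner_comm, inner_prj_eq,
    real_inner_self_eq_norm_sq]
  simp only [sq]

theorem norm_prj_le (b : ℕ → E) (k : ℕ) (x : E) : ‖prj b k x‖ ≤ ‖x‖ := by
  rw [← sq_le_sq₀ (norm_nonneg _) (norm_nonneg _), norm_sq_prj, sub_le_self_iff]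
  exact Finset.sum_nonneg fun j _ => by positivity

theorem spanLT_eq_of_sub_mem {b b' : ℕ → E} (h : ∀ j, b' j - b j ∈ spanLT b j) (k : ℕ) :
    spanLT b' k = spanLT b k := by
  induction k with
  | zero => simp [spanLT]
  | succ k ih =>
    rw [spanLT_succ, spanLT_succ, ih]
    apply le_antisymm <;> refine sup_le le_sup_left ?_ <;>
      rw [Submodule.span_singleton_le_iff_mem, Submodule.mem_sup]
    · exact ⟨_, h k, b k, Submodule.mem_span_singleton_self _, by simp⟩
    · exact ⟨_, Submodule.neg_mem _ (h k), b' k, Submodule.mem_span_singleton_self _, by simp⟩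

/-- Size reduction is a change of this kind, so it leaves Gram determinants and potential alone. -/
theorem gs_eq_of_sub_mem {b b' : ℕ → E} (h : ∀ j, b' j - b j ∈ spanLT b j) : gs b' = gs b :=
  funext fun k => prj_congr (spanLT_eq_of_sub_mem h k) (h k)

theorem gramDet_congr {b b' : ℕ → E} (h : gs b' = gs b) : gramDet b' = gramDet b := by
  funext k; simp only [gramDet, h]

theorem gramDet_succ (b : ℕ → E) (k : ℕ) : gramDet b (k + 1) = gramDet b k * ‖gs b k‖ ^ 2 :=
  Finset.prod_range_succ _ _

theorem gramDet_pos {b : ℕ → E} {k : ℕ} (h : ∀ j < k, gs b j ≠ 0) : 0 < gramDet b k :=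
  Finset.prod_pos fun j hj => by have := h j (Finset.mem_range.1 hj); positivity

theorem gramDet_le {b : ℕ → E} {k : ℕ} {R : ℝ} (h : ∀ j < k, ‖gs b j‖ ≤ R) :
    gramDet b k ≤ R ^ (2 * k) := by
  rw [pow_mul]
  calc gramDet b k ≤ ∏ j ∈ Finset.range k, R ^ 2 := by
        refine Finset.prod_le_prod (fun j _ => by positivity) fun j hj => ?_
        have := h j (Finset.mem_range.1 hj)
        gcongr
    _ = _ := by simp

/-! ### Integrality -/

/-- The Gram matrix factors as `U * D * Uᵀ`, with `U` the unit lower triangular matrix of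
Gram–Schmidt coefficients and `D` the diagonal matrix of squared lengths. -/
theorem det_gram_eq {b : ℕ → E} {k : ℕ} (h : ∀ j < k, gs b j ≠ 0) :
    (Matrix.of fun i j : Fin k => ⟪b i, b j⟫).det = gramDet b k := by
  let U : Matrix (Fin k) (Fin k) ℝ := Matrix.of fun i j => ⟪b i, gs b j⟫ / ‖gs b j‖ ^ 2
  let D : Fin k → ℝ := fun j => ‖gs b j‖ ^ 2
  have hU : U.det = 1 := by
    rw [Matrix.det_of_isLowerTriangular U]
    · refine Finset.prod_eq_one fun i _ => ?_
      have : gs b i ≠ 0 := h i i.2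
      simp only [U, Matrix.of_apply, inner_gs_self]
      exact div_self (by positivity)
    · intro i j hij
      have hij' : (i : ℕ) < j := by simpa using hij
      simp [U, inner_gs_of_lt b hij']
  have hG : (Matrix.of fun i j : Fin k => ⟪b i, b j⟫) = U * Matrix.diagonal D * U.transpose := by
    ext i j
    have := inner_prj_eq b k (b i) (b j)
    rw [prj_eq_zero b (mem_spanLT b i.2), inner_zero_left, Finset.sum_range] at this
    rw [Matrix.of_apply, Matrix.mul_apply, sub_eq_zero.1 this.symm]
    refine Finset.sum_congr rfl fun l _ => ?_
    rw [Matrix.mul_diagonal, Matrix.transpose_apply]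
    have : ‖gs b l‖ ≠ 0 := norm_ne_zero_iff.2 (h l l.2)
    simp only [U, D, Matrix.of_apply]
    field_simp
  rw [hG, Matrix.det_mul, Matrix.det_mul, Matrix.det_transpose, hU, Matrix.det_diagonal, gramDet,
    Finset.prod_range]
  simp [D]

/-- Cramer's rule: the coefficients of the projection solve a linear system with the Gram matrix, so
multiplication by its determinant clears all denominators. The solution is the adjugate applied to
the inner products with `x`. For an integral basis this makes the scaled Gram–Schmidt vectors
integral. -/
theorem exists_int_smul_prj {b : ℕ → E} {k : ℕ} (h : ∀ j < k, gs b j ≠ 0) {x : E}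
    (hb : ∀ i < k, ∀ j < k, ∃ z : ℤ, ⟪b i, b j⟫ = z) (hx : ∀ i < k, ∃ z : ℤ, ⟪b i, x⟫ = z) :
    ∃ (d : ℤ) (y : Fin k → ℤ), gramDet b k = d ∧
      gramDet b k • prj b k x = (d : ℝ) • x - ∑ i, (y i : ℝ) • b i := by
  choose! g hg using hb
  choose! w hw using hx
  let G : Matrix (Fin k) (Fin k) ℤ := Matrix.of fun i j => g i j
  let W : Fin k → ℤ := fun i => w i
  have hGr : (Matrix.of fun i j : Fin k => ⟪b i, b j⟫) = G.map (Int.castRingHom ℝ) := by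
    ext i j
    simp [G, hg i i.2 j j.2]
  have hd : gramDet b k = (G.det : ℤ) := by
    rw [← det_gram_eq h, hGr]
    exact ((Int.castRingHom ℝ).map_det G).symm
  refine ⟨G.det, G.adjugate.mulVec W, hd, ?_⟩
  have hsum : (∑ i, ((G.adjugate.mulVec W) i : ℝ) • b i) ∈ spanLT b k :=
    Submodule.sum_mem _ fun i _ => Submodule.smul_mem _ _ (mem_spanLT b i.2)
  have key : (1 / gramDet b k) • ((G.det : ℝ) • x - ∑ i, ((G.adjugate.mulVec W) i : ℝ) • b i) =
      prj b k x := by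
    have hpos := gramDet_pos h
    apply eq_prj
    · rw [← hd, smul_sub, smul_smul, one_div_mul_cancel hpos.ne', one_smul, sub_sub_cancel]
      exact Submodule.smul_mem _ _ hsum
    · intro y hy
      refine Submodule.span_induction ?_ (by simp) ?_ ?_ hy
      · rintro _ ⟨j, hj, rfl⟩
        have hj : j < k := hj
        have e : G.mulVec (G.adjugate.mulVec W) = G.det • W := by
          rw [Matrix.mulVec_mulVec, Matrix.mul_adjugate, Matrix.smul_mulVec, Matrix.one_mulVec]
        have e' := congrFun e ⟨j, hj⟩
        change ∑ i : Fin k, g j i * (G.adjugate.mulVec W) i = G.det * w j at e'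
        have e'' : ∑ i : Fin k, (g j i : ℝ) * ((G.adjugate.mulVec W) i : ℝ) = G.det * w j := by
          exact_mod_cast congrArg (Int.cast (R := ℝ)) e'
        rw [inner_smul_left, inner_sub_left, inner_smul_left, sum_inner]
        simp only [inner_smul_left, conj_trivial]
        rw [real_inner_comm, hw j hj]
        have : ∀ i : Fin k, ⟪b i, b j⟫ = g j i := fun i => by rw [real_inner_comm, hg j hj i i.2]
        simp only [this]
        rw [mul_eq_zero]
        right
        rw [sub_eq_zero, ← e'']
        exact Finset.sum_congr rfl fun i _ => mul_comm _ _
      · intro u w _ _ hu hw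
        rw [inner_add_right, hu, hw, add_zero]
      · intro r u _ hu
        rw [inner_smul_right, hu, mul_zero]
  rw [← key, smul_smul, mul_one_div_cancel (gramDet_pos h).ne', one_smul]

/-! ### Swapping two consecutive vectors -/

/-- The family with the vectors `k` and `k + 1` exchanged. -/
def swapAt (b : ℕ → E) (k : ℕ) : ℕ → E := fun j => b (Equiv.swap k (k + 1) j)

theorem spanLT_swapAt (b : ℕ → E) {j k : ℕ} (h : j ≠ k + 1) : spanLT (swapAt b k) j = spanLT b j := by
  have : swapAt b k '' Set.Iio j = b '' Set.Iio j := by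
    rw [show swapAt b k = b ∘ Equiv.swap k (k + 1) from rfl, Set.image_comp]
    congr 1
    ext i
    simp only [Set.mem_image_equiv, Equiv.symm_swap, Set.mem_Iio]
    rcases eq_or_ne i k with rfl | h₁
    · rw [Equiv.swap_apply_left]; omega
    rcases eq_or_ne i (k + 1) with rfl | h₂
    · rw [Equiv.swap_apply_right]; omega
    rw [Equiv.swap_apply_of_ne_of_ne h₁ h₂]
  rw [spanLT, spanLT, this]

theorem gs_swapAt_of_ne (b : ℕ → E) {j k : ℕ} (h₁ : j ≠ k) (h₂ : j ≠ k + 1) :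
    gs (swapAt b k) j = gs b j := by
  refine prj_congr (spanLT_swapAt b h₂) ?_
  simp [swapAt, Equiv.swap_apply_of_ne_of_ne h₁ h₂]

/-- After the swap `b (k + 1)` is only projected off the first `k` vectors, so it keeps its
component along `gs b k`. -/
theorem gs_swapAt_left (b : ℕ → E) (k : ℕ) :
    gs (swapAt b k) k = gs b (k + 1) + (⟪b (k + 1), gs b k⟫ / ‖gs b k‖ ^ 2) • gs b k := by
  rw [gs, prj_congr (y := b (k + 1)) (spanLT_swapAt b (by omega)) (by simp [swapAt]), gs, prj_succ]
  simp

theorem inner_gs_gs (b : ℕ → E) {j k : ℕ} (h : j < k) : ⟪gs b k, gs b j⟫ = 0 :=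
  inner_prj b k _ (gs_mem b h)

theorem norm_sq_gs_swapAt_left (b : ℕ → E) (k : ℕ) :
    ‖gs (swapAt b k) k‖ ^ 2 = ‖gs b (k + 1)‖ ^ 2 + ⟪b (k + 1), gs b k⟫ ^ 2 / ‖gs b k‖ ^ 2 := by
  rw [gs_swapAt_left, norm_add_sq_real, inner_smul_right, inner_gs_gs b k.lt_succ_self, norm_smul,
    mul_pow, Real.norm_eq_abs, sq_abs, div_pow]
  by_cases h : gs b k = 0
  · simp [h]
  · have : ‖gs b k‖ ≠ 0 := norm_ne_zero_iff.2 h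
    field_simp
    ring

theorem norm_sq_gs_swapAt_right {b : ℕ → E} {k : ℕ} (h : gs b k ≠ 0) :
    ‖gs (swapAt b k) (k + 1)‖ ^ 2 =
      ‖gs b k‖ ^ 2 - ⟪b (k + 1), gs b k⟫ ^ 2 / ‖gs (swapAt b k) k‖ ^ 2 := by
  have hb : swapAt b k (k + 1) = b k := by simp [swapAt]
  have hn : ‖gs b k‖ ≠ 0 := norm_ne_zero_iff.2 h
  have e₁ : ‖gs (swapAt b k) (k + 1)‖ ^ 2 = ‖prj (swapAt b k) k (b k)‖ ^ 2
      - ⟪b k, gs (swapAt b k) k⟫ ^ 2 / ‖gs (swapAt b k) k‖ ^ 2 := by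
    rw [gs, hb, norm_sq_prj, Finset.sum_range_succ, norm_sq_prj]
    ring
  have e₂ : prj (swapAt b k) k (b k) = gs b k := prj_congr (spanLT_swapAt b (by omega)) (by simp)
  have e₃ : ⟪b k, gs (swapAt b k) k⟫ = ⟪b (k + 1), gs b k⟫ := by
    rw [gs_swapAt_left, inner_add_right, inner_smul_right, inner_gs_of_lt b k.lt_succ_self,
      inner_gs_self]
    field_simp
    ring
  rw [e₁, e₂, e₃]

/-- The factor `3 / 4` is `1 / 2`, from the violated condition, plus `1 / 4`, the square of the
bound on the size-reduced coefficient. The product of the two squared lengths is a two-dimensional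
volume and does not change, which also shows that the new vectors are nonzero. -/
theorem gs_swapAt {b : ℕ → E} {k : ℕ} (h₀ : gs b k ≠ 0) (h₁ : gs b (k + 1) ≠ 0)
    (hred : |⟪b (k + 1), gs b k⟫| ≤ ‖gs b k‖ ^ 2 / 2)
    (hlt : 2 * ‖gs b (k + 1)‖ ^ 2 < ‖gs b k‖ ^ 2) :
    gs (swapAt b k) k ≠ 0 ∧ gs (swapAt b k) (k + 1) ≠ 0 ∧
    ‖gs (swapAt b k) k‖ ≤ ‖gs b k‖ ∧ ‖gs (swapAt b k) (k + 1)‖ ≤ ‖gs b k‖ ∧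
    ‖gs (swapAt b k) k‖ ^ 2 * ‖gs (swapAt b k) (k + 1)‖ ^ 2 =
      ‖gs b k‖ ^ 2 * ‖gs b (k + 1)‖ ^ 2 ∧
    ‖gs (swapAt b k) k‖ ^ 2 ≤ 3 / 4 * ‖gs b k‖ ^ 2 := by
  have hL := norm_sq_gs_swapAt_left b k
  have hR := norm_sq_gs_swapAt_right (b := b) h₀
  have p₀ : 0 < ‖gs b k‖ ^ 2 := by positivity
  have p₁ : 0 < ‖gs b (k + 1)‖ ^ 2 := by positivity
  have hs : ⟪b (k + 1), gs b k⟫ ^ 2 ≤ (‖gs b k‖ ^ 2 / 2) ^ 2 := by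
    rw [← sq_abs]; gcongr
  generalize ⟪b (k + 1), gs b k⟫ = s at *
  have hs' : s ^ 2 / ‖gs b k‖ ^ 2 ≤ ‖gs b k‖ ^ 2 / 4 := by
    rw [div_le_iff₀ p₀]; linarith
  have hq : 0 ≤ s ^ 2 / ‖gs b k‖ ^ 2 := by positivity
  have pL : 0 < ‖gs (swapAt b k) k‖ ^ 2 := by rw [hL]; linarith
  have hprod : ‖gs (swapAt b k) k‖ ^ 2 * ‖gs (swapAt b k) (k + 1)‖ ^ 2 =
      ‖gs b k‖ ^ 2 * ‖gs b (k + 1)‖ ^ 2 := by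
    rw [hR, mul_sub, mul_div_cancel₀ _ pL.ne', hL]
    field_simp
    ring
  have pR : 0 < ‖gs (swapAt b k) (k + 1)‖ ^ 2 := by
    by_contra! hc
    have : 0 < ‖gs b k‖ ^ 2 * ‖gs b (k + 1)‖ ^ 2 := by positivity
    rw [← hprod] at this
    nlinarith
  have h34 : ‖gs (swapAt b k) k‖ ^ 2 ≤ 3 / 4 * ‖gs b k‖ ^ 2 := by rw [hL]; linarith
  refine ⟨fun h => by simp [h] at pL, fun h => by simp [h] at pR, ?_, ?_, hprod, h34⟩
  · rw [← sq_le_sq₀ (norm_nonneg _) (norm_nonneg _)]; linarith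
  · rw [← sq_le_sq₀ (norm_nonneg _) (norm_nonneg _), hR, sub_le_self_iff]
    positivity

/-- The first `j` vectors are the same up to order unless `j = k + 1`. -/
theorem gramDet_swapAt {b : ℕ → E} {k : ℕ}
    (h : ‖gs (swapAt b k) k‖ ^ 2 * ‖gs (swapAt b k) (k + 1)‖ ^ 2 =
      ‖gs b k‖ ^ 2 * ‖gs b (k + 1)‖ ^ 2) {j : ℕ} (hj : j ≠ k + 1) :
    gramDet (swapAt b k) j = gramDet b j := by
  have hle : ∀ j ≤ k, gramDet (swapAt b k) j = gramDet b j := fun j hj =>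
    Finset.prod_congr rfl fun i hi => by
      have := Finset.mem_range.1 hi
      rw [gs_swapAt_of_ne b (by omega) (by omega)]
  rcases Nat.lt_or_ge k j with hk | hk
  · obtain ⟨i, rfl⟩ : ∃ i, j = k + 2 + i := ⟨j - (k + 2), by omega⟩
    clear hj hk
    induction i with
    | zero =>
      rw [add_zero, gramDet_succ, gramDet_succ, gramDet_succ, gramDet_succ, hle k le_rfl, mul_assoc,
        h, mul_assoc]
    | succ i ih =>
      rw [← add_assoc, gramDet_succ, gramDet_succ, ih, gs_swapAt_of_ne b (by omega) (by omega)]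
  · exact hle j hk

/-- The product of the Gram determinants of order less than `n`. -/
noncomputable def potential (b : ℕ → E) (n : ℕ) : ℝ := ∏ j ∈ Finset.range n, gramDet b j

/-- Only the factor of order `k + 1` changes, and its last Gram–Schmidt length has shrunk. -/
theorem potential_swapAt {b : ℕ → E} {k n : ℕ} (hk : k + 1 < n)
    (hb : ∀ j < n, gs b j ≠ 0)
    (h : ‖gs (swapAt b k) k‖ ^ 2 * ‖gs (swapAt b k) (k + 1)‖ ^ 2 =
      ‖gs b k‖ ^ 2 * ‖gs b (k + 1)‖ ^ 2)
    (h34 : ‖gs (swapAt b k) k‖ ^ 2 ≤ 3 / 4 * ‖gs b k‖ ^ 2) :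
    potential (swapAt b k) n ≤ 3 / 4 * potential b n := by
  have hmem : k + 1 ∈ Finset.range n := Finset.mem_range.2 hk
  rw [potential, potential, ← Finset.mul_prod_erase _ _ hmem, ← Finset.mul_prod_erase _ _ hmem,
    ← mul_assoc]
  have e : ∏ j ∈ (Finset.range n).erase (k + 1), gramDet (swapAt b k) j =
      ∏ j ∈ (Finset.range n).erase (k + 1), gramDet b j :=
    Finset.prod_congr rfl fun j hj => gramDet_swapAt h (Finset.mem_erase.1 hj).1
  rw [e]
  refine mul_le_mul_of_nonneg_right ?_ (Finset.prod_nonneg fun j hj =>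
    (gramDet_pos fun i hi => hb i ?_).le)
  · rw [gramDet_succ, gramDet_succ, gramDet_swapAt h (by omega)]
    have : 0 ≤ gramDet b k := (gramDet_pos fun i hi => hb i (by omega)).le
    nlinarith
  · have := Finset.mem_range.1 (Finset.mem_erase.1 hj).2
    omega

/-- A family is Siegel reduced if the lengths of its Gram–Schmidt vectors do not drop too fast. -/
def SiegelReduced (b : ℕ → E) (n : ℕ) : Prop :=
  ∀ k, k + 1 < n → ‖gs b k‖ ^ 2 ≤ 2 * ‖gs b (k + 1)‖ ^ 2

/-- The first vector is `gs b 0`, so `‖b 0‖ ^ 2 ≤ 2 ^ i * ‖gs b i‖ ^ 2` for each `i`; multiply these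
over `i < n`. -/
theorem SiegelReduced.norm_pow_le {b : ℕ → E} {n : ℕ} (h : SiegelReduced b n) :
    (‖b 0‖ ^ 2) ^ n ≤ 2 ^ (n * (n - 1) / 2) * gramDet b n := by
  have hi : ∀ i < n, ‖b 0‖ ^ 2 ≤ 2 ^ i * ‖gs b i‖ ^ 2 := by
    intro i hi
    induction i with
    | zero => simp [gs]
    | succ i ih =>
      refine (ih (by omega)).trans ?_
      calc 2 ^ i * ‖gs b i‖ ^ 2 ≤ 2 ^ i * (2 * ‖gs b (i + 1)‖ ^ 2) := by
            gcongr
            exact h i hi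
        _ = _ := by ring
  calc (‖b 0‖ ^ 2) ^ n = ∏ i ∈ Finset.range n, ‖b 0‖ ^ 2 := by simp
    _ ≤ ∏ i ∈ Finset.range n, 2 ^ i * ‖gs b i‖ ^ 2 :=
      Finset.prod_le_prod (fun _ _ => by positivity) fun i hi' => hi i (Finset.mem_range.1 hi')
    _ = _ := by
      rw [Finset.prod_mul_distrib, Finset.prod_pow_eq_pow_sum, Finset.sum_range_id, gramDet]

end LatticeReduction

/-! ### Newton series, and separation of signs by means of forward differences. -/

namespace NewtonSeries

/-- The `j`-th forward difference, at `x`, of the function whose Newton coefficients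
(at most `m` of them) are the `a i`. -/
def eval (m : ℕ) (a : ℕ → ℤ) (j x : ℕ) : ℤ :=
  ∑ k ∈ Finset.range m, (x.choose k : ℤ) * a (j + k)

variable {m : ℕ} {a : ℕ → ℤ}

/-- Pascal's rule. The truncated sum loses one term on the right, whose coefficient vanishes by
`ha`. -/
theorem eval_succ_sub (ha : ∀ i, m ≤ i → a i = 0) (j x : ℕ) :
    eval m a j (x + 1) - eval m a j x = eval m a (j + 1) x := by
  cases m with
  | zero => simp [eval]
  | succ m =>
    rw [eval, eval, eval, ← Finset.sum_sub_distrib, Finset.sum_range_succ', Finset.sum_range_succ,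
      ha (j + 1 + m) (by omega)]
    simp only [Nat.choose_zero_right, sub_self, mul_zero, add_zero]
    refine Finset.sum_congr rfl fun k _ => ?_
    rw [Nat.choose_succ_succ, show j + (k + 1) = j + 1 + k by ring]
    push_cast
    ring

theorem eval_of_le (ha : ∀ i, m ≤ i → a i = 0) {j : ℕ} (hj : m ≤ j) (x : ℕ) : eval m a j x = 0 :=
  Finset.sum_eq_zero fun k _ => by rw [ha _ (by omega), mul_zero]

/-- Newton's forward difference formula has `x + 1` terms. It agrees with the sum of `m` terms
because differences of order beyond the degree vanish, and so do the binomial coefficients beyond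
`x`. -/
theorem eval_zero_fwdDiff (P : Polynomial ℤ) {f : ℤ → ℤ} (hf : ∀ x, f x = P.eval x)
    (hP : P.natDegree < m) (x : ℕ) :
    eval m (fun i => (fwdDiff (1 : ℤ))^[i] f 0) 0 x = P.eval (x : ℤ) := by
  have h₀ : ∀ k, m ≤ k → (fwdDiff (1 : ℤ))^[k] f 0 = 0 := by
    intro k hk
    have hfP : f = P.eval := funext hf
    rw [hfP, Polynomial.fwdDiff_iter_eq_zero_of_degree_lt (by omega)]
    rfl
  have := shift_eq_sum_fwdDiff_iter (1 : ℤ) f x 0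
  rw [hf] at this
  simp only [nsmul_eq_mul, mul_one, zero_add] at this
  rw [this]
  simp only [eval, zero_add]
  rcases le_total m (x + 1) with h | h
  · rw [← Finset.sum_subset (Finset.range_mono h)]
    intro k _ hk
    rw [h₀ k (by simpa using hk), mul_zero]
  · symm
    rw [← Finset.sum_subset (Finset.range_mono h)]
    intro k _ hk
    rw [Nat.choose_eq_zero_of_lt (by simp at hk; omega)]
    simp

/-- The sign of `g` is constant on each cell `[c i, c (i + 1))`. -/
def Separates (n : ℕ) (c : ℕ → ℕ) (g : ℕ → ℤ) : Prop :=
  ∀ i < n, ∀ x, c i ≤ x → x < c (i + 1) → (0 < g x ↔ 0 < g (c i))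

/-- This is what makes a binary search on `g` legitimate once the signs of its difference function
are separated. -/
theorem monotoneOn_or_antitoneOn {g d : ℕ → ℤ} (hd : ∀ x, g (x + 1) - g x = d x) {p q : ℕ}
    (h : ∀ x, p ≤ x → x < q → (0 < d x ↔ 0 < d p)) :
    MonotoneOn g (Set.Icc p q) ∨ AntitoneOn g (Set.Icc p q) := by
  by_cases hp : 0 < d p
  · left
    intro x hx y hy hxy
    obtain ⟨hx₁, hx₂⟩ := hx
    obtain ⟨hy₁, hy₂⟩ := hy
    induction y, hxy using Nat.le_induction with
    | base => rfl
    | succ y hxy ih =>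
      have := ih (by omega) (by omega)
      have := (h y (by omega) (by omega)).2 hp
      have := hd y
      linarith
  · right
    intro x hx y hy hxy
    obtain ⟨hx₁, hx₂⟩ := hx
    obtain ⟨hy₁, hy₂⟩ := hy
    induction y, hxy using Nat.le_induction with
    | base => rfl
    | succ y hxy ih =>
      have := ih (by omega) (by omega)
      have := mt (h y (by omega) (by omega)).1 hp
      have := hd y
      linarith

/-- What a binary search on `[p, q]` for a sign change of `g` returns: the sign is constant on
`[p, c)` and on `[c, q]`. -/
def IsCut (g : ℕ → ℤ) (p q c : ℕ) : Prop :=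
  p ≤ c ∧ c ≤ q ∧ (∀ x, p ≤ x → x < c → (0 < g x ↔ 0 < g p)) ∧
    ∀ x, c ≤ x → x ≤ q → (0 < g x ↔ 0 < g c)

/-- At the end `lo` has the sign of `p`, while its successor `hi` has the other sign, or the search
has run into `q`. Monotonicity spreads both facts. -/
theorem isCut_of_search {g : ℕ → ℤ} {p q lo hi : ℕ}
    (hm : MonotoneOn g (Set.Icc p q) ∨ AntitoneOn g (Set.Icc p q))
    (h₁ : p ≤ lo) (h₂ : lo ≤ hi) (h₃ : hi ≤ q) (h₄ : hi ≤ lo + 1) (hlo : 0 < g lo ↔ 0 < g p)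
    (hhi : hi = q ∨ ¬(0 < g hi ↔ 0 < g p)) : IsCut g p q hi := by
  refine ⟨by omega, h₃, fun x hx hx' => ?_, fun x hx hx' => ?_⟩
  · rcases hm with hm | hm
    · have a₁ := hm (a := p) ⟨le_rfl, by omega⟩ (b := x) ⟨hx, by omega⟩ hx
      have a₂ := hm (a := x) ⟨hx, by omega⟩ (b := lo) ⟨h₁, by omega⟩ (by omega)
      constructor
      · intro h; exact hlo.1 (by linarith)
      · intro h; linarith
    · have a₁ := hm (a := p) ⟨le_rfl, by omega⟩ (b := x) ⟨hx, by omega⟩ hx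
      have a₂ := hm (a := x) ⟨hx, by omega⟩ (b := lo) ⟨h₁, by omega⟩ (by omega)
      constructor
      · intro h; linarith
      · intro h; have := hlo.2 h; linarith
  · rcases hhi with rfl | hhi
    · rw [le_antisymm hx' hx]
    · rcases hm with hm | hm
      · have a₁ := hm (a := p) ⟨le_rfl, by omega⟩ (b := hi) ⟨by omega, h₃⟩ (by omega)
        have a₂ := hm (a := hi) ⟨by omega, h₃⟩ (b := x) ⟨by omega, hx'⟩ hx
        constructor
        · intro _
          by_contra h
          exact hhi ⟨fun h' => absurd h' h, fun h' => absurd (lt_of_lt_of_le h' a₁) h⟩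
        · intro h; linarith
      · have a₁ := hm (a := p) ⟨le_rfl, by omega⟩ (b := hi) ⟨by omega, h₃⟩ (by omega)
        have a₂ := hm (a := hi) ⟨by omega, h₃⟩ (b := x) ⟨by omega, hx'⟩ hx
        constructor
        · intro h; linarith
        · intro h
          exact absurd ⟨fun _ => lt_of_lt_of_le h a₁, fun _ => h⟩ hhi

/-- A new cell straddles one old breakpoint. The cut in the old cell to the left and the cut in the
one to the right each settle one half, and the halves agree at the old breakpoint. -/
theorem separates_of_isCut {n : ℕ} {c c' : ℕ → ℕ} {g : ℕ → ℤ} (h₀ : c' 0 = c 0)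
    (h : ∀ i < n, IsCut g (c i) (c (i + 1)) (c' (i + 1))) : Separates n c' g := by
  intro i hi x hx hx'
  rcases i with _ | i
  · rw [h₀] at hx ⊢
    exact (h 0 hi).2.2.1 x hx hx'
  · obtain ⟨-, h₁, -, h₂⟩ := h i (by omega)
    obtain ⟨-, -, h₃, -⟩ := h (i + 1) hi
    rcases le_total x (c (i + 1)) with hxc | hxc
    · exact h₂ x hx hxc
    · rw [h₃ x hxc hx']
      exact h₂ _ h₁ le_rfl

/-- For a nonnegative function "not positive" means zero, so a zero forces zeros all the way back to
the breakpoint on its left. -/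
theorem Separates.exists_cell {n : ℕ} {c : ℕ → ℕ} {g : ℕ → ℤ} (h : Separates n c g) {y : ℕ}
    (h₀ : c 0 ≤ y) (hn : y < c n) (hy : g y = 0) (hg : ∀ x, 0 ≤ g x) :
    ∃ i < n, c i ≤ y ∧ ∀ x, c i ≤ x → x ≤ y → g x = 0 := by
  obtain ⟨i, hi, h₁, h₂⟩ : ∃ i < n, c i ≤ y ∧ y < c (i + 1) := by
    by_contra! hc
    have : ∀ i ≤ n, c i ≤ y := by
      intro i hi
      induction i with
      | zero => exact h₀
      | succ i ih => exact hc i (by omega) (ih (by omega))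
    exact absurd (this n le_rfl) (by omega)
  refine ⟨i, hi, h₁, fun x hx hxy => ?_⟩
  have e₁ := h i hi y h₁ h₂
  have e₂ := h i hi x hx (by omega)
  rw [← e₁, hy] at e₂
  exact le_antisymm (not_lt.1 (mt e₂.1 (lt_irrefl _))) (hg x)

/-- Bounds the length of a run of zeros, hence the distance of a zero from its breakpoint. -/
theorem card_zeros_le {P : Polynomial ℤ} (hP : P ≠ 0) {x y : ℕ}
    (h : ∀ z : ℕ, x ≤ z → z ≤ y → P.eval (z : ℤ) = 0) : y + 1 ≤ x + P.natDegree := by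
  by_contra! hc
  have := Polynomial.card_le_degree_of_subset_roots (p := P)
    (Z := (Finset.Icc x y).map ⟨Nat.cast, Nat.cast_injective⟩) (by
      intro z hz
      simp only [Finset.map_val, Multiset.mem_map, Finset.mem_val, Finset.mem_Icc] at hz
      obtain ⟨w, hw, rfl⟩ := hz
      exact (Polynomial.mem_roots hP).2 (h w hw.1 hw.2))
  rw [Finset.card_map, Nat.card_Icc] at this
  omega

end NewtonSeries

/-! ### Integer matrices stored in an array, and their rows as Euclidean vectors. -/

namespace LatticeReduction

open scoped RealInnerProductSpace

/-- Row `k` of the matrix with `L` columns that is stored row by row in `A`, as a Euclidean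
vector. -/
noncomputable def row (L : ℕ) (A : ℤ → ℤ) (k : ℕ) : EuclideanSpace ℝ (Fin L) :=
  if k < L then WithLp.toLp 2 fun j : Fin L => (A (k * L + j) : ℝ) else 0

theorem row_apply {L k : ℕ} (A : ℤ → ℤ) (hk : k < L) (j : Fin L) :
    row L A k j = (A (k * L + j) : ℝ) := by
  simp [row, hk]

theorem row_of_le {L k : ℕ} (A : ℤ → ℤ) (hk : L ≤ k) : row L A k = 0 := by
  simp [row, hk]

theorem row_ext {L k : ℕ} {A : ℤ → ℤ} {x : EuclideanSpace ℝ (Fin L)} (hk : k < L)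
    (h : ∀ j : Fin L, (A (k * L + j) : ℝ) = x j) : row L A k = x := by
  ext j
  rw [row_apply A hk, h]

theorem inner_row {L k l : ℕ} (A B : ℤ → ℤ) (hk : k < L) (hl : l < L) :
    ⟪row L A k, row L B l⟫ = ((∑ j ∈ Finset.range L, A (k * L + j) * B (l * L + j) : ℤ) : ℝ) := by
  rw [Finset.sum_range, PiLp.inner_apply]
  push_cast
  refine Finset.sum_congr rfl fun j _ => ?_
  rw [row_apply A hk, row_apply B hl]
  simp [mul_comm]

theorem abs_coord_le {L k : ℕ} (A : ℤ → ℤ) (hk : k < L) {j : ℕ} (hj : j < L) :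
    |(A (k * L + j) : ℝ)| ≤ ‖row L A k‖ := by
  have := PiLp.norm_apply_le (row L A k) ⟨j, hj⟩
  rwa [row_apply A hk] at this

theorem norm_sq_row {L k : ℕ} (A : ℤ → ℤ) (hk : k < L) :
    ‖row L A k‖ ^ 2 = ∑ j ∈ Finset.range L, (A (k * L + j) : ℝ) ^ 2 := by
  rw [EuclideanSpace.norm_sq_eq, Finset.sum_range]
  refine Finset.sum_congr rfl fun j _ => ?_
  rw [row_apply A hk]
  simp

/-- Below the diagonal, row `i` is a combination of the earlier diagonal vectors. It thus differs
from its diagonal part, one member of an orthogonal family, by an element of their span, and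
`gs_eq_of_sub_mem` applies. -/
theorem gs_eq_of_triangular {L : ℕ} {A : ℤ → ℤ} (hz : ∀ i < L, ∀ j < L, i < j → A (i * L + j) = 0)
    (hd : ∀ i < L, A (i * L + i) ≠ 0) {i : ℕ} (hi : i < L) :
    ‖gs (row L A) i‖ = |(A (i * L + i) : ℝ)| := by
  let e : ℕ → EuclideanSpace ℝ (Fin L) := fun i =>
    if h : i < L then EuclideanSpace.single ⟨i, h⟩ (A (i * L + i) : ℝ) else 0
  have he : ∀ i (h : i < L), e i = EuclideanSpace.single ⟨i, h⟩ (A (i * L + i) : ℝ) :=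
    fun i h => by simp [e, h]
  have hsub : ∀ k, row L A k - e k ∈ spanLT e k := by
    intro k
    rcases Nat.lt_or_ge k L with hk | hk
    · have : row L A k - e k =
          ∑ j ∈ Finset.range k, ((A (k * L + j) : ℝ) / A (j * L + j)) • e j := by
        ext l
        rw [PiLp.sub_apply, row_apply A hk, he k hk, WithLp.ofLp_sum, Finset.sum_apply]
        have h₁ : ∀ j ∈ Finset.range k, (((A (k * L + j) : ℝ) / A (j * L + j)) • e j) l =
            if j = l then (A (k * L + j) : ℝ) else 0 := by
          intro j hj
          have hjL : j < L := (Finset.mem_range.1 hj).trans hk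
          have hdj : (A (j * L + j) : ℝ) ≠ 0 := by exact_mod_cast hd j hjL
          rw [he j hjL, PiLp.smul_apply, PiLp.single_apply]
          by_cases h : j = l
          · have : l = ⟨j, hjL⟩ := Fin.ext h.symm
            simp only [this]
            simp [hdj]
          · have : ¬ l = ⟨j, hjL⟩ := fun h' => h (by rw [h'])
            simp [h, this]
        rw [Finset.sum_congr rfl h₁, Finset.sum_ite_eq', PiLp.single_apply]
        rcases lt_trichotomy (l : ℕ) k with h | h | h
        · have : ¬ l = ⟨k, hk⟩ := fun h' => by rw [h'] at h; simp at h
          simp [h, this]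
        · have : l = ⟨k, hk⟩ := Fin.ext h
          simp [this]
        · have h' : ¬ l = ⟨k, hk⟩ := fun h' => by rw [h'] at h; simp at h
          simp [h', hz k hk l l.2 h]
      rw [this]
      exact Submodule.sum_mem _ fun j hj =>
        Submodule.smul_mem _ _ (mem_spanLT e (Finset.mem_range.1 hj))
    · simp [row_of_le A hk, e, Nat.not_lt.2 hk]
  have hg : gs e i = e i := by
    refine (eq_prj e i (by simp) fun y hy => ?_).symm
    refine Submodule.span_induction ?_ (by simp) ?_ ?_ hy
    · rintro _ ⟨j, hj, rfl⟩
      have hj : j < i := hj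
      rw [he i hi, he j (hj.trans hi), EuclideanSpace.inner_single_left]
      simp [hj.ne']
    · intro u w _ _ hu hw
      rw [inner_add_right, hu, hw, add_zero]
    · intro r u _ hu
      rw [inner_smul_right, hu, mul_zero]
  rw [gs_eq_of_sub_mem hsub, hg, he i hi]
  simp

end LatticeReduction

/-! ### Polynomials with a root modulo a power of the unknown divisor. -/

namespace HowgraveGraham

/-- `w` is the coefficient vector, with column `j` scaled by `X ^ j`, of a polynomial of degree less
than `L` whose value at `y` is divisible by `D`. -/
def Vanishing (L : ℕ) (X y D : ℤ) (w : ℕ → ℤ) : Prop :=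
  ∃ h : ℕ → ℤ, (∀ j < L, w j = h j * X ^ j) ∧ D ∣ ∑ j ∈ Finset.range L, h j * y ^ j

theorem Vanishing.sub_mul {L : ℕ} {X y D : ℤ} {w u : ℕ → ℤ} (hw : Vanishing L X y D w)
    (hu : Vanishing L X y D u) (q : ℤ) {z : ℕ → ℤ} (hz : ∀ j < L, z j = w j - q * u j) :
    Vanishing L X y D z := by
  obtain ⟨f, hf, hf'⟩ := hw
  obtain ⟨g, hg, hg'⟩ := hu
  refine ⟨fun j => f j - q * g j, fun j hj => by rw [hz j hj, hf j hj, hg j hj]; ring, ?_⟩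
  have : ∑ j ∈ Finset.range L, (f j - q * g j) * y ^ j =
      ∑ j ∈ Finset.range L, f j * y ^ j - q * ∑ j ∈ Finset.range L, g j * y ^ j := by
    rw [Finset.mul_sum, ← Finset.sum_sub_distrib]
    exact Finset.sum_congr rfl fun j _ => by ring
  rw [this]
  exact dvd_sub hf' (hg'.mul_left q)

/-- The coefficient of `X ^ j` in `(P₀ - X) ^ i`, scaled by `B ^ j`. -/
noncomputable def powCoeff (P₀ B : ℤ) (i j : ℕ) : ℤ :=
  ((Polynomial.C P₀ - Polynomial.X) ^ i).coeff j * B ^ j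

theorem powCoeff_zero (P₀ B : ℤ) (j : ℕ) : powCoeff P₀ B 0 j = if j = 0 then 1 else 0 := by
  rw [powCoeff, pow_zero, Polynomial.coeff_one]
  split_ifs with h <;> simp [h]

theorem powCoeff_succ_zero (P₀ B : ℤ) (i : ℕ) :
    powCoeff P₀ B (i + 1) 0 = P₀ * powCoeff P₀ B i 0 := by
  simp [powCoeff, pow_succ', sub_mul]

theorem powCoeff_succ_succ (P₀ B : ℤ) (i j : ℕ) :
    powCoeff P₀ B (i + 1) (j + 1) = P₀ * powCoeff P₀ B i (j + 1) - B * powCoeff P₀ B i j := by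
  simp only [powCoeff, pow_succ' (Polynomial.C P₀ - Polynomial.X), sub_mul, Polynomial.coeff_sub,
    Polynomial.coeff_C_mul, Polynomial.coeff_X_mul]
  ring

theorem powCoeff_of_lt (P₀ B : ℤ) {i j : ℕ} (h : i < j) : powCoeff P₀ B i j = 0 := by
  induction i generalizing j with
  | zero => rw [powCoeff_zero, if_neg (by omega)]
  | succ i ih =>
    obtain ⟨j, rfl⟩ : ∃ k, j = k + 1 := ⟨j - 1, by omega⟩
    rw [powCoeff_succ_succ, ih (by omega), ih (by omega)]
    simp

theorem powCoeff_self (P₀ B : ℤ) (i : ℕ) : powCoeff P₀ B i i = (-B) ^ i := by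
  induction i with
  | zero => simp [powCoeff_zero]
  | succ i ih =>
    rw [powCoeff_succ_succ, ih, powCoeff_of_lt P₀ B i.lt_succ_self]
    ring

theorem abs_powCoeff_le {P₀ B : ℤ} (hP : 0 ≤ P₀) (hB : 0 ≤ B) (i j : ℕ) :
    |powCoeff P₀ B i j| ≤ (P₀ + B) ^ i := by
  induction i generalizing j with
  | zero => rw [powCoeff_zero]; split_ifs <;> simp
  | succ i ih =>
    cases j with
    | zero =>
      rw [powCoeff_succ_zero, abs_mul, abs_of_nonneg hP, pow_succ']
      have := mul_le_mul_of_nonneg_left (ih 0) hP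
      have : 0 ≤ B * (P₀ + B) ^ i := by positivity
      linarith
    | succ j =>
      rw [powCoeff_succ_succ, pow_succ', add_mul]
      refine (abs_sub _ _).trans ?_
      rw [abs_mul, abs_mul, abs_of_nonneg hP, abs_of_nonneg hB]
      have := mul_le_mul_of_nonneg_left (ih (j + 1)) hP
      have := mul_le_mul_of_nonneg_left (ih j) hB
      linarith

theorem natDegree_pow_le (P₀ : ℤ) (i : ℕ) :
    ((Polynomial.C P₀ - Polynomial.X) ^ i).natDegree ≤ i := by
  refine Polynomial.natDegree_pow_le.trans ?_
  have : (Polynomial.C P₀ - Polynomial.X).natDegree ≤ 1 := by compute_degree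
  nlinarith

/-- At `y` each of the factors `K` and `P₀ - x` contributes a factor `P₀ - y`. -/
theorem vanishing_powCoeff {L t i : ℕ} (hi : i < L) {P₀ B y K : ℤ} (hK : P₀ - y ∣ K) :
    Vanishing L B y ((P₀ - y) ^ t) fun j => K ^ (t - i) * powCoeff P₀ B i j := by
  refine ⟨fun j => K ^ (t - i) * ((Polynomial.C P₀ - Polynomial.X) ^ i).coeff j,
    fun j _ => by simp only [powCoeff]; ring, ?_⟩
  have : ∑ j ∈ Finset.range L,
      K ^ (t - i) * ((Polynomial.C P₀ - Polynomial.X) ^ i).coeff j * y ^ j =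
      K ^ (t - i) * (P₀ - y) ^ i := by
    have h := Polynomial.eval_eq_sum_range' (lt_of_le_of_lt (natDegree_pow_le P₀ i) hi) y
    simp only [Polynomial.eval_pow, Polynomial.eval_sub, Polynomial.eval_C, Polynomial.eval_X] at h
    rw [h, Finset.mul_sum]
    exact Finset.sum_congr rfl fun j _ => by ring
  rw [this]
  -- Subtraction is truncated: for `i > t` the multiplier is `K ^ 0`, and `t ≤ t - i + i` still
  -- holds.
  calc (P₀ - y) ^ t ∣ (P₀ - y) ^ (t - i + i) := pow_dvd_pow _ (by omega)
    _ = (P₀ - y) ^ (t - i) * (P₀ - y) ^ i := pow_add _ _ _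
    _ ∣ _ := mul_dvd_mul_right (pow_dvd_pow_of_dvd hK _) _

/-- The squared determinant of the triangular lattice basis. Only the rows `i < t` carry powers of
`K`. -/
theorem prod_diag (X K : ℝ) (t : ℕ) :
    ∏ i ∈ Finset.range (2 * t), (K ^ (t - i) * X ^ i) ^ 2 =
      K ^ (t * (t + 1)) * X ^ (2 * t * (2 * t - 1)) := by
  have h₁ : ∑ i ∈ Finset.range (2 * t), (t - i) * 2 = t * (t + 1) := by
    rw [← Finset.sum_mul, two_mul, Finset.sum_range_add]
    have : ∑ i ∈ Finset.range t, (t - (t + i)) = 0 := Finset.sum_eq_zero fun i _ => by omega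
    rw [this, add_zero, ← Finset.sum_range_reflect]
    have : ∑ i ∈ Finset.range t, (t - (t - 1 - i)) = ∑ i ∈ Finset.range t, (i + 1) :=
      Finset.sum_congr rfl fun i hi => by have := Finset.mem_range.1 hi; omega
    have h : ∑ i ∈ Finset.range t, (i + 1) = ∑ i ∈ Finset.range (t + 1), i := by
      rw [Finset.sum_range_succ']; simp
    rw [this, h, Finset.sum_range_id_mul_two, Nat.add_sub_cancel, mul_comm]
  have h₂ : ∑ i ∈ Finset.range (2 * t), i * 2 = 2 * t * (2 * t - 1) := by
    rw [← Finset.sum_mul, Finset.sum_range_id_mul_two]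
  simp only [mul_pow, Finset.prod_mul_distrib, ← pow_mul]
  rw [Finset.prod_pow_eq_pow_sum, Finset.prod_pow_eq_pow_sum, h₁, h₂]

/-- The inequality between the parameters that makes the first vector of a reduced basis vanish at
the unknown root. -/
theorem parameters_lt {N P X K : ℝ} {t : ℕ} (ht : 50 ≤ t) (hN : 0 < N) (hNt : N < 2 ^ t)
    (hXN : 64 * X ^ 2 ≤ N) (hK : 0 ≤ K) (hKN : K ≤ N ^ 2) (hP : N ≤ 2 * P) :
    ((2 * t : ℕ) : ℝ) ^ (2 * t) * (2 ^ (2 * t * (2 * t - 1) / 2) *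
      (K ^ (t * (t + 1)) * X ^ (2 * t * (2 * t - 1)))) < P ^ (2 * t * (2 * t)) := by
  obtain ⟨s, rfl⟩ : ∃ s, t = s + 1 := ⟨t - 1, by omega⟩
  have e₁ : 2 * (s + 1) * (2 * (s + 1) - 1) / 2 = (2 * s + 1) * (s + 1) := by
    rw [show 2 * (s + 1) - 1 = 2 * s + 1 by omega, mul_assoc, Nat.mul_div_cancel_left _ two_pos]
    ring
  have e₂ : 2 * (s + 1) * (2 * (s + 1) - 1) = 2 * (2 * s + 1) * (s + 1) := by
    rw [show 2 * (s + 1) - 1 = 2 * s + 1 by omega]; ring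
  rw [e₁, e₂]
  -- Both sides of the goal are powers with exponent `s + 1 = t`; this is the inequality between
  -- their bases.
  have hbase : (2 * (s + 1) : ℝ) ^ 2 * (2 ^ (2 * s + 1) * (K ^ (s + 2) * (X ^ 2) ^ (2 * s + 1))) <
      P ^ (4 * (s + 1)) := by
    have hs : ((s : ℝ) + 1) < 2 ^ (s + 1) := by exact_mod_cast (s + 1).lt_two_pow_self
    -- The new factors turn `X ^ 2` into `64 * X ^ 2 ≤ N` and `P` into `2 * P ≥ N`. The power of `N`
    -- on the left then exceeds that on the right by one factor `N < 2 ^ (s + 1)`. Together with the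
    -- other powers of two it makes `2 ^ (9 * s + 10)`, which `64 ^ (2 * s + 1)` dominates.
    have h₁ : (2 ^ (4 * (s + 1)) * 64 ^ (2 * s + 1) : ℝ) * ((2 * (s + 1) : ℝ) ^ 2 *
        (2 ^ (2 * s + 1) * (K ^ (s + 2) * (X ^ 2) ^ (2 * s + 1)))) <
        (2 ^ (4 * (s + 1)) * 64 ^ (2 * s + 1) : ℝ) * P ^ (4 * (s + 1)) := by
      calc _ = 2 ^ (4 * (s + 1)) * (2 * (s + 1) : ℝ) ^ 2 *
            2 ^ (2 * s + 1) * (K ^ (s + 2) * (64 * X ^ 2) ^ (2 * s + 1)) := by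
            rw [mul_pow 64]; ring
        _ ≤ 2 ^ (4 * (s + 1)) * (2 * 2 ^ (s + 1) : ℝ) ^ 2 *
            2 ^ (2 * s + 1) * ((N ^ 2) ^ (s + 2) * N ^ (2 * s + 1)) := by gcongr
        _ = 2 ^ (8 * s + 9) * N * N ^ (4 * (s + 1)) := by ring
        _ < 2 ^ (8 * s + 9) * 2 ^ (s + 1) * N ^ (4 * (s + 1)) := by gcongr
        _ = 2 ^ (9 * s + 10) * N ^ (4 * (s + 1)) := by ring
        _ ≤ 2 ^ (6 * (2 * s + 1)) * (2 * P) ^ (4 * (s + 1)) := by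
            gcongr
            · norm_num
            · omega
        _ = _ := by
            rw [show (64 : ℝ) = 2 ^ 6 by norm_num, ← pow_mul, mul_pow]; ring
    exact lt_of_mul_lt_mul_left h₁ (by positivity)
  have := pow_lt_pow_left₀ hbase (by positivity) (n := s + 1) (by omega)
  push_cast
  generalize (2 * ((s : ℝ) + 1)) = c at *
  calc _ = (c ^ 2 * (2 ^ (2 * s + 1) * (K ^ (s + 2) * (X ^ 2) ^ (2 * s + 1)))) ^ (s + 1) := by
        simp only [mul_pow, ← pow_mul]
        rw [show (s + 1) * (s + 1 + 1) = (s + 2) * (s + 1) by ring]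
    _ < _ := this
    _ = _ := by rw [← pow_mul]; congr 1; ring

/-- A multiple of `D` that is smaller than `D` in absolute value is zero. By Cauchy–Schwarz the
value at `y` is at most `√L` times the length of the scaled coefficient vector. The hypothesis
compares the powers with exponent `2 * L` because the bound on a reduced basis comes in that form.
-/
theorem sum_eq_zero_of_vanishing {L : ℕ} {X y D : ℤ} (hy : |y| ≤ X) {h : ℕ → ℤ}
    (hD : D ∣ ∑ j ∈ Finset.range L, h j * y ^ j)
    (hlt : (L : ℝ) ^ L * (∑ j ∈ Finset.range L, ((h j * X ^ j : ℤ) : ℝ) ^ 2) ^ L <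
      (D : ℝ) ^ (2 * L)) :
    ∑ j ∈ Finset.range L, h j * y ^ j = 0 := by
  refine Int.eq_zero_of_abs_lt_dvd ((abs_dvd D _).2 hD) ?_
  have h₁ : |∑ j ∈ Finset.range L, h j * y ^ j| ≤ ∑ j ∈ Finset.range L, |h j * X ^ j| := by
    refine (Finset.abs_sum_le_sum_abs _ _).trans (Finset.sum_le_sum fun j _ => ?_)
    rw [abs_mul, abs_mul, abs_pow, abs_pow]
    have : |y| ≤ |X| := hy.trans (le_abs_self X)
    gcongr
  have h₂ : ((∑ j ∈ Finset.range L, |h j * X ^ j| : ℤ) : ℝ) ^ 2 ≤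
      L * ∑ j ∈ Finset.range L, ((h j * X ^ j : ℤ) : ℝ) ^ 2 := by
    have := sq_sum_le_card_mul_sum_sq (s := Finset.range L) (f := fun j => |((h j * X ^ j : ℤ) : ℝ)|)
    simp only [sq_abs] at this
    rw [Finset.card_range] at this
    simpa only [Int.cast_sum, Int.cast_abs] using this
  have h₃ : ((∑ j ∈ Finset.range L, |h j * X ^ j| : ℤ) : ℝ) ^ (2 * L) < (|D| : ℤ) ^ (2 * L) := by
    rw [pow_mul]
    calc _ ≤ (L * ∑ j ∈ Finset.range L, ((h j * X ^ j : ℤ) : ℝ) ^ 2) ^ L := by gcongr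
      _ = _ := mul_pow _ _ _
      _ < _ := hlt
      _ = _ := by push_cast; rw [pow_mul, pow_mul, sq_abs]
  have h₄ := lt_of_pow_lt_pow_left₀ _ (by positivity) h₃
  exact_mod_cast (show ((|∑ j ∈ Finset.range L, h j * y ^ j| : ℤ) : ℝ) <
    ((|D| : ℤ) : ℝ) from lt_of_le_of_lt (by exact_mod_cast h₁) h₄)

end HowgraveGraham

/-! ### Arithmetic of the cofactor of the largest prime factor. -/

namespace Cofactor

/-- With `N = p * m` the left side is `(p - 1) * m`. -/
theorem sub_dvd_mul {N p M : ℕ} (hp : p ∣ N) (hM : p - 1 ∣ M) : N - N / p ∣ M * N := by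
  obtain ⟨m, rfl⟩ := hp
  rcases Nat.eq_zero_or_pos p with rfl | hp
  · simp
  rw [Nat.mul_div_cancel_left _ hp]
  have : p * m - m = (p - 1) * m := by rw [Nat.sub_mul, one_mul]
  rw [this]
  exact mul_dvd_mul hM (Dvd.intro_left p rfl)

/-- A multiple `d` of `p` would have `d * d ≥ p ^ 2 > N`. So `p` divides the complementary divisor.
-/
theorem le_of_dvd_of_sq_lt {N p d : ℕ} (hN : N ≠ 0) (hp : p.Prime) (hpN : p ∣ N) (hlt : N < p ^ 2)
    (hd : d ∣ N) (hd' : d * d < N) : d ≤ N / p := by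
  obtain ⟨e, rfl⟩ := hd
  have hd0 : 0 < d := Nat.pos_of_ne_zero fun h => hN (by simp [h])
  have he0 : 0 < e := Nat.pos_of_ne_zero fun h => hN (by simp [h])
  rcases (Nat.Prime.dvd_mul hp).1 hpN with h | h
  · have := Nat.le_of_dvd hd0 h
    nlinarith
  · rw [Nat.le_div_iff_mul_le hp.pos]
    exact Nat.mul_le_mul_left d (Nat.le_of_dvd he0 h)

theorem pred_dvd_carmichael {N p : ℕ} (hp : p.Prime) (h2 : p ≠ 2) (hpN : p ∣ N) :
    p - 1 ∣ ArithmeticFunction.carmichael N := by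
  have h := ArithmeticFunction.carmichael_pow_of_prime_ne_two 1 hp h2
  rw [pow_one, Nat.totient_prime hp] at h
  rw [← h]
  exact ArithmeticFunction.carmichael_dvd hpN

theorem pred_dvd_totient {N p : ℕ} (hp : p.Prime) (hpN : p ∣ N) : p - 1 ∣ N.totient := by
  rw [← Nat.totient_prime hp]
  exact Nat.totient_dvd_of_dvd hpN

end Cofactor

namespace LogCost

/-! ### The program -/

/-- `y := ∑ e`, where the counter `x` of the sum is bounded by the content of variable `b`. -/
def sumCmd (y x b : ℕ) (e : Expr) : Cmd := .set y 0 ;; .rep x b (.set y (v y + e))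

/-- Cell `(i, j)` of the matrix with rows of length `L` that is stored in array `a`. -/
def cell (a : ℕ) (i j : Expr) : Expr := .get a (i * v 2 + j)

/-- Projection of row `v 10` of array `1`, orthogonally to row `v 12`. -/
def projectCmd : Cmd :=
  sumCmd 13 11 2 (cell 0 (v 10) (v 11) * cell 1 (v 12) (v 11)) ;;
  .rep 11 2 (.put 1 (v 10 * v 2 + v 11)
    ((.get 2 (v 12 + 1) * cell 1 (v 10) (v 11) - v 13 * cell 1 (v 12) (v 11)) / .get 2 (v 12)))

/-- Row `v 10` of the integral Gram–Schmidt orthogonalization. -/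
def gsoRowCmd : Cmd :=
  .rep 11 2 (.put 1 (v 10 * v 2 + v 11) (cell 0 (v 10) (v 11))) ;;
  .rep 12 2 (.ite (.le (v 12 + 1) (v 10)) projectCmd .nop) ;;
  sumCmd 13 11 2 (cell 0 (v 10) (v 11) * cell 1 (v 10) (v 11)) ;;
  .put 2 (v 10 + 1) (v 13)

/-- Integral Gram–Schmidt orthogonalization of the rows of array `0`: the scaled Gram–Schmidt vectors
go into array `1`, the Gram determinants into array `2`. -/
def gsoCmd : Cmd := .put 2 0 1 ;; .rep 10 2 gsoRowCmd

/-- Subtraction of the nearest integral multiple of row `v 14` from row `v 10`. -/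
def subtractCmd : Cmd :=
  sumCmd 13 11 2 (cell 0 (v 10) (v 11) * cell 1 (v 14) (v 11)) ;;
  .set 15 ((2 * v 13 + .get 2 (v 14 + 1)) / (2 * .get 2 (v 14 + 1))) ;;
  .rep 11 2 (.put 0 (v 10 * v 2 + v 11) (cell 0 (v 10) (v 11) - v 15 * cell 0 (v 14) (v 11)))

/-- Size reduction of row `v 10` of array `0`. -/
def reduceRowCmd : Cmd :=
  .rep 12 2 (.ite (.le (v 12 + 1) (v 10)) (.set 14 (v 10 - 1 - v 12) ;; subtractCmd) .nop)

/-- Size reduction of the rows of array `0`. -/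
def reduceCmd : Cmd := .rep 10 2 reduceRowCmd

/-- Exchange of two consecutive rows of array `0` that violate the reduction condition. -/
def swapCmd : Cmd :=
  .set 14 0 ;;
  .rep 10 2 (.ite (.le (v 10 + 2) (v 2))
    (.ite (.le (2 * .get 2 (v 10 + 2) * .get 2 (v 10) + 1) (.get 2 (v 10 + 1) * .get 2 (v 10 + 1)))
      (.set 14 (v 10 + 1)) .nop) .nop) ;;
  .ite (v 14)
    (.rep 11 2 (.put 3 (v 11) (cell 0 (v 14) (v 11))) ;;
      .rep 11 2 (.put 0 (v 14 * v 2 + v 11) (cell 0 (v 14 - 1) (v 11))) ;;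
      .rep 11 2 (.put 0 ((v 14 - 1) * v 2 + v 11) (.get 3 (v 11)))) .nop

/-- Lattice basis reduction of the rows of array `0`. -/
def reductionCmd : Cmd := .rep 19 4 (gsoCmd ;; reduceCmd ;; swapCmd)

/-- The lattice basis: row `i` of array `3` holds the scaled coefficients of `(P₀ - x) ^ i`, and
row `i` of array `0` the same times `K ^ (L / 2 - i)`. -/
def latticeCmd : Cmd :=
  .set 16 (v 0 - v 9) ;;
  .rep 11 2 (.put 3 (v 11) (.equals (v 11) 0)) ;;
  .rep 10 2 (
    .set 13 1 ;;
    .rep 12 2 (.ite (.le (v 10 + v 12 + 1) (v 2 / 2)) (.set 13 (v 13 * v 17)) .nop) ;;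
    .rep 11 2 (.put 0 (v 10 * v 2 + v 11) (v 13 * cell 3 (v 10) (v 11))) ;;
    .rep 11 2 (.put 3 ((v 10 + 1) * v 2 + v 11)
      (v 16 * cell 3 (v 10) (v 11) -
        (1 - .equals (v 11) 0) * (v 7 * cell 3 (v 10) (v 11 - 1)))))

/-- Unscaling of the first lattice vector to a polynomial, in array `5`. -/
def polyCmd : Cmd :=
  .set 13 1 ;;
  .rep 11 2 (.put 5 (v 11) (.get 0 (v 11) / v 13) ;; .set 13 (v 13 * v 7))

/-- The Newton coefficients, in array `7`, of the square of the polynomial in array `5`. -/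
def newtonCmd : Cmd :=
  .rep 10 3 (
    .set 13 0 ;; .set 14 1 ;;
    .rep 11 2 (.set 13 (v 13 + .get 5 (v 11) * v 14) ;; .set 14 (v 14 * v 10)) ;;
    .put 6 (v 10) (v 13 * v 13)) ;;
  .put 6 (v 3) 0 ;;
  .rep 10 3 (.put 7 (v 3 + v 10) 0) ;;
  .rep 10 3 (
    .put 7 (v 10) (.get 6 0) ;;
    .rep 11 3 (.put 6 (v 11) (.get 6 (v 11 + 1) - .get 6 (v 11))))

/-- Variable `21` tells whether the difference of order `v 18` is positive at `v 20`. -/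
def signCmd : Cmd :=
  .set 13 0 ;; .set 14 1 ;;
  .rep 11 3 (.set 13 (v 13 + v 14 * .get 7 (v 18 + v 11)) ;;
    .set 14 (v 14 * (v 20 - v 11) / (v 11 + 1))) ;;
  .set 21 (.le 1 (v 13))

/-- Binary search for a sign change between the breakpoints `v 15` and `v 15 + 1`. -/
def searchCmd : Cmd :=
  .set 22 (.get 8 (v 15)) ;; .set 23 (.get 8 (v 15 + 1)) ;;
  .set 20 (v 22) ;; signCmd ;; .set 24 (v 21) ;;
  .rep 12 2 (.set 20 ((v 22 + v 23) / 2) ;; signCmd ;;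
    .ite (.equals (v 21) (v 24)) (.set 22 (v 20)) (.set 23 (v 20)))

/-- The breakpoints, in array `8`, between which the polynomial does not change sign. -/
def separateCmd : Cmd :=
  .put 8 0 0 ;;
  .rep 10 3 (.put 8 (v 10 + 1) (v 7)) ;;
  .put 8 (v 3 + 1) (v 7) ;;
  .rep 10 3 (.set 18 (v 3 - 1 - v 10) ;;
    .rep 19 3 (.set 15 (v 3 - 1 - v 19) ;; searchCmd ;; .put 8 (v 15 + 1) (v 23)))

/-- Whether the value of `e` is a better candidate for the cofactor. -/
def testCmd (e : Expr) : Cmd :=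
  .set 18 e ;;
  .ite (.le (v 6 + 1) (v 18))
    (.ite (.equals (v 0 % v 18) 0)
      (.ite (.le (v 18 * v 18 + 1) (v 0)) (.set 6 (v 18)) .nop) .nop) .nop

/-- The tests of all integers that follow a breakpoint closely. -/
def candidatesCmd : Cmd := .rep 10 4 (.rep 11 2 (testCmd (v 9 + .get 8 (v 10) + v 11)))

/-- The search for the cofactor in the interval of length `v 7` that begins at `v 9`. -/
def intervalCmd : Cmd :=
  latticeCmd ;; reductionCmd ;; polyCmd ;; newtonCmd ;; separateCmd ;; candidatesCmd

/-- The choice of the interval length. -/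
def lengthCmd : Cmd :=
  .set 7 1 ;; .rep 10 2 (.ite (.le (256 * (v 7 * v 7)) (v 0)) (.set 7 (2 * v 7)) .nop)

/-- The search for the cofactor of the largest prime factor. -/
def cofactorCmd : Cmd :=
  .set 6 0 ;; .set 17 (v 1 * v 0) ;; lengthCmd ;;
  .rep 8 2 (testCmd (v 8) ;; .set 9 (v 8 * v 7) ;; intervalCmd)

/-! ### Reasoning about loops -/

/-- `s'` agrees with `s` wherever the command does not write. -/
def Frame (c : Cmd) (s s' : State) : Prop :=
  (∀ y, c.writes y = false → s'.var y = s.var y) ∧ ∀ a, c.stores a = false → s'.arr a = s.arr a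

theorem forIter_frame (x b : ℕ) (c : Cmd) (s : State) (k : ℕ) :
    Frame (.rep x b c) s (forIter x c.run k s) := by
  induction k with
  | zero =>
    refine ⟨fun y hy => ?_, fun a _ => rfl⟩
    have : y ≠ x := by rintro rfl; simp [Cmd.writes] at hy
    simp [forIter, State.setVar, this]
  | succ k ih =>
    refine ⟨fun y hy => ?_, fun a ha => ?_⟩
    · have hyx : y ≠ x := by rintro rfl; simp [Cmd.writes] at hy
      have hyc : c.writes y = false := by simp [Cmd.writes] at hy; exact hy.2
      simp only [forIter, State.setVar, Function.update_of_ne hyx]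
      rw [c.run_var hyc, ih.1 y hy]
    · change (c.run _).arr a = _
      rw [c.run_arr ha, ih.2 a ha]

theorem Cmd.frame (c : Cmd) (s : State) : Frame c s (c.run s) :=
  ⟨fun _ h => c.run_var h s, fun _ h => c.run_arr h s⟩

/-- The invariant rule for loops. What the body does not write comes for free through `Frame` and
need not be part of the invariant. -/
theorem run_for {x b : ℕ} {c : Cmd} {s : State} {n : ℕ} (P : ℕ → State → Prop)
    (hn : s.var b = n) (h₀ : P 0 (s.setVar x 0))
    (hs : ∀ k < n, ∀ s', Frame (.rep x b c) s s' → s'.var x = k → P k s' →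
      P (k + 1) ((c.run s').setVar x (k + 1))) :
    P n ((Cmd.rep x b c).run s) := by
  have : ∀ k ≤ n, P k (forIter x c.run k s) := by
    intro k hk
    induction k with
    | zero => exact h₀
    | succ k ih =>
      refine hs k (by omega) _ (forIter_frame x b c s k) ?_ (ih (by omega))
      cases k <;> simp [forIter, State.setVar]
  simpa [Cmd.run, hn] using this n le_rfl

/-- Replacement of the `n` cells from `base` on. -/
def block (f : ℤ → ℤ) (base : ℤ) (n : ℕ) (F : ℕ → ℤ) : ℤ → ℤ :=
  fun z => if base ≤ z ∧ z < base + n then F (z - base).toNat else f z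

theorem block_succ (f : ℤ → ℤ) (base : ℤ) (n : ℕ) (F : ℕ → ℤ) :
    block f base (n + 1) F = Function.update (block f base n F) (base + n) (F n) := by
  funext z
  rcases eq_or_ne z (base + n) with rfl | h
  · simp [block]
  · rw [Function.update_of_ne h]
    simp only [block]
    by_cases h' : base ≤ z ∧ z < base + n
    · rw [if_pos h', if_pos ⟨h'.1, by push_cast; omega⟩]
    · rw [if_neg h', if_neg (by push_cast; omega)]

theorem block_of_lt {f : ℤ → ℤ} {base z : ℤ} (h : z < base) (n : ℕ) (F : ℕ → ℤ) :
    block f base n F z = f z := if_neg (by omega)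

theorem block_of_le {f : ℤ → ℤ} {base z : ℤ} {n : ℕ} (h : base + n ≤ z) (F : ℕ → ℤ) :
    block f base n F z = f z := if_neg (by omega)

theorem block_apply {f : ℤ → ℤ} {base : ℤ} {n j : ℕ} (h : j < n) (F : ℕ → ℤ) :
    block f base n F (base + j) = F j := by
  rw [block, if_pos (by omega)]; congr; omega

/-- The state after `j` rounds of a loop that fills consecutive cells. -/
def fillState (s : State) (x a : ℕ) (base : ℤ) (F : ℕ → ℤ) (j : ℕ) : State where
  var := Function.update s.var x j
  arr := Function.update s.arr a (block (s.arr a) base j F)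

/-- Index and value are evaluated in the partially filled state, so the rule also covers loops that
read the array they overwrite. -/
theorem run_for_put {x b a : ℕ} {idx e : Expr} {s : State} {n : ℕ} (base : ℤ) (F : ℕ → ℤ)
    (hn : s.var b = n) (hx : x ≠ 5) (hi : ∀ j < n, idx.eval (fillState s x a base F j) = base + j)
    (he : ∀ j < n, e.eval (fillState s x a base F j) = F j) (hF : ∀ j < n, |F j| < s.var 5) :
    (Cmd.rep x b (.put a idx e)).run s = fillState s x a base F n := by
  refine run_for (fun k s' => s' = fillState s x a base F k) hn ?_ ?_
  · ext1
    · simp [State.setVar, fillState]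
    · have : block (s.arr a) base 0 F = s.arr a := by
        funext z; simp [block]
      simp [State.setVar, fillState, this]
  · rintro k hk s' - - rfl
    have h5 : (fillState s x a base F k).var 5 = s.var 5 := by
      simp [fillState, Function.update_of_ne hx.symm]
    simp only [Cmd.run, h5, hi k hk, he k hk, clamp_eq (hF k hk)]
    ext1
    · simp [State.setVar, State.setArr, fillState]
    · simp [State.setVar, State.setArr, fillState, block_succ]

/-- All partial sums have to be below `Q`, as each of them is clamped. -/
theorem run_sumCmd {y x b : ℕ} {e : Expr} {s : State} {n : ℕ} (F : ℕ → ℤ) (hn : s.var b = n)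
    (hxy : x ≠ y) (hyb : y ≠ b) (hx : x ≠ 5) (hy : y ≠ 5)
    (he : ∀ j < n, ∀ u, e.eval ((s.setVar y u).setVar x j) = F j)
    (hF : ∀ j ≤ n, |∑ i ∈ Finset.range j, F i| < s.var 5) :
    (sumCmd y x b e).run s = (s.setVar y (∑ i ∈ Finset.range n, F i)).setVar x n := by
  have h0 : clamp (s.var 5) 0 = 0 := clamp_eq (by simpa using hF 0 (by omega))
  simp only [sumCmd, Cmd.run, Expr.eval_zero, h0]
  refine run_for (c := .set y (v y + e)) (x := x) (b := b)
    (fun k s' => s' = (s.setVar y (∑ i ∈ Finset.range k, F i)).setVar x k) ?_ ?_ ?_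
  · simp [State.setVar, Function.update_of_ne hyb.symm, hn]
  · simp
  · rintro k hk s' - - rfl
    have h5 : ((s.setVar y (∑ i ∈ Finset.range k, F i)).setVar x k).var 5 = s.var 5 := by
      simp [State.setVar, Function.update_of_ne hx.symm, Function.update_of_ne hy.symm]
    have hy' : ((s.setVar y (∑ i ∈ Finset.range k, F i)).setVar x k).var y =
        ∑ i ∈ Finset.range k, F i := by
      simp [State.setVar, Function.update_of_ne hxy.symm]
    simp only [Cmd.run, h5, Expr.eval_add, he k hk, Expr.eval_var, hy']
    rw [← Finset.sum_range_succ, clamp_eq (hF (k + 1) hk)]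
    ext1
    · funext z
      simp only [State.setVar, Function.update_apply]
      split_ifs <;> simp_all
    · rfl

end LogCost

/-! ### Correctness of the integral Gram–Schmidt orthogonalization. -/

namespace LogCost

open LatticeReduction
open scoped RealInnerProductSpace

theorem abs_lt_of_real {z Q : ℤ} {r : ℝ} (h : |(z : ℝ)| ≤ r) (hr : r < Q) : |z| < Q := by
  exact_mod_cast lt_of_le_of_lt h hr

theorem row_block_self {L k : ℕ} (f : ℤ → ℤ) (F : ℕ → ℤ) (hk : k < L) :
    row L (block f (k * L) L F) k = WithLp.toLp 2 fun j : Fin L => (F j : ℝ) :=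
  row_ext hk fun j => by rw [block_apply j.2]

theorem mul_add_lt_of_lt {L i k j : ℕ} (hik : i < k) (hj : j < L) :
    (i * L + j : ℤ) < k * L := by
  have : (i + 1) * L ≤ k * L := Nat.mul_le_mul_right L hik
  have h : i * L + j < k * L := by linarith
  exact_mod_cast h

theorem block_cell_ne {L i k j n : ℕ} (f : ℤ → ℤ) (F : ℕ → ℤ) (hj : j < L) (hn : n ≤ L)
    (hik : i ≠ k) : block f (k * L) n F (i * L + j) = f (i * L + j) := by
  rcases Nat.lt_or_gt_of_ne hik with h | h
  · exact block_of_lt (mul_add_lt_of_lt h hj) _ _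
  · refine block_of_le ?_ _
    have : (k + 1) * L ≤ i * L := Nat.mul_le_mul_right L h
    have h : k * L + n ≤ i * L + j := by linarith
    exact_mod_cast h

theorem row_block_ne {L i k n : ℕ} (f : ℤ → ℤ) (F : ℕ → ℤ) (hn : n ≤ L) (hik : i ≠ k) :
    row L (block f (k * L) n F) i = row L f i := by
  rcases Nat.lt_or_ge i L with hi | hi
  · exact row_ext hi fun j => by rw [block_cell_ne f F j.2 hn hik, row_apply f hi]
  · rw [row_of_le _ hi, row_of_le _ hi]

theorem abs_sum_mul_le {L k i : ℕ} (A C : ℤ → ℤ) (hk : k < L) (hi : i < L) {j : ℕ} (hj : j ≤ L) :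
    |((∑ l ∈ Finset.range j, A (k * L + l) * C (i * L + l) : ℤ) : ℝ)| ≤
      L * (‖row L A k‖ * ‖row L C i‖) := by
  push_cast
  calc _ ≤ ∑ l ∈ Finset.range j, |(A (k * L + l) : ℝ) * C (i * L + l)| :=
        Finset.abs_sum_le_sum_abs _ _
    _ ≤ ∑ l ∈ Finset.range j, ‖row L A k‖ * ‖row L C i‖ := by
        refine Finset.sum_le_sum fun l hl => ?_
        have hl : l < L := (Finset.mem_range.1 hl).trans_le hj
        rw [abs_mul]
        exact mul_le_mul (abs_coord_le A hk hl) (abs_coord_le C hi hl) (abs_nonneg _)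
          (norm_nonneg _)
    _ = j * (‖row L A k‖ * ‖row L C i‖) := by simp
    _ ≤ _ := by gcongr

theorem exists_int_coord {L : ℕ} {A : ℤ → ℤ} (hg : ∀ j < L, gs (row L A) j ≠ 0) {i k : ℕ}
    (hk : k < L) (hi : i ≤ L) (j : Fin L) :
    ∃ z : ℤ, (gramDet (row L A) i • prj (row L A) i (row L A k)) j = z := by
  obtain ⟨d, y, -, h⟩ := exists_int_smul_prj (b := row L A) (k := i) (x := row L A k)
    (fun j hj => hg j (by omega))
    (fun p hp q hq => ⟨_, inner_row A A (by omega) (by omega)⟩)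
    (fun p hp => ⟨_, inner_row A A (by omega) hk⟩)
  refine ⟨d * A (k * L + j) - ∑ p, y p * A (p * L + j), ?_⟩
  rw [h, PiLp.sub_apply, PiLp.smul_apply, row_apply A hk, WithLp.ofLp_sum, Finset.sum_apply]
  push_cast
  congr 1
  refine Finset.sum_congr rfl fun p _ => ?_
  rw [PiLp.smul_apply, row_apply A (p.2.trans_le hi)]
  rfl

/-- The fraction-free recurrence behind `projectCmd`: `prj_succ` multiplied by `gramDet b i *
gramDet b (i + 1)`. -/
theorem smul_prj_succ {E : Type*} [NormedAddCommGroup E] [InnerProductSpace ℝ E]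
    [FiniteDimensional ℝ E] {b : ℕ → E} {i : ℕ} (h : gs b i ≠ 0) (x : E) :
    gramDet b i • (gramDet b (i + 1) • prj b (i + 1) x) =
      gramDet b (i + 1) • (gramDet b i • prj b i x) -
        ⟪x, gramDet b i • gs b i⟫ • (gramDet b i • gs b i) := by
  have : ‖gs b i‖ ≠ 0 := norm_ne_zero_iff.2 h
  rw [prj_succ, gramDet_succ, inner_smul_right]
  simp only [smul_sub, smul_smul]
  congr 2
  · ring
  · field_simp

/-- What Gram–Schmidt orthogonalization of `b` leaves in the arrays `1` and `2`. -/
structure GsoData (L : ℕ) (s : State) (b : ℕ → EuclideanSpace ℝ (Fin L)) : Prop where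
  det : ∀ k ≤ L, (s.arr 2 k : ℝ) = gramDet b k
  vec : ∀ k < L, row L (s.arr 1) k = gramDet b k • gs b k

/-- A positive integer. This lower bound is what makes the reduction terminate. -/
theorem one_le_gramDet {L : ℕ} {A : ℤ → ℤ} (hg : ∀ j < L, gs (row L A) j ≠ 0) {k : ℕ}
    (hk : k ≤ L) : 1 ≤ gramDet (row L A) k := by
  obtain ⟨d, -, h, -⟩ := exists_int_smul_prj (b := row L A) (k := k) (x := 0)
    (fun j hj => hg j (by omega))
    (fun p hp q hq => ⟨_, inner_row A A (by omega) (by omega)⟩)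
    (fun p hp => ⟨0, by simp⟩)
  have := gramDet_pos (b := row L A) (k := k) (fun j hj => hg j (by omega))
  rw [h] at this ⊢
  exact_mod_cast this

/-- By `exists_int_coord` the next scaled projection is integral, so in `smul_prj_succ` the division
by `gramDet b i` is exact. The bound `L * H ^ (2 * L + 2)` allows for a Gram determinant, at most `H
^ (2 * L)`, and an inner product of two vectors of length at most `H`. -/
theorem run_project {s : State} {L k : ℕ} {b : ℕ → EuclideanSpace ℝ (Fin L)}
    (hb : b = row L (s.arr 0)) (hL : s.var 2 = L) (hk : k < L) (h10 : s.var 10 = k) {H : ℝ}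
    (hH : 1 ≤ H) (hbH : ∀ j < L, ‖b j‖ ≤ H) (hg : ∀ j < L, gs b j ≠ 0)
    (hQ : L * H ^ (2 * L + 2) < s.var 5) {i : ℕ} (hi : i < k) (h12 : s.var 12 = i)
    (hd : ∀ j ≤ k, (s.arr 2 j : ℝ) = gramDet b j)
    (hc : ∀ j < k, row L (s.arr 1) j = gramDet b j • gs b j)
    (hck : row L (s.arr 1) k = gramDet b i • prj b i (b k)) {s' : State}
    (hs' : s' = projectCmd.run s) :
    (∀ j < k, row L (s'.arr 1) j = gramDet b j • gs b j) ∧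
      row L (s'.arr 1) k = gramDet b (i + 1) • prj b (i + 1) (b k) := by
  have hpow : ∀ j ≤ L, gramDet b j ≤ H ^ (2 * L) := fun j hj =>
    (gramDet_le fun l hl => (norm_prj_le _ _ _).trans (hbH l (by omega))).trans
      (pow_le_pow_right₀ hH (by omega))
  have hpos : ∀ j ≤ L, 0 < gramDet b j := fun j hj => gramDet_pos fun l hl => hg l (by omega)
  have hL1 : (1 : ℝ) ≤ L := by exact_mod_cast (by omega : 1 ≤ L)
  have hsum := run_sumCmd (y := 13) (x := 11) (b := 2) (s := s) (n := L)
    (e := cell 0 (v 10) (v 11) * cell 1 (v 12) (v 11))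
    (fun j => s.arr 0 (k * L + j) * s.arr 1 (i * L + j)) hL (by norm_num) (by norm_num)
    (by norm_num) (by norm_num)
    (fun j _ u => by simp [cell, State.setVar, h10, h12, hL]) (fun j hj => by
      refine abs_lt_of_real (abs_sum_mul_le (s.arr 0) (s.arr 1) hk (by omega) hj) (lt_of_le_of_lt ?_ hQ)
      rw [hc i hi, ← hb, norm_smul, Real.norm_of_nonneg (hpos i (by omega)).le]
      calc (L : ℝ) * (‖b k‖ * (gramDet b i * ‖gs b i‖)) ≤ L * (H * (H ^ (2 * L) * H)) := by
            have := (hpos i (by omega)).le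
            gcongr
            · exact hbH k hk
            · exact hpow i (by omega)
            · exact (norm_prj_le _ _ _).trans (hbH i (by omega))
        _ = _ := by ring)
  set u : ℤ := ∑ j ∈ Finset.range L, s.arr 0 (k * L + j) * s.arr 1 (i * L + j) with hu
  have hur : (u : ℝ) = ⟪b k, gramDet b i • gs b i⟫ := by
    rw [← hc i hi, hb, inner_row _ _ hk (by omega)]
  have hcoord := fun j : Fin L => exists_int_coord (A := s.arr 0) (hb ▸ hg) (i := i + 1) hk
    (by omega) j
  rw [← hb] at hcoord
  choose z hz using hcoord
  let F : ℕ → ℤ := fun j => if h : j < L then z ⟨j, h⟩ else 0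
  have hF : ∀ j (hj : j < L), (F j : ℝ) =
      (gramDet b (i + 1) • prj b (i + 1) (b k)) ⟨j, hj⟩ := fun j hj => by simp [F, hj, hz]
  set s₁ := (s.setVar 13 u).setVar 11 L with hs₁
  have hfill := run_for_put (x := 11) (b := 2) (a := 1) (s := s₁) (n := L)
    (idx := v 10 * v 2 + v 11)
    (e := (.get 2 (v 12 + 1) * cell 1 (v 10) (v 11) - v 13 * cell 1 (v 12) (v 11)) /
            .get 2 (v 12)) (k * L) F (by simp [hs₁, State.setVar, hL]) (by norm_num)
    (fun j hj => by simp [hs₁, State.setVar, fillState, hL, h10])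
    (fun j hj => by
      have e₁ : block (s.arr 1) (k * L) j F (k * L + j) = s.arr 1 (k * L + j) :=
        block_of_le le_rfl _
      have e₂ : block (s.arr 1) (k * L) j F (i * L + j) = s.arr 1 (i * L + j) :=
        block_cell_ne _ _ hj hj.le hi.ne
      simp only [cell, hs₁, State.setVar, fillState, Expr.eval_div, Expr.eval_sub, Expr.eval_mul,
        Expr.eval_get, Expr.eval_add, Expr.eval_var, Expr.eval_one]
      simp [h10, h12, hL, e₁, e₂]
      have hdi : (s.arr 2 i : ℝ) ≠ 0 := by rw [hd i hi.le]; exact (hpos i (by omega)).ne'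
      refine Int.ediv_eq_of_eq_mul_right (by exact_mod_cast hdi) ?_
      obtain ⟨W, hW⟩ : ∃ W, W = gramDet b (i + 1) • prj b (i + 1) (b k) := ⟨_, rfl⟩
      have key := smul_prj_succ (hg i (by omega)) (b k)
      rw [← hur, ← hck, ← hc i hi, ← hW] at key
      have key := congrArg (fun x : EuclideanSpace ℝ (Fin L) => x ⟨j, hj⟩) key
      simp only [PiLp.sub_apply, PiLp.smul_apply, smul_eq_mul] at key
      rw [hW, ← hF j hj, ← hd i hi.le, ← hd (i + 1) hi, row_apply _ hk,
        row_apply _ (by omega)] at key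
      symm
      exact_mod_cast key)
    (fun j hj => by
      have h5 : s₁.var 5 = s.var 5 := by simp [hs₁, State.setVar]
      rw [h5]
      refine abs_lt_of_real (r := L * H ^ (2 * L + 2)) ?_ hQ
      rw [hF j hj, ← Real.norm_eq_abs]
      refine (PiLp.norm_apply_le _ _).trans ?_
      rw [norm_smul, Real.norm_of_nonneg (hpos (i + 1) (by omega)).le]
      calc _ ≤ H ^ (2 * L) * H := by
            gcongr
            · exact hpow (i + 1) (by omega)
            · exact (norm_prj_le _ _ _).trans (hbH k hk)
        _ = 1 * H ^ (2 * L + 1) := by ring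
        _ ≤ L * H ^ (2 * L + 2) := by (gcongr; omega))
  have hs'' : s' = fillState s₁ 11 1 (k * L) F L := by
    rw [hs', ← hfill]
    change (Cmd.rep _ _ _).run ((sumCmd 13 11 2 _).run s) = _
    rw [hsum]
  have harr : s'.arr 1 = block (s.arr 1) (k * L) L F := by
    rw [hs'']; simp [fillState, hs₁, State.setVar]
  refine ⟨fun j hj => ?_, ?_⟩
  · rw [harr, row_block_ne _ _ le_rfl hj.ne, hc j hj]
  · rw [harr, row_block_self _ _ hk]
    ext j
    exact hF j j.2

theorem run_gsoRow {s : State} {L k : ℕ} {b : ℕ → EuclideanSpace ℝ (Fin L)}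
    (hb : b = row L (s.arr 0)) (hL : s.var 2 = L) (hk : k < L) (h10 : s.var 10 = k) {H : ℝ}
    (hH : 1 ≤ H) (hbH : ∀ j < L, ‖b j‖ ≤ H) (hg : ∀ j < L, gs b j ≠ 0)
    (hQ : L * H ^ (2 * L + 2) < s.var 5) (hd : ∀ j ≤ k, (s.arr 2 j : ℝ) = gramDet b j)
    (hc : ∀ j < k, row L (s.arr 1) j = gramDet b j • gs b j) :
    (∀ j ≤ k + 1, ((gsoRowCmd.run s).arr 2 j : ℝ) = gramDet b j) ∧
      ∀ j < k + 1, row L ((gsoRowCmd.run s).arr 1) j = gramDet b j • gs b j := by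
  have hpow : ∀ j ≤ L, gramDet b j ≤ H ^ (2 * L) := fun j hj =>
    (gramDet_le fun l hl => (norm_prj_le _ _ _).trans (hbH l (by omega))).trans
      (pow_le_pow_right₀ hH (by omega))
  have hpos : ∀ j ≤ L, 0 < gramDet b j := fun j hj => gramDet_pos fun l hl => hg l (by omega)
  have hL1 : (1 : ℝ) ≤ L := by exact_mod_cast (by omega : 1 ≤ L)
  have hcopy := run_for_put (x := 11) (b := 2) (a := 1) (s := s) (n := L)
    (idx := v 10 * v 2 + v 11) (e := cell 0 (v 10) (v 11)) (k * L)
    (fun j => s.arr 0 (k * L + j)) hL (by norm_num)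
    (fun j hj => by simp [fillState, hL, h10]) (fun j hj => by simp [fillState, cell, hL, h10])
    (fun j hj => by
      refine abs_lt_of_real ((abs_coord_le (s.arr 0) hk hj).trans (hb ▸ hbH k hk)) (lt_of_le_of_lt ?_ hQ)
      calc H = 1 * H ^ 1 := by ring
        _ ≤ L * H ^ (2 * L + 2) := by gcongr; omega)
  obtain ⟨s₁, hs₁⟩ : ∃ s₁, s₁ = fillState s 11 1 (k * L) (fun j => s.arr 0 (k * L + j)) L := ⟨_, rfl⟩
  rw [← hs₁] at hcopy
  have a1 : s₁.arr 1 = block (s.arr 1) (k * L) L (fun j => s.arr 0 (k * L + j)) := by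
    simp [hs₁, fillState]
  have fr₁ : Frame _ s s₁ := hcopy ▸ Cmd.frame _ s
  obtain ⟨s₂, hs₂⟩ : ∃ s₂, s₂ =
    (Cmd.rep 12 2 (.ite (.le (v 12 + 1) (v 10)) projectCmd .nop)).run s₁ := ⟨_, rfl⟩
  have fr₂ : Frame _ s₁ s₂ := hs₂ ▸ Cmd.frame _ s₁
  have hloop := run_for (x := 12) (b := 2) (n := L) (s := s₁)
    (c := .ite (.le (v 12 + 1) (v 10)) projectCmd .nop)
    -- The loop makes `L` rounds, but only those with `i < k` project, hence `min i k`.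
    (fun i s' => (∀ j < k, row L (s'.arr 1) j = gramDet b j • gs b j) ∧
      row L (s'.arr 1) k = gramDet b (min i k) • prj b (min i k) (b k)) ((fr₁.1 2 rfl).trans hL)
    ⟨fun j hj => by
      change row L (s₁.arr 1) j = _
      rw [a1, row_block_ne _ _ le_rfl hj.ne, hc j hj], by
      change row L (s₁.arr 1) k = _
      rw [a1, row_block_self _ _ hk, Nat.zero_min, prj_zero, hb]
      ext j
      simp [gramDet, row_apply _ hk]⟩ (by
    rintro i hi s' fr h12 ⟨hc', hck'⟩
    have g10 : s'.var 10 = k := (fr.1 10 rfl).trans ((fr₁.1 10 rfl).trans h10)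
    rcases Nat.lt_or_ge i k with hik | hik
    · have htest : (Expr.le (v 12 + 1) (v 10)).eval s' ≠ 0 := by
        have : (i : ℤ) + 1 ≤ k := by omega
        simp [h12, g10, this]
      rw [Nat.min_eq_left hik.le] at hck'
      rw [Nat.min_eq_left hik, Cmd.run, if_pos htest]
      exact run_project (s := s') (s' := projectCmd.run s') (hb.trans (by rw [fr.2 0 rfl, fr₁.2 0 rfl]))
        ((fr.1 2 rfl).trans ((fr₁.1 2 rfl).trans hL)) hk
        g10 hH hbH hg (by rw [fr.1 5 rfl, fr₁.1 5 rfl]; exact hQ) hik h12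
        (fun j hj => by rw [fr.2 2 rfl, fr₁.2 2 rfl]; exact hd j hj) hc' hck' rfl
    · have htest : (Expr.le (v 12 + 1) (v 10)).eval s' = 0 := by
        have : ¬ (i : ℤ) + 1 ≤ k := by omega
        simp [h12, g10, this]
      rw [Nat.min_eq_right hik] at hck'
      rw [Nat.min_eq_right (by omega), Cmd.run, if_neg (by simpa using htest)]
      exact ⟨hc', hck'⟩)
  rw [← hs₂, Nat.min_eq_right hk.le] at hloop
  obtain ⟨hc₂, hck₂⟩ := hloop
  have g10 : s₂.var 10 = k := (fr₂.1 10 rfl).trans ((fr₁.1 10 rfl).trans h10)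
  have g2 : s₂.var 2 = L := (fr₂.1 2 rfl).trans ((fr₁.1 2 rfl).trans hL)
  have g5 : s₂.var 5 = s.var 5 := (fr₂.1 5 rfl).trans (fr₁.1 5 rfl)
  have b0 : s₂.arr 0 = s.arr 0 := (fr₂.2 0 rfl).trans (fr₁.2 0 rfl)
  have b2 : s₂.arr 2 = s.arr 2 := (fr₂.2 2 rfl).trans (fr₁.2 2 rfl)
  have hbound : ∀ j ≤ L, |((∑ l ∈ Finset.range j, s.arr 0 (k * L + l) * s₂.arr 1 (k * L + l) : ℤ) : ℝ)|
      ≤ L * H ^ (2 * L + 2) := fun j hj => by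
    refine (abs_sum_mul_le (s.arr 0) (s₂.arr 1) hk hk hj).trans ?_
    rw [hck₂, ← hb, norm_smul, Real.norm_of_nonneg (hpos k hk.le).le]
    calc (L : ℝ) * (‖b k‖ * (gramDet b k * ‖prj b k (b k)‖)) ≤ L * (H * (H ^ (2 * L) * H)) := by
          have := (hpos k hk.le).le
          gcongr
          · exact hbH k hk
          · exact hpow k hk.le
          · exact (norm_prj_le _ _ _).trans (hbH k hk)
      _ = _ := by ring
  have hsum := run_sumCmd (y := 13) (x := 11) (b := 2) (s := s₂) (n := L)
    (e := cell 0 (v 10) (v 11) * cell 1 (v 10) (v 11))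
    (fun j => s.arr 0 (k * L + j) * s₂.arr 1 (k * L + j)) g2 (by norm_num) (by norm_num)
    (by norm_num) (by norm_num)
    (fun j _ u => by simp [cell, State.setVar, g10, g2, b0]) (fun j hj => by
      rw [g5]; exact abs_lt_of_real (hbound j hj) hQ)
  set u : ℤ := ∑ j ∈ Finset.range L, s.arr 0 (k * L + j) * s₂.arr 1 (k * L + j) with hu
  -- The inner product of `b k` with `gramDet b k • gs b k` is `gramDet b k * ‖gs b k‖ ^ 2`.
  have hur : (u : ℝ) = gramDet b (k + 1) := by
    have := inner_row (s.arr 0) (s₂.arr 1) hk hk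
    rw [hu, ← this, hck₂, ← hb, inner_smul_right, ← gs, inner_gs_self, gramDet_succ]
  have hcl : clamp (s.var 5) u = u := clamp_eq (abs_lt_of_real (hbound L le_rfl) hQ)
  have hrun : gsoRowCmd.run s = ((s₂.setVar 13 u).setVar 11 L).setArr 2 (k + 1) u := by
    change (Cmd.put 2 (v 10 + 1) (v 13)).run ((sumCmd 13 11 2 _).run (Cmd.run _ (Cmd.run _ s))) = _
    rw [hcopy, ← hs₂, hsum]
    simp [Cmd.run, State.setVar, g10, g5, hcl]
  rw [hrun]
  refine ⟨fun j hj => ?_, fun j hj => ?_⟩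
  · rcases Nat.lt_or_ge k j with h | h
    · obtain rfl : j = k + 1 := by omega
      simp [State.setArr, hur]
    · have h' : (j : ℤ) ≠ k + 1 := by omega
      simp [State.setArr, State.setVar, h', b2, hd j h]
  · change row L (s₂.arr 1) j = _
    rcases Nat.lt_or_ge j k with h | h
    · exact hc₂ j h
    · obtain rfl : j = k := by omega
      exact hck₂

theorem run_gso {s : State} {L : ℕ} {b : ℕ → EuclideanSpace ℝ (Fin L)} (hL0 : 0 < L)
    (hb : b = row L (s.arr 0)) (hL : s.var 2 = L) {H : ℝ}
    (hH : 1 ≤ H) (hbH : ∀ j < L, ‖b j‖ ≤ H) (hg : ∀ j < L, gs b j ≠ 0)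
    (hQ : L * H ^ (2 * L + 2) < s.var 5) : GsoData L (gsoCmd.run s) b := by
  have hL1 : (1 : ℝ) ≤ L := by exact_mod_cast hL0
  have h1Q : (1 : ℝ) < s.var 5 := by
    refine lt_of_le_of_lt ?_ hQ
    have : (1 : ℝ) ≤ H ^ (2 * L + 2) := one_le_pow₀ hH
    nlinarith
  have hclamp1 : clamp (s.var 5) 1 = 1 := clamp_eq (by simpa using (by exact_mod_cast h1Q))
  have main := run_for (x := 10) (b := 2) (n := L) (s := (Cmd.put 2 0 1).run s) (c := gsoRowCmd)
    (fun k s' => (∀ j ≤ k, (s'.arr 2 j : ℝ) = gramDet b j) ∧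
      ∀ j < k, row L (s'.arr 1) j = gramDet b j • gs b j) (by simpa [Cmd.run, State.setArr] using hL)
    ⟨fun j hj => by
      obtain rfl : j = 0 := by omega
      simp [Cmd.run, State.setArr, State.setVar, hclamp1, gramDet], fun j hj => absurd hj (by omega)⟩
    (by
      rintro k hk s' fr h10 ⟨hd, hc⟩
      exact run_gsoRow (s := s') (hb.trans (by rw [fr.2 0 rfl]; simp [Cmd.run, State.setArr]))
        ((fr.1 2 rfl).trans hL) hk h10 hH hbH hg (by rw [fr.1 5 rfl]; exact hQ) hd hc)
  exact ⟨main.1, main.2⟩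

end LogCost

/-! ### Size reduction. -/

namespace LogCost

open LatticeReduction
open scoped RealInnerProductSpace

theorem row_congr {L k l : ℕ} {A B : ℤ → ℤ} (hk : k < L) (hl : l < L)
    (h : ∀ j < L, A (k * L + j) = B (l * L + j)) : row L A k = row L B l := by
  ext j
  rw [row_apply A hk, row_apply B hl, h j j.2]

theorem row_eq_sub {L k i : ℕ} {A B : ℤ → ℤ} {q : ℤ} (hk : k < L) (hi : i < L)
    (h : ∀ j < L, B (k * L + j) = A (k * L + j) - q * A (i * L + j)) :
    row L B k = row L A k - (q : ℝ) • row L A i := by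
  ext j
  rw [row_apply B hk, PiLp.sub_apply, PiLp.smul_apply, row_apply A hk, row_apply A hi, h j j.2]
  push_cast
  rfl

/-- Here `b` is the basis that was orthogonalized, while the stored row `k` may have changed since.
`W` tracks the growth of that row, which one subtraction multiplies by at most `3 * L * H ^ (2 * L +
2)`. -/
theorem run_subtract {s : State} {L k i : ℕ} {b : ℕ → EuclideanSpace ℝ (Fin L)}
    (hL : s.var 2 = L) (hk : k < L) (h10 : s.var 10 = k) (h14 : s.var 14 = i) (hi : i < k)
    (hG : GsoData L s b) (hdet : ∀ j ≤ L, 1 ≤ gramDet b j) {H W : ℝ} (hH : 1 ≤ H) (hW : 1 ≤ W)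
    (hβ : ∀ j < L, ‖gs b j‖ ≤ H) (hw : ‖row L (s.arr 0) k‖ ≤ W) (hbi : ‖row L (s.arr 0) i‖ ≤ H)
    (hQ : 3 * L * H ^ (2 * L + 2) * W < s.var 5) :
    ∃ q : ℤ, (∀ l ≠ k, ∀ j < L,
        (subtractCmd.run s).arr 0 (l * L + j) = s.arr 0 (l * L + j)) ∧
      (∀ j < L, (subtractCmd.run s).arr 0 (k * L + j) =
        s.arr 0 (k * L + j) - q * s.arr 0 (i * L + j)) ∧
      |⟪row L (s.arr 0) k, gs b i⟫ - q * ‖gs b i‖ ^ 2| ≤ ‖gs b i‖ ^ 2 / 2 ∧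
      ‖row L ((subtractCmd.run s).arr 0) k‖ ≤ 3 * L * H ^ (2 * L + 2) * W := by
  have hpow : ∀ j ≤ L, gramDet b j ≤ H ^ (2 * L) := fun j hj =>
    (gramDet_le fun l hl => hβ l (by omega)).trans (pow_le_pow_right₀ hH (by omega))
  have hL1 : (1 : ℝ) ≤ L := by exact_mod_cast (by omega : 1 ≤ L)
  have hci : ‖row L (s.arr 1) i‖ ≤ H ^ (2 * L) * H := by
    have := hdet i (by omega)
    rw [hG.vec i (by omega), norm_smul, Real.norm_of_nonneg (by linarith)]
    gcongr
    · exact hpow i (by omega)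
    · exact hβ i (by omega)
  have hHp : (1 : ℝ) ≤ H ^ (2 * L + 2) := one_le_pow₀ hH
  have hP : (1 : ℝ) ≤ H ^ (2 * L + 1) := one_le_pow₀ hH
  have hPP : H ^ (2 * L + 1) ≤ H ^ (2 * L + 2) := pow_le_pow_right₀ hH (by omega)
  have hsum := run_sumCmd (y := 13) (x := 11) (b := 2) (s := s) (n := L)
    (e := cell 0 (v 10) (v 11) * cell 1 (v 14) (v 11))
    (fun j => s.arr 0 (k * L + j) * s.arr 1 (i * L + j)) hL (by norm_num) (by norm_num)
    (by norm_num) (by norm_num)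
    (fun j _ u => by simp [cell, State.setVar, h10, h14, hL]) (fun j hj => by
      refine abs_lt_of_real (abs_sum_mul_le (s.arr 0) (s.arr 1) hk (by omega) hj) (lt_of_le_of_lt ?_ hQ)
      calc (L : ℝ) * (‖row L (s.arr 0) k‖ * ‖row L (s.arr 1) i‖)
          ≤ L * (W * (H ^ (2 * L) * H)) := by gcongr
        _ = 1 * L * H ^ (2 * L + 1) * W := by ring
        _ ≤ _ := by gcongr; norm_num)
  set u : ℤ := ∑ j ∈ Finset.range L, s.arr 0 (k * L + j) * s.arr 1 (i * L + j) with hu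
  have hur : (u : ℝ) = gramDet b i * ⟪row L (s.arr 0) k, gs b i⟫ := by
    rw [← inner_smul_right, ← hG.vec i (by omega), inner_row _ _ hk (by omega)]
  have hu_abs : |(u : ℝ)| ≤ W * H ^ (2 * L + 1) := by
    rw [hu, ← inner_row _ _ hk (by omega)]
    refine (abs_real_inner_le_norm _ _).trans ?_
    calc _ ≤ W * (H ^ (2 * L) * H) := by gcongr
      _ = _ := by ring
  set d : ℤ := s.arr 2 (i + 1) with hd
  have hdr : (d : ℝ) = gramDet b i * ‖gs b i‖ ^ 2 := by
    have := hG.det (i + 1) (by omega)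
    push_cast at this
    rw [hd, this, gramDet_succ]
  have hd1 : (1 : ℝ) ≤ d := by
    have := hG.det (i + 1) (by omega)
    push_cast at this
    rw [hd, this]; exact hdet _ (by omega)
  have hdpos : 0 < d := by exact_mod_cast lt_of_lt_of_le one_pos hd1
  -- `u / d` is the Gram–Schmidt coefficient of row `k` at `i`, and `q` is an integer nearest to it.
  set q : ℤ := (2 * u + d) / (2 * d) with hq
  have hq₁ : 2 * d * q ≤ 2 * u + d := Int.mul_ediv_self_le (by omega)
  have hq₂ : 2 * u + d < 2 * d * q + 2 * d := by
    have := Int.lt_mul_ediv_self_add (x := 2 * u + d) (k := 2 * d) (by omega)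
    exact this
  have hround : |(u : ℝ) - q * d| ≤ d / 2 := by
    rw [abs_le]
    have h₁ : (2 * d * q : ℝ) ≤ 2 * u + d := by exact_mod_cast hq₁
    have h₂ : (2 * u + d : ℝ) ≤ 2 * d * q + 2 * d := by exact_mod_cast hq₂.le
    constructor <;> linarith
  have hqabs : |(q : ℝ)| ≤ 2 * W * H ^ (2 * L + 1) := by
    have h₁ : |(q : ℝ)| * d ≤ |(u : ℝ)| + d / 2 := by
      calc |(q : ℝ)| * d = |(q : ℝ) * d| := by rw [abs_mul, abs_of_nonneg (by linarith : (0 : ℝ) ≤ d)]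
        _ = |(u : ℝ) - (u - q * d)| := by ring_nf
        _ ≤ |(u : ℝ)| + |(u : ℝ) - q * d| := abs_sub _ _
        _ ≤ _ := by linarith
    have h₂ : |(u : ℝ)| ≤ |(u : ℝ)| * d := le_mul_of_one_le_right (abs_nonneg _) hd1
    have h₃ : |(q : ℝ)| ≤ |(u : ℝ)| + 1 / 2 := by
      have : |(q : ℝ)| * d ≤ (|(u : ℝ)| + 1 / 2) * d := by linarith
      exact le_of_mul_le_mul_right this (by linarith)
    have h₄ : 1 ≤ W * H ^ (2 * L + 1) := one_le_mul_of_one_le_of_one_le hW hP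
    linarith
  have hqQ : |q| < s.var 5 := by
    refine abs_lt_of_real hqabs (lt_of_le_of_lt ?_ hQ)
    calc 2 * W * H ^ (2 * L + 1) = 2 * 1 * H ^ (2 * L + 1) * W := by ring
      _ ≤ 3 * L * H ^ (2 * L + 2) * W := by gcongr; norm_num
  set s₁ := ((s.setVar 13 u).setVar 11 L).setVar 15 q with hs₁
  let F : ℕ → ℤ := fun j => s.arr 0 (k * L + j) - q * s.arr 0 (i * L + j)
  let z : EuclideanSpace ℝ (Fin L) := row L (s.arr 0) k - (q : ℝ) • row L (s.arr 0) i
  have hz : ‖z‖ ≤ 3 * L * H ^ (2 * L + 2) * W := by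
    calc ‖z‖ ≤ ‖row L (s.arr 0) k‖ + |(q : ℝ)| * ‖row L (s.arr 0) i‖ := by
          refine (norm_sub_le _ _).trans ?_
          rw [norm_smul, Real.norm_eq_abs]
      _ ≤ W + 2 * W * H ^ (2 * L + 1) * H := by gcongr
      _ = W * (1 + 2 * H ^ (2 * L + 2)) := by ring
      _ ≤ W * (3 * H ^ (2 * L + 2)) := by gcongr; linarith
      _ = 3 * 1 * H ^ (2 * L + 2) * W := by ring
      _ ≤ _ := by gcongr
  have hFz : ∀ j (hj : j < L), (F j : ℝ) = z ⟨j, hj⟩ := fun j hj => by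
    simp only [z, F]
    rw [PiLp.sub_apply, PiLp.smul_apply, row_apply _ hk, row_apply _ (by omega)]
    push_cast
    rfl
  have hfill := run_for_put (x := 11) (b := 2) (a := 0) (s := s₁) (n := L)
    (idx := v 10 * v 2 + v 11) (e := cell 0 (v 10) (v 11) - v 15 * cell 0 (v 14) (v 11)) (k * L) F
    (by simp [hs₁, State.setVar, hL]) (by norm_num)
    (fun j hj => by simp [hs₁, State.setVar, fillState, hL, h10])
    (fun j hj => by
      have e₁ : block (s.arr 0) (k * L) j F (k * L + j) = s.arr 0 (k * L + j) :=
        block_of_le le_rfl _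
      have e₂ : block (s.arr 0) (k * L) j F (i * L + j) = s.arr 0 (i * L + j) :=
        block_cell_ne _ _ hj hj.le hi.ne
      simp [cell, hs₁, State.setVar, fillState, h10, h14, hL, e₁, e₂, F])
    (fun j hj => by
      have h5 : s₁.var 5 = s.var 5 := by simp [hs₁, State.setVar]
      rw [h5]
      refine abs_lt_of_real (r := ‖z‖) ?_ (hz.trans_lt hQ)
      rw [hFz j hj, ← Real.norm_eq_abs]
      exact PiLp.norm_apply_le _ _)
  have hrun : subtractCmd.run s = fillState s₁ 11 0 (k * L) F L := by
    rw [← hfill]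
    change (Cmd.rep _ _ _).run ((Cmd.set 15 _).run ((sumCmd 13 11 2 _).run s)) = _
    rw [hsum]
    congr 1
    simp [Cmd.run, State.setVar, h14, ← hd, ← hq, clamp_eq hqQ, hs₁]
  have harr : (subtractCmd.run s).arr 0 = block (s.arr 0) (k * L) L F := by
    rw [hrun]; simp [fillState, hs₁, State.setVar]
  refine ⟨q, fun l hl j hj => by rw [harr, block_cell_ne _ _ hj le_rfl hl],
    fun j hj => by rw [harr, block_apply hj], ?_, ?_⟩
  · have hdi := hdet i (by omega)
    have : gramDet b i * |⟪row L (s.arr 0) k, gs b i⟫ - q * ‖gs b i‖ ^ 2| ≤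
        gramDet b i * (‖gs b i‖ ^ 2 / 2) := by
      calc _ = |(u : ℝ) - q * d| := by
            rw [hur, hdr, ← abs_of_nonneg (by linarith : 0 ≤ gramDet b i), ← abs_mul,
              abs_of_nonneg (by linarith : 0 ≤ gramDet b i)]
            ring_nf
        _ ≤ d / 2 := hround
        _ = _ := by rw [hdr]; ring
    exact le_of_mul_le_mul_left this (by linarith)
  · have : row L ((subtractCmd.run s).arr 0) k = z := by
      rw [harr, row_block_self _ _ hk]
      ext j
      exact hFz j j.2
    rw [this]; exact hz

/-- A property of integer vectors that passes to differences with integral multiples. -/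
def Closed (L : ℕ) (V : (ℕ → ℤ) → Prop) : Prop :=
  ∀ w u, V w → V u → ∀ (q : ℤ) (z : ℕ → ℤ), (∀ j < L, z j = w j - q * u j) → V z

/-- Row `k` as a function. -/
def rowFn (L : ℕ) (A : ℤ → ℤ) (k : ℕ) : ℕ → ℤ := fun j => A (k * L + j)

theorem Closed.congr {L : ℕ} {V : (ℕ → ℤ) → Prop} (h : Closed L V) {w z : ℕ → ℤ} (hw : V w)
    (hz : ∀ j < L, z j = w j) : V z :=
  h w w hw hw 0 z fun j hj => by rw [hz j hj]; ring

/-- A size-reduced row is controlled by the Gram–Schmidt lengths alone. The growth during its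
reduction therefore does not accumulate over rows or rounds. -/
theorem norm_row_le_of_reduced {L k : ℕ} {b : ℕ → EuclideanSpace ℝ (Fin L)}
    (hg : ∀ j < L, gs b j ≠ 0) (hk : k < L) {R : ℝ} (hR : ∀ j < L, ‖gs b j‖ ≤ R)
    (hR0 : 0 ≤ R) {x : EuclideanSpace ℝ (Fin L)} (hx : prj b k x = gs b k)
    (hred : ∀ i < k, |⟪x, gs b i⟫| ≤ ‖gs b i‖ ^ 2 / 2) : ‖x‖ ≤ L * R := by
  have h := norm_sq_prj b k x
  rw [hx] at h
  have hs : ∑ j ∈ Finset.range k, ⟪x, gs b j⟫ ^ 2 / ‖gs b j‖ ^ 2 ≤ k * R ^ 2 := by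
    calc _ ≤ ∑ j ∈ Finset.range k, R ^ 2 := by
          refine Finset.sum_le_sum fun j hj => ?_
          have hj' := Finset.mem_range.1 hj
          have hpos : 0 < ‖gs b j‖ ^ 2 := by have := hg j (by omega); positivity
          rw [div_le_iff₀ hpos, ← sq_abs]
          have h₁ := hred j hj'
          have h₂ : ‖gs b j‖ ^ 2 ≤ R ^ 2 := by gcongr; exact hR j (by omega)
          calc |⟪x, gs b j⟫| ^ 2 ≤ (‖gs b j‖ ^ 2 / 2) ^ 2 := by gcongr
            _ ≤ ‖gs b j‖ ^ 2 * ‖gs b j‖ ^ 2 := by nlinarith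
            _ ≤ _ := by gcongr
      _ = _ := by simp
  have hk2 : ‖gs b k‖ ^ 2 ≤ R ^ 2 := by gcongr; exact hR k hk
  have hkL : (k : ℝ) + 1 ≤ L := by exact_mod_cast hk
  have hL1 : (1 : ℝ) ≤ L := by exact_mod_cast (by omega : 1 ≤ L)
  rw [← sq_le_sq₀ (norm_nonneg _) (by positivity)]
  calc ‖x‖ ^ 2 ≤ (k + 1) * R ^ 2 := by linarith
    _ ≤ L * R ^ 2 := by gcongr
    _ ≤ (L * L) * R ^ 2 := by gcongr; nlinarith
    _ = _ := by ring

/-- The coefficients are treated from `k - 1` down to `0`. Subtracting a multiple of row `i` keeps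
those at `l > i`, as row `i` is orthogonal to `gs b l`. The at most `L` subtractions explain the
exponent in `hQ`. -/
theorem run_reduceRow {s : State} {L k : ℕ} {b : ℕ → EuclideanSpace ℝ (Fin L)}
    {V : (ℕ → ℤ) → Prop} (hV : Closed L V)
    (hL : s.var 2 = L) (hk : k < L) (h10 : s.var 10 = k)
    (hG : GsoData L s b) (hdet : ∀ j ≤ L, 1 ≤ gramDet b j)
    (hsub : ∀ l, row L (s.arr 0) l - b l ∈ spanLT b l)
    {H : ℝ} (hH : 1 ≤ H)
    (hβ : ∀ j < L, ‖gs b j‖ ≤ H) (hrow : ∀ j < L, ‖row L (s.arr 0) j‖ ≤ H)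
    (hVr : ∀ l < L, V (rowFn L (s.arr 0) l))
    (hQ : (3 * L * H ^ (2 * L + 2)) ^ (L + 1) < s.var 5) :
    (∀ l ≠ k, ∀ j < L, (reduceRowCmd.run s).arr 0 (l * L + j) = s.arr 0 (l * L + j)) ∧
      row L ((reduceRowCmd.run s).arr 0) k - b k ∈ spanLT b k ∧
      V (rowFn L ((reduceRowCmd.run s).arr 0) k) ∧
      ∀ i < k, |⟪row L ((reduceRowCmd.run s).arr 0) k, gs b i⟫| ≤ ‖gs b i‖ ^ 2 / 2 := by
  have hL1 : (1 : ℝ) ≤ L := by exact_mod_cast (by omega : 1 ≤ L)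
  have hHp : (1 : ℝ) ≤ H ^ (2 * L + 2) := one_le_pow₀ hH
  set G : ℝ := 3 * L * H ^ (2 * L + 2) with hGdef
  have hHG : H ≤ G := by
    calc H = 1 * 1 * H ^ 1 := by ring
      _ ≤ G := by rw [hGdef]; gcongr <;> norm_num
  have hG1 : 1 ≤ G := hH.trans hHG
  have main := run_for (x := 12) (b := 2) (n := L) (s := s)
    (c := .ite (.le (v 12 + 1) (v 10)) (.set 14 (v 10 - 1 - v 12) ;; subtractCmd) .nop)
    (fun m s' => (∀ l ≠ k, ∀ j < L, s'.arr 0 (l * L + j) = s.arr 0 (l * L + j)) ∧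
      row L (s'.arr 0) k - b k ∈ spanLT b k ∧ V (rowFn L (s'.arr 0) k) ∧
      (∀ i < k, k ≤ i + m → |⟪row L (s'.arr 0) k, gs b i⟫| ≤ ‖gs b i‖ ^ 2 / 2) ∧
      ‖row L (s'.arr 0) k‖ ≤ G ^ (min m k + 1)) hL
    ⟨fun l _ j _ => rfl, hsub k, hVr k hk, fun i h₁ h₂ => absurd h₁ (by omega), by
      rw [Nat.zero_min, zero_add, pow_one]
      exact (hrow k hk).trans hHG⟩ (by
    rintro m hm s' fr h12 ⟨i₁, i₂, i₃, i₄, i₅⟩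
    have g10 : s'.var 10 = k := (fr.1 10 rfl).trans h10
    have g2 : s'.var 2 = L := (fr.1 2 rfl).trans hL
    have g5 : s'.var 5 = s.var 5 := fr.1 5 rfl
    rcases Nat.lt_or_ge m k with hmk | hmk
    swap
    · have htest : (Expr.le (v 12 + 1) (v 10)).eval s' = 0 := by
        have : ¬ (m : ℤ) + 1 ≤ k := by omega
        simp [h12, g10, this]
      rw [Cmd.run, if_neg (by simpa using htest)]
      refine ⟨i₁, i₂, i₃, fun i hi _ => i₄ i hi (by omega), ?_⟩
      rw [Nat.min_eq_right hmk] at i₅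
      rw [Nat.min_eq_right (by omega)]
      exact i₅
    have htest : (Expr.le (v 12 + 1) (v 10)).eval s' ≠ 0 := by
      have : (m : ℤ) + 1 ≤ k := by omega
      simp [h12, g10, this]
    rw [Cmd.run, if_pos htest, Nat.min_eq_left hmk]
    rw [Nat.min_eq_left hmk.le] at i₅
    have hGm : G ^ (m + 1 + 1) ≤ G ^ (L + 1) := pow_le_pow_right₀ hG1 (by omega)
    have hGG : G ≤ G ^ (L + 1) := by
      calc G = G ^ 1 := by ring
        _ ≤ _ := pow_le_pow_right₀ hG1 (by omega)
    obtain ⟨i, hi⟩ : ∃ i, k = i + 1 + m := ⟨k - 1 - m, by omega⟩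
    have hcl : clamp (s'.var 5) (k - 1 - m : ℤ) = i := by
      have : (k - 1 - m : ℤ) = i := by omega
      rw [this, clamp_eq]
      rw [g5]
      refine abs_lt_of_real (r := G) ?_ (hGG.trans_lt hQ)
      have hiL : (i : ℝ) ≤ L := by exact_mod_cast (by omega : i ≤ L)
      have : (L : ℝ) ≤ G := by rw [hGdef]; nlinarith
      rw [Int.cast_natCast, abs_of_nonneg (by positivity)]
      linarith
    have hset : (Cmd.set 14 (v 10 - 1 - v 12)).run s' = s'.setVar 14 i := by
      simp [Cmd.run, g10, h12, hcl]
    have hrun : (Cmd.set 14 (v 10 - 1 - v 12) ;; subtractCmd).run s' =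
        subtractCmd.run (s'.setVar 14 i) := by
      change subtractCmd.run ((Cmd.set 14 (v 10 - 1 - v 12)).run s') = _
      rw [hset]
    rw [hrun]
    have e0 : (s'.setVar 14 i).arr = s'.arr := rfl
    have hrow_i : row L (s'.arr 0) i = row L (s.arr 0) i :=
      row_congr (by omega) (by omega) (i₁ i (by omega))
    obtain ⟨q, k₁, k₂, k₃, k₄⟩ := run_subtract (s := s'.setVar 14 i) (L := L) (k := k) (i := i) (b := b)
      (by simpa [State.setVar] using g2) hk (by simpa [State.setVar] using g10)
      (by simp [State.setVar]) (by omega)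
      ⟨fun j hj => by rw [e0, fr.2 2 rfl]; exact hG.det j hj,
        fun j hj => by rw [e0, fr.2 1 rfl]; exact hG.vec j hj⟩ hdet hH (W := G ^ (m + 1))
      (one_le_pow₀ hG1) hβ i₅ (by rw [e0, hrow_i]; exact hrow i (by omega))
      (by
        have : (s'.setVar 14 i).var 5 = s.var 5 := by simpa [State.setVar] using g5
        rw [this, ← hGdef]
        refine lt_of_le_of_lt ?_ hQ
        rw [← pow_succ']
        exact hGm)
    rw [← hGdef, ← pow_succ'] at k₄
    rw [e0] at k₁ k₂ k₃
    change (∀ l ≠ k, ∀ j < L, (subtractCmd.run (s'.setVar 14 i)).arr 0 (l * L + j) = _) ∧ _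
    have hnew := row_eq_sub hk (by omega : i < L) k₂
    have hbi : row L (s'.arr 0) i ∈ spanLT b (i + 1) := by
      rw [hrow_i]
      have := Submodule.add_mem _ (spanLT_mono b i.le_succ (hsub i)) (mem_spanLT b i.lt_succ_self)
      simpa using this
    refine ⟨fun l hl j hj => by rw [k₁ l hl j hj, i₁ l hl j hj], ?_, ?_, ?_, k₄⟩
    · change row L ((subtractCmd.run (s'.setVar 14 i)).arr 0) k - b k ∈ _
      rw [hnew, sub_right_comm]
      exact Submodule.sub_mem _ i₂ (Submodule.smul_mem _ _ (spanLT_mono b (by omega) hbi))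
    · exact hV _ _ i₃ (hV.congr (hVr i (by omega)) (z := rowFn L (s'.arr 0) i)
        (i₁ i (by omega))) q _ k₂
    · intro l hl hlm
      change |⟪row L ((subtractCmd.run (s'.setVar 14 i)).arr 0) k, gs b l⟫| ≤ _
      rw [hnew, inner_sub_left, inner_smul_left]
      rcases Nat.lt_or_ge i l with hil | hil
      · have : ⟪row L (s'.arr 0) i, gs b l⟫ = 0 := by
          rw [real_inner_comm]
          exact inner_prj b l _ (spanLT_mono b (by omega) hbi)
        rw [this, mul_zero, sub_zero]
        exact i₄ l hl (by omega)
      · obtain rfl : l = i := by omega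
        have : ⟪row L (s'.arr 0) l, gs b l⟫ = ‖gs b l‖ ^ 2 := by
          have h₁ : ⟪row L (s'.arr 0) l - b l, gs b l⟫ = 0 := by
            rw [real_inner_comm, hrow_i]
            exact inner_prj b l _ (hsub l)
          rw [inner_sub_left, inner_gs_self] at h₁
          linarith
        rw [this]
        exact k₃)
  obtain ⟨m₁, m₂, m₃, m₄, -⟩ := main
  exact ⟨m₁, m₂, m₃, fun i hi => m₄ i hi (by omega)⟩

theorem run_reduce {s : State} {L : ℕ} {b : ℕ → EuclideanSpace ℝ (Fin L)}
    {V : (ℕ → ℤ) → Prop} (hV : Closed L V) (hb : b = row L (s.arr 0))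
    (hL : s.var 2 = L) (hG : GsoData L s b) (hg : ∀ j < L, gs b j ≠ 0)
    (hdet : ∀ j ≤ L, 1 ≤ gramDet b j) {R H : ℝ} (hR0 : 0 ≤ R) (hH : 1 ≤ H) (hRH : L * R ≤ H)
    (hR : ∀ j < L, ‖gs b j‖ ≤ R) (hrow : ∀ j < L, ‖b j‖ ≤ H)
    (hVr : ∀ l < L, V (rowFn L (s.arr 0) l))
    (hQ : (3 * L * H ^ (2 * L + 2)) ^ (L + 1) < s.var 5) :
    gs (row L ((reduceCmd.run s).arr 0)) = gs b ∧
      (∀ l < L, V (rowFn L ((reduceCmd.run s).arr 0) l)) ∧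
      (∀ l < L, ‖row L ((reduceCmd.run s).arr 0) l‖ ≤ H) ∧
      ∀ k < L, ∀ i < k, |⟪row L ((reduceCmd.run s).arr 0) k, gs b i⟫| ≤ ‖gs b i‖ ^ 2 / 2 := by
  have main := run_for (x := 10) (b := 2) (n := L) (s := s) (c := reduceRowCmd)
    (fun k s' => (∀ l, row L (s'.arr 0) l - b l ∈ spanLT b l) ∧
      (∀ l < L, V (rowFn L (s'.arr 0) l)) ∧ (∀ l < L, ‖row L (s'.arr 0) l‖ ≤ H) ∧
      ∀ j < k, ∀ i < j, |⟪row L (s'.arr 0) j, gs b i⟫| ≤ ‖gs b i‖ ^ 2 / 2) hL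
    ⟨fun l => by subst hb; simp [State.setVar], hVr, by subst hb; exact hrow,
      fun j hj => absurd hj (by omega)⟩ (by
    rintro k hk s' fr h10 ⟨i₁, i₂, i₃, i₄⟩
    have hRle : ∀ j < L, ‖gs b j‖ ≤ H := fun j hj => by
      have hL1 : (1 : ℝ) ≤ L := by exact_mod_cast (by omega : 1 ≤ L)
      have := hR j hj
      nlinarith
    obtain ⟨k₁, k₂, k₃, k₄⟩ := run_reduceRow (s := s') hV ((fr.1 2 rfl).trans hL) hk h10
      ⟨fun j hj => by rw [fr.2 2 rfl]; exact hG.det j hj,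
        fun j hj => by rw [fr.2 1 rfl]; exact hG.vec j hj⟩ hdet i₁ hH hRle i₃ i₂
      (by rw [fr.1 5 rfl]; exact hQ)
    have hne : ∀ l ≠ k, row L ((reduceRowCmd.run s').arr 0) l = row L (s'.arr 0) l := by
      intro l hl
      rcases Nat.lt_or_ge l L with hlL | hlL
      · exact row_congr hlL hlL (k₁ l hl)
      · rw [row_of_le _ hlL, row_of_le _ hlL]
    refine ⟨fun l => ?_, fun l hl => ?_, fun l hl => ?_, fun j hj i hi => ?_⟩
    · change row L ((reduceRowCmd.run s').arr 0) l - b l ∈ _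
      rcases eq_or_ne l k with rfl | h
      · exact k₂
      · rw [hne l h]; exact i₁ l
    · rcases eq_or_ne l k with rfl | h
      · exact k₃
      · exact hV.congr (i₂ l hl) (k₁ l h)
    · change ‖row L ((reduceRowCmd.run s').arr 0) l‖ ≤ H
      rcases eq_or_ne l k with rfl | h
      · exact (norm_row_le_of_reduced hg hk hR hR0 (prj_congr rfl k₂) k₄).trans hRH
      · rw [hne l h]; exact i₃ l hl
    · change |⟪row L ((reduceRowCmd.run s').arr 0) j, gs b i⟫| ≤ _
      rcases eq_or_ne j k with rfl | h
      · exact k₄ i hi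
      · rw [hne j h]; exact i₄ j (by omega) i hi)
  obtain ⟨m₁, m₂, m₃, m₄⟩ := main
  exact ⟨gs_eq_of_sub_mem m₁, m₂, m₃, m₄⟩

end LogCost

/-! ### The swap step and the termination of lattice reduction. -/

namespace LogCost

open LatticeReduction
open scoped RealInnerProductSpace

/-- The test of `swapCmd` for a violation of the reduction condition. -/
def violationCmd : Cmd := .ite (.le (v 10 + 2) (v 2))
    (.ite (.le (2 * .get 2 (v 10 + 2) * .get 2 (v 10) + 1) (.get 2 (v 10 + 1) * .get 2 (v 10 + 1)))
      (.set 14 (v 10 + 1)) .nop) .nop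

/-- Dividing by `gramDet b k ^ 2 * ‖gs b k‖ ^ 2` turns the comparison of Gram determinants into one
of Gram–Schmidt lengths, so the test needs integers only. -/
theorem violation_iff {L : ℕ} {s : State} {b : ℕ → EuclideanSpace ℝ (Fin L)}
    (hd : ∀ k ≤ L, (s.arr 2 k : ℝ) = gramDet b k) (hpos : ∀ k ≤ L, 0 < gramDet b k) {k : ℕ}
    (hk : k + 2 ≤ L) :
    2 * s.arr 2 (k + 2) * s.arr 2 k + 1 ≤ s.arr 2 (k + 1) * s.arr 2 (k + 1) ↔
      2 * ‖gs b (k + 1)‖ ^ 2 < ‖gs b k‖ ^ 2 := by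
  have h₀ := hd k (by omega)
  have h₁ := hd (k + 1) (by omega)
  have h₂ := hd (k + 2) hk
  push_cast at h₁ h₂
  rw [gramDet_succ] at h₁
  rw [gramDet_succ, gramDet_succ] at h₂
  rw [Int.add_one_le_iff, ← Int.cast_lt (R := ℝ)]
  push_cast
  rw [h₀, h₁, h₂]
  have p₀ := hpos k (by omega)
  have p₁ : 0 < ‖gs b k‖ ^ 2 := by
    have := hpos (k + 1) (by omega)
    rw [gramDet_succ] at this
    exact pos_of_mul_pos_right this p₀.le
  generalize gramDet b k = d at *
  generalize ‖gs b k‖ ^ 2 = x at *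
  generalize ‖gs b (k + 1)‖ ^ 2 = y at *
  have hp : 0 < d * d * x := by positivity
  rw [show 2 * (d * x * y) * d = d * d * x * (2 * y) by ring,
    show d * x * (d * x) = d * d * x * x by ring, mul_lt_mul_iff_right₀ hp]

/-- Variable `14` holds `i + 1` for the last violation at `i`, so that `0` can stand for none. -/
theorem run_swap {s : State} {L : ℕ} {b : ℕ → EuclideanSpace ℝ (Fin L)}
    (hL : s.var 2 = L) (hd : ∀ k ≤ L, (s.arr 2 k : ℝ) = gramDet b k)
    (hpos : ∀ k ≤ L, 0 < gramDet b k) (hLQ : (L : ℤ) < s.var 5)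
    (hcell : ∀ k < L, ∀ j < L, |s.arr 0 (k * L + j)| < s.var 5) :
    (SiegelReduced b L ∧ (swapCmd.run s).arr 0 = s.arr 0) ∨
      ∃ i, i + 2 ≤ L ∧ 2 * ‖gs b (i + 1)‖ ^ 2 < ‖gs b i‖ ^ 2 ∧
        ∀ l < L, ∀ j < L, (swapCmd.run s).arr 0 (l * L + j) =
          s.arr 0 ((Equiv.swap i (i + 1) l : ℕ) * L + j) := by
  have hQ0 : 0 < s.var 5 := lt_of_le_of_lt (by positivity) hLQ
  have hcl0 : clamp (s.var 5) 0 = 0 := clamp_eq (by simpa using hQ0)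
  have hs₀ : (Cmd.set 14 0).run s = s.setVar 14 0 := by simp [Cmd.run, hcl0]
  obtain ⟨s₁, hs₁⟩ : ∃ s₁, s₁ = (Cmd.rep 10 2 violationCmd).run (s.setVar 14 0) := ⟨_, rfl⟩
  have hfr : Frame _ (s.setVar 14 0) s₁ := hs₁ ▸ Cmd.frame _ _
  have hloop := run_for (x := 10) (b := 2) (n := L) (s := s.setVar 14 0) (c := violationCmd)
    (fun k s' => (s'.var 14 = 0 ∧ ∀ i < k, i + 2 ≤ L → ‖gs b i‖ ^ 2 ≤ 2 * ‖gs b (i + 1)‖ ^ 2) ∨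
      ∃ i : ℕ, i + 2 ≤ L ∧ s'.var 14 = i + 1 ∧ 2 * ‖gs b (i + 1)‖ ^ 2 < ‖gs b i‖ ^ 2)
    (by simpa [State.setVar] using hL)
    (Or.inl ⟨by simp [State.setVar], fun i hi => absurd hi (by omega)⟩) (by
    rintro k hk s' fr h10 hP
    have g2 : s'.var 2 = L := (fr.1 2 rfl).trans (by simpa [State.setVar] using hL)
    have g5 : s'.var 5 = s.var 5 := (fr.1 5 rfl).trans (by simp [State.setVar])
    have b2 : s'.arr 2 = s.arr 2 := (fr.2 2 rfl).trans (by simp [State.setVar])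
    rcases Nat.lt_or_ge L (k + 2) with hkL | hkL
    · have htest : (Expr.le (v 10 + 2) (v 2)).eval s' = 0 := by
        have : ¬ (k : ℤ) + 2 ≤ L := by omega
        simp [h10, g2, this]
      rw [violationCmd, Cmd.run, if_neg (by simpa using htest)]
      rcases hP with ⟨h₁, h₂⟩ | ⟨i, h₁, h₂, h₃⟩
      · refine Or.inl ⟨by simpa [Cmd.run, State.setVar] using h₁, fun i hi hi' => h₂ i (by omega) hi'⟩
      · exact Or.inr ⟨i, h₁, by simpa [Cmd.run, State.setVar] using h₂, h₃⟩
    have htest : (Expr.le (v 10 + 2) (v 2)).eval s' ≠ 0 := by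
      have : (k : ℤ) + 2 ≤ L := by omega
      simp [h10, g2, this]
    rw [violationCmd, Cmd.run, if_pos htest]
    have hviol := violation_iff hd hpos hkL
    by_cases hv : 2 * ‖gs b (k + 1)‖ ^ 2 < ‖gs b k‖ ^ 2
    · have ht : (Expr.le (2 * .get 2 (v 10 + 2) * .get 2 (v 10) + 1)
          (.get 2 (v 10 + 1) * .get 2 (v 10 + 1))).eval s' ≠ 0 := by
        simp [h10, b2, hviol.2 hv]
      rw [Cmd.run, if_pos ht]
      refine Or.inr ⟨k, hkL, ?_, hv⟩
      have : clamp (s.var 5) (k + 1 : ℤ) = k + 1 := by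
        apply clamp_eq
        rw [abs_of_nonneg (by positivity)]
        omega
      simp [Cmd.run, State.setVar, h10, g5, this]
    · have ht : (Expr.le (2 * .get 2 (v 10 + 2) * .get 2 (v 10) + 1)
          (.get 2 (v 10 + 1) * .get 2 (v 10 + 1))).eval s' = 0 := by
        simp [h10, b2, mt hviol.1 hv]
      rw [Cmd.run, if_neg (by simpa using ht)]
      rcases hP with ⟨h₁, h₂⟩ | ⟨i, h₁, h₂, h₃⟩
      · refine Or.inl ⟨by simpa [Cmd.run, State.setVar] using h₁, fun i hi hi' => ?_⟩
        rcases Nat.lt_or_ge i k with h | h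
        · exact h₂ i h hi'
        · obtain rfl : i = k := by omega
          exact not_lt.1 hv
      · exact Or.inr ⟨i, h₁, by simpa [Cmd.run, State.setVar] using h₂, h₃⟩)
  rw [← hs₁] at hloop
  have g2 : s₁.var 2 = L := (hfr.1 2 rfl).trans (by simpa [State.setVar] using hL)
  have g5 : s₁.var 5 = s.var 5 := (hfr.1 5 rfl).trans (by simp [State.setVar])
  have b0 : s₁.arr 0 = s.arr 0 := (hfr.2 0 rfl).trans (by simp [State.setVar])
  have hrun : swapCmd.run s = (Cmd.ite (v 14)
    (.rep 11 2 (.put 3 (v 11) (cell 0 (v 14) (v 11))) ;;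
      .rep 11 2 (.put 0 (v 14 * v 2 + v 11) (cell 0 (v 14 - 1) (v 11))) ;;
      .rep 11 2 (.put 0 ((v 14 - 1) * v 2 + v 11) (.get 3 (v 11)))) .nop).run s₁ := by
    rw [hs₁, ← hs₀]; rfl
  rcases hloop with ⟨h₁, h₂⟩ | ⟨i, h₁, h₂, h₃⟩
  · left
    refine ⟨fun k hk => h₂ k (by omega) hk, ?_⟩
    rw [hrun, Cmd.run, if_neg (by simp [h₁])]
    exact b0
  · right
    refine ⟨i, h₁, h₃, ?_⟩
    rw [hrun, Cmd.run, if_pos (by simp [h₂]; omega)]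
    have c1 := run_for_put (x := 11) (b := 2) (a := 3) (s := s₁) (n := L)
      (idx := v 11) (e := cell 0 (v 14) (v 11)) 0 (fun j => s.arr 0 ((i + 1) * L + j)) g2
      (by norm_num) (fun j hj => by simp [fillState])
      (fun j hj => by simp [fillState, cell, g2, h₂, b0])
      (fun j hj => by rw [g5]; exact_mod_cast hcell (i + 1) (by omega) j hj)
    obtain ⟨s₂, hs₂⟩ : ∃ s₂, s₂ = fillState s₁ 11 3 0 (fun j => s.arr 0 ((i + 1) * L + j)) L :=
      ⟨_, rfl⟩
    rw [← hs₂] at c1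
    have p14 : s₂.var 14 = i + 1 := by simp [hs₂, fillState, h₂]
    have p2 : s₂.var 2 = L := by simp [hs₂, fillState, g2]
    have p5 : s₂.var 5 = s.var 5 := by simp [hs₂, fillState, g5]
    have q0 : s₂.arr 0 = s.arr 0 := by simp [hs₂, fillState, b0]
    have q3 : ∀ j < L, s₂.arr 3 j = s.arr 0 ((i + 1) * L + j) := fun j hj => by
      have := block_apply (f := s₁.arr 3) (base := 0) hj (fun j => s.arr 0 ((i + 1) * L + j))
      rw [zero_add] at this
      simp [hs₂, fillState, this]
    have c2 := run_for_put (x := 11) (b := 2) (a := 0) (s := s₂) (n := L)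
      (idx := v 14 * v 2 + v 11) (e := cell 0 (v 14 - 1) (v 11)) (((i + 1 : ℕ) : ℤ) * L)
      (fun j => s.arr 0 (i * L + j)) p2
      (by norm_num) (fun j hj => by simp [fillState, p14, p2])
      (fun j hj => by
        have := block_cell_ne (s.arr 0) (fun j => s.arr 0 (i * L + j)) hj hj.le
          (by omega : i ≠ i + 1)
        push_cast at this
        simp [fillState, cell, p2, p14, q0, this])
      (fun j hj => by rw [p5]; exact hcell i (by omega) j hj)
    obtain ⟨s₃, hs₃⟩ : ∃ s₃, s₃ = fillState s₂ 11 0 (((i + 1 : ℕ) : ℤ) * L)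
      (fun j => s.arr 0 (i * L + j)) L := ⟨_, rfl⟩
    rw [← hs₃] at c2
    have r14 : s₃.var 14 = i + 1 := by simp [hs₃, fillState, p14]
    have r2 : s₃.var 2 = L := by simp [hs₃, fillState, p2]
    have r5 : s₃.var 5 = s.var 5 := by simp [hs₃, fillState, p5]
    have t3 : s₃.arr 3 = s₂.arr 3 := by simp [hs₃, fillState]
    have t0 : s₃.arr 0 = block (s.arr 0) (((i + 1 : ℕ) : ℤ) * L) L (fun j => s.arr 0 (i * L + j)) := by
      simp [hs₃, fillState, q0]
    have c3 := run_for_put (x := 11) (b := 2) (a := 0) (s := s₃) (n := L)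
      (idx := (v 14 - 1) * v 2 + v 11) (e := .get 3 (v 11)) (i * L)
      (fun j => s.arr 0 ((i + 1) * L + j)) r2
      (by norm_num) (fun j hj => by simp [fillState, r14, r2])
      (fun j hj => by simp [fillState, t3, q3 j hj])
      (fun j hj => by rw [r5]; exact_mod_cast hcell (i + 1) (by omega) j hj)
    have hfin : (Cmd.rep 11 2 (.put 3 (v 11) (cell 0 (v 14) (v 11))) ;;
      .rep 11 2 (.put 0 (v 14 * v 2 + v 11) (cell 0 (v 14 - 1) (v 11))) ;;
      .rep 11 2 (.put 0 ((v 14 - 1) * v 2 + v 11) (.get 3 (v 11)))).run s₁ =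
        fillState s₃ 11 0 (i * L) (fun j => s.arr 0 ((i + 1) * L + j)) L := by
      change (Cmd.rep 11 2 _).run ((Cmd.rep 11 2 _).run ((Cmd.rep 11 2 _).run s₁)) = _
      rw [c1, c2, c3]
    intro l hl j hj
    rw [hfin]
    have e : (fillState s₃ 11 0 (i * L) (fun j => s.arr 0 ((i + 1) * L + j)) L).arr 0 =
      block (s₃.arr 0) (i * L) L (fun j => s.arr 0 ((i + 1) * L + j)) := by simp [fillState]
    rw [e]
    rcases eq_or_ne l i with rfl | hli
    · rw [block_apply hj, Equiv.swap_apply_left]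
      push_cast; rfl
    rw [block_cell_ne _ _ hj le_rfl hli, t0]
    rcases eq_or_ne l (i + 1) with rfl | hli'
    · rw [block_apply hj, Equiv.swap_apply_right]
    rw [block_cell_ne _ _ hj le_rfl hli', Equiv.swap_apply_of_ne_of_ne hli hli']

/-- The invariant of the reduction loop, in which every round halves the potential or so. -/
structure ReductionInvariant (L : ℕ) (V : (ℕ → ℤ) → Prop) (R D Φ : ℝ) (n : ℕ) (A : ℤ → ℤ) :
    Prop where
  ne_zero : ∀ j < L, gs (row L A) j ≠ 0
  gs_le : ∀ j < L, ‖gs (row L A) j‖ ≤ R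
  row_le : ∀ j < L, ‖row L A j‖ ≤ L * R
  gramDet_eq : gramDet (row L A) L = D
  closed : ∀ l < L, V (rowFn L A l)
  progress : SiegelReduced (row L A) L ∨ potential (row L A) L ≤ (3 / 4) ^ n * Φ

/-- Size reduction changes neither Gram–Schmidt vectors nor potential and restores the bound on the
rows. A swap does not increase the maximal Gram–Schmidt length and lowers the potential. Without a
violation the basis is already reduced. -/
theorem ReductionInvariant.step {L n : ℕ} {V : (ℕ → ℤ) → Prop} (hV : Closed L V) (hL0 : 0 < L)
    {R D Φ : ℝ} (hR : 1 ≤ R) {s : State}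
    (hL : s.var 2 = L) (hQ : (3 * L * (L * R) ^ (2 * L + 2)) ^ (L + 1) < s.var 5)
    (h : ReductionInvariant L V R D Φ n (s.arr 0)) :
    ReductionInvariant L V R D Φ (n + 1)
      (((gsoCmd ;; reduceCmd ;; swapCmd).run s).arr 0) := by
  have hL1 : (1 : ℝ) ≤ L := by exact_mod_cast hL0
  set H : ℝ := L * R with hHdef
  have hH : 1 ≤ H := one_le_mul_of_one_le_of_one_le hL1 hR
  have hRH : R ≤ H := by rw [hHdef]; nlinarith
  set b := row L (s.arr 0) with hb
  have hHp : (1 : ℝ) ≤ H ^ (2 * L + 2) := one_le_pow₀ hH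
  set G : ℝ := 3 * L * H ^ (2 * L + 2) with hGdef
  have hG1 : 1 ≤ G := by rw [hGdef]; nlinarith
  have hGG : G ≤ G ^ (L + 1) := by
    calc G = G ^ 1 := by ring
      _ ≤ _ := pow_le_pow_right₀ hG1 (by omega)
  have hHG : H ≤ G := by
    calc H = 1 * 1 * H ^ 1 := by ring
      _ ≤ G := by rw [hGdef]; gcongr <;> norm_num
  have hdet : ∀ j ≤ L, 1 ≤ gramDet b j := fun j hj => one_le_gramDet h.ne_zero hj
  obtain ⟨s₁, hs₁⟩ : ∃ s₁, s₁ = gsoCmd.run s := ⟨_, rfl⟩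
  have fr₁ : Frame gsoCmd s s₁ := hs₁ ▸ Cmd.frame _ _
  have hgso : GsoData L s₁ b := hs₁ ▸ run_gso hL0 hb hL hH h.row_le h.ne_zero
    (lt_of_le_of_lt (by
      refine le_trans ?_ hGG
      rw [hGdef]; nlinarith) hQ)
  obtain ⟨s₂, hs₂⟩ : ∃ s₂, s₂ = reduceCmd.run s₁ := ⟨_, rfl⟩
  have fr₂ : Frame reduceCmd s₁ s₂ := hs₂ ▸ Cmd.frame _ _
  have hred := run_reduce (s := s₁) hV (hb.trans (by rw [fr₁.2 0 rfl])) ((fr₁.1 2 rfl).trans hL)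
    hgso h.ne_zero hdet (by linarith) hH le_rfl h.gs_le h.row_le
    (by rw [fr₁.2 0 rfl]; exact h.closed) (by rw [fr₁.1 5 rfl]; exact hQ)
  rw [← hs₂] at hred
  obtain ⟨hgs, hVr, hrow, hmu⟩ := hred
  set b' := row L (s₂.arr 0) with hb'
  have hgd : gramDet b' = gramDet b := gramDet_congr hgs
  have g5 : s₂.var 5 = s.var 5 := (fr₂.1 5 rfl).trans (fr₁.1 5 rfl)
  have hrun : (gsoCmd ;; reduceCmd ;; swapCmd).run s = swapCmd.run s₂ := by rw [hs₂, hs₁]; rfl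
  rw [hrun]
  have hne : ∀ j < L, gs b' j ≠ 0 := by rw [hgs]; exact h.ne_zero
  have hpot : potential b' L = potential b L := by simp only [potential, hgd]
  have hinv : ∀ m, (SiegelReduced b' L ∨ potential b' L ≤ (3 / 4) ^ m * Φ) →
      ReductionInvariant L V R D Φ m (s₂.arr 0) := fun m hm =>
    ⟨hne, by rw [← hb', hgs]; exact h.gs_le, hrow, by rw [← hb', hgd]; exact h.gramDet_eq, hVr, hm⟩
  rcases run_swap (s := s₂) (b := b') ((fr₂.1 2 rfl).trans ((fr₁.1 2 rfl).trans hL))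
    (fun k hk => by rw [fr₂.2 2 rfl, hgso.det k hk, hgd])
    (fun k hk => by rw [hgd]; linarith [hdet k hk])
    (by
      rw [g5, ← Int.cast_lt (R := ℝ)]
      refine lt_of_le_of_lt (le_trans ?_ hGG) hQ
      push_cast
      rw [hGdef]; nlinarith)
    (fun k hk j hj => by
      rw [g5]
      exact abs_lt_of_real ((abs_coord_le _ hk hj).trans (hrow k hk))
        (lt_of_le_of_lt (hHG.trans hGG) hQ)) with ⟨hS, harr⟩ | ⟨i, hi, hlt, hcell⟩
  · rw [harr]
    exact hinv _ (Or.inl hS)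
  have hrow' : row L ((swapCmd.run s₂).arr 0) = swapAt b' i := by
    funext l
    rcases Nat.lt_or_ge l L with hl | hl
    · have hsl : (Equiv.swap i (i + 1) l : ℕ) < L := by
        rw [Equiv.swap_apply_def]; split_ifs <;> omega
      exact row_congr hl hsl fun j hj => hcell l hl j hj
    · rw [row_of_le _ hl, swapAt, Equiv.swap_apply_of_ne_of_ne (by omega) (by omega), hb',
        row_of_le _ hl]
  obtain ⟨k₁, k₂, k₃, k₄, k₅, k₆⟩ := gs_swapAt (b := b') (k := i) (hne i (by omega))
    (hne (i + 1) (by omega)) (by rw [hgs]; exact hmu (i + 1) (by omega) i (by omega)) hlt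
  have hgsle : ∀ j < L, ‖gs b' j‖ ≤ R := by rw [hgs]; exact h.gs_le
  refine ⟨fun j hj => ?_, fun j hj => ?_, fun j hj => ?_, ?_, fun l hl => ?_, ?_⟩
  · rw [hrow']
    rcases eq_or_ne j i with rfl | h₁
    · exact k₁
    rcases eq_or_ne j (i + 1) with rfl | h₂
    · exact k₂
    rw [gs_swapAt_of_ne _ h₁ h₂]; exact hne j hj
  · rw [hrow']
    rcases eq_or_ne j i with rfl | h₁
    · exact k₃.trans (hgsle j hj)
    rcases eq_or_ne j (i + 1) with rfl | h₂
    · exact k₄.trans (hgsle i (by omega))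
    rw [gs_swapAt_of_ne _ h₁ h₂]; exact hgsle j hj
  · rw [hrow']
    refine hrow _ ?_
    rw [Equiv.swap_apply_def]; split_ifs <;> omega
  · rw [hrow', gramDet_swapAt k₅ (by omega), hgd]; exact h.gramDet_eq
  · refine hV.congr (hVr (Equiv.swap i (i + 1) l) ?_) fun j hj => hcell l hl j hj
    rw [Equiv.swap_apply_def]; split_ifs <;> omega
  · right
    rw [hrow']
    have hp := potential_swapAt (n := L) (by omega) hne k₅ k₆
    rcases h.progress with hS | hP
    · exfalso
      have := hS i (by omega)
      rw [hgs] at hlt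
      linarith
    · rw [hpot] at hp
      calc _ ≤ 3 / 4 * potential b L := hp
        _ ≤ 3 / 4 * ((3 / 4) ^ n * Φ) := by gcongr
        _ = _ := by ring

/-- The potential is a product of Gram determinants, hence at least `1`, and at first it is at most
`R ^ (2 * L * L)`. By `hpot` it cannot have dropped in all `T` rounds, so a reduced basis was
reached. -/
theorem run_reduction {L T : ℕ} {V : (ℕ → ℤ) → Prop} (hV : Closed L V) (hL0 : 0 < L)
    {R : ℝ} (hR : 1 ≤ R) {s : State} (hL : s.var 2 = L) (hT : s.var 4 = T)
    (hQ : (3 * L * (L * R) ^ (2 * L + 2)) ^ (L + 1) < s.var 5)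
    (hne : ∀ j < L, gs (row L (s.arr 0)) j ≠ 0) (hgs : ∀ j < L, ‖gs (row L (s.arr 0)) j‖ ≤ R)
    (hrow : ∀ j < L, ‖row L (s.arr 0) j‖ ≤ L * R) (hVr : ∀ l < L, V (rowFn L (s.arr 0) l))
    (hpot : R ^ (2 * L * L) * (3 / 4) ^ T < 1) :
    V (rowFn L ((reductionCmd.run s).arr 0) 0) ∧ row L ((reductionCmd.run s).arr 0) 0 ≠ 0 ∧
      ‖row L ((reductionCmd.run s).arr 0) 0‖ ≤ L * R ∧
      (‖row L ((reductionCmd.run s).arr 0) 0‖ ^ 2) ^ L ≤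
        2 ^ (L * (L - 1) / 2) * gramDet (row L (s.arr 0)) L := by
  have main := run_for (x := 19) (b := 4) (n := T) (s := s) (c := gsoCmd ;; reduceCmd ;; swapCmd)
    (fun n s' => ReductionInvariant L V R (gramDet (row L (s.arr 0)) L)
      (potential (row L (s.arr 0)) L) n (s'.arr 0)) hT
    ⟨hne, hgs, hrow, rfl, hVr, Or.inr (by simp [State.setVar])⟩ (by
    rintro k hk s' fr - h
    exact h.step hV hL0 hR ((fr.1 2 rfl).trans hL) (by rw [fr.1 5 rfl]; exact hQ))
  change ReductionInvariant _ _ _ _ _ _ ((reductionCmd.run s).arr 0) at main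
  set A := (reductionCmd.run s).arr 0
  have hS : SiegelReduced (row L A) L := by
    refine main.progress.resolve_right fun hp => ?_
    have h₁ : 1 ≤ potential (row L A) L := by
      refine Finset.prod_induction _ (fun x : ℝ => 1 ≤ x)
        (fun a b ha hb => one_le_mul_of_one_le_of_one_le ha hb) le_rfl fun j hj => ?_
      exact one_le_gramDet main.ne_zero (Finset.mem_range.1 hj).le
    have h₂ : potential (row L (s.arr 0)) L ≤ R ^ (2 * L * L) := by
      calc _ ≤ ∏ j ∈ Finset.range L, R ^ (2 * L) := by
            refine Finset.prod_le_prod (fun j hj => ?_) fun j hj => ?_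
            · linarith [one_le_gramDet hne (Finset.mem_range.1 hj).le]
            · have hj := Finset.mem_range.1 hj
              exact (gramDet_le fun l hl => hgs l (by omega)).trans
                (pow_le_pow_right₀ hR (by omega))
        _ = _ := by rw [Finset.prod_const, Finset.card_range, ← pow_mul]
    have h₃ : (3 / 4 : ℝ) ^ T * potential (row L (s.arr 0)) L ≤ (3 / 4) ^ T * R ^ (2 * L * L) := by
      gcongr
    linarith
  refine ⟨main.closed 0 hL0, ?_, main.row_le 0 hL0, main.gramDet_eq ▸ hS.norm_pow_le⟩
  have := main.ne_zero 0 hL0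
  rwa [gs, prj_zero] at this

end LogCost

/-! ### Construction of the lattice basis and recovery of the polynomial. -/

namespace LogCost

open HowgraveGraham

/-- Loops can only be bounded by read-only variables, so there are `L` rounds, of which those from
`t - i` on are idle. -/
theorem run_multiplier {s : State} {L i t : ℕ} {K : ℤ} (hL : s.var 2 = L) (ht : L / 2 = t)
    (h10 : s.var 10 = i) (h17 : s.var 17 = K) (hK : 1 ≤ K) (hQ : K ^ L < s.var 5) :
    (Cmd.run (.set 13 1 ;;
      .rep 12 2 (.ite (.le (v 10 + v 12 + 1) (v 2 / 2)) (.set 13 (v 13 * v 17)) .nop)) s).var 13 =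
      K ^ (t - i) := by
  have hpQ : ∀ k ≤ L, |K ^ k| < s.var 5 := fun k hk => by
    rw [abs_of_nonneg (by positivity)]
    exact lt_of_le_of_lt (pow_le_pow_right₀ hK hk) hQ
  have hcl : clamp (s.var 5) 1 = 1 := clamp_eq (by simpa using hpQ 0 (by omega))
  have main := run_for (x := 12) (b := 2) (n := L) (s := s.setVar 13 1)
    (c := .ite (.le (v 10 + v 12 + 1) (v 2 / 2)) (.set 13 (v 13 * v 17)) .nop)
    (fun k s' => s'.var 13 = K ^ min k (t - i)) (by simpa [State.setVar] using hL)
    (by simp [State.setVar]) (by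
    rintro k hk s' fr h12 hP
    have g2 : s'.var 2 = L := (fr.1 2 rfl).trans (by simpa [State.setVar] using hL)
    have g5 : s'.var 5 = s.var 5 := (fr.1 5 rfl).trans (by simp [State.setVar])
    have g10 : s'.var 10 = i := (fr.1 10 rfl).trans (by simpa [State.setVar] using h10)
    have g17 : s'.var 17 = K := (fr.1 17 rfl).trans (by simpa [State.setVar] using h17)
    have ht' : (L : ℤ) / 2 = t := by omega
    by_cases h : i + k + 1 ≤ t
    · have htest : (Expr.le (v 10 + v 12 + 1) (v 2 / 2)).eval s' ≠ 0 := by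
        have : (i : ℤ) + k + 1 ≤ t := by omega
        simp [g2, g10, h12, ht', this]
      rw [Nat.min_eq_left (by omega)] at hP
      rw [Cmd.run, if_pos htest, Nat.min_eq_left (by omega)]
      have : clamp (s.var 5) (K ^ k * K) = K ^ (k + 1) := by
        rw [← pow_succ, clamp_eq (hpQ _ hk)]
      simp [Cmd.run, State.setVar, g5, g17, hP, this]
    · have htest : (Expr.le (v 10 + v 12 + 1) (v 2 / 2)).eval s' = 0 := by
        have : ¬ (i : ℤ) + k + 1 ≤ t := by omega
        simp [g2, g10, h12, ht', this]
      rw [Nat.min_eq_right (by omega)] at hP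
      rw [Cmd.run, if_neg (by simpa using htest), Nat.min_eq_right (by omega)]
      simpa [Cmd.run, State.setVar] using hP)
  rw [Nat.min_eq_right (by omega)] at main
  have hs : (Cmd.set 13 1).run s = s.setVar 13 1 := by simp [Cmd.run, hcl]
  change ((Cmd.rep 12 2 _).run ((Cmd.set 13 1).run s)).var 13 = _
  rw [hs]
  exact main

theorem run_lattice {s : State} {L t : ℕ} {K P₀ X : ℤ} (hL : s.var 2 = L) (ht : L / 2 = t)
    (hP : s.var 0 - s.var 9 = P₀) (h7 : s.var 7 = X) (h17 : s.var 17 = K) (hK : 1 ≤ K)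
    (hP0 : 1 ≤ P₀) (hX : 0 ≤ X) (hQ : K ^ L * (P₀ + X) ^ (L + 1) < s.var 5) :
    ∀ i < L, ∀ j < L, (latticeCmd.run s).arr 0 (i * L + j) = K ^ (t - i) * powCoeff P₀ X i j := by
  have hB1 : 1 ≤ P₀ + X := by linarith
  have hKL : 1 ≤ K ^ L := one_le_pow₀ hK
  have hBL : 1 ≤ (P₀ + X) ^ (L + 1) := one_le_pow₀ hB1
  have hKQ : K ^ L < s.var 5 := lt_of_le_of_lt (by nlinarith) hQ
  have hpc : ∀ i ≤ L, ∀ j, |powCoeff P₀ X i j| ≤ (P₀ + X) ^ (L + 1) := fun i hi j =>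
    (abs_powCoeff_le (by linarith) hX i j).trans (pow_le_pow_right₀ hB1 (by omega))
  have hpcQ : ∀ i ≤ L, ∀ j, |powCoeff P₀ X i j| < s.var 5 := fun i hi j =>
    lt_of_le_of_lt ((hpc i hi j).trans (by nlinarith)) hQ
  have hPQ : clamp (s.var 5) P₀ = P₀ := clamp_eq (by
    rw [abs_of_nonneg (by linarith)]
    refine lt_of_le_of_lt ?_ hQ
    calc P₀ ≤ (P₀ + X) ^ 1 := by linarith
      _ ≤ (P₀ + X) ^ (L + 1) := pow_le_pow_right₀ hB1 (by omega)
      _ ≤ _ := by nlinarith)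
  obtain ⟨s₁, hs₁⟩ : ∃ s₁, s₁ = s.setVar 16 P₀ := ⟨_, rfl⟩
  have r₁ : (Cmd.set 16 (v 0 - v 9)).run s = s₁ := by
    simp only [Cmd.run, Expr.eval_sub, Expr.eval_var]
    rw [hP, hPQ, hs₁]
  have c₁ := run_for_put (x := 11) (b := 2) (a := 3) (s := s₁) (n := L)
    (idx := v 11) (e := .equals (v 11) 0) 0 (fun j => powCoeff P₀ X 0 j)
    (by simp [hs₁, State.setVar, hL]) (by norm_num) (fun j hj => by simp [fillState])
    (fun j hj => by simp [fillState, powCoeff_zero])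
    (fun j hj => by
      have := hpcQ 0 (by omega) j
      simpa [hs₁, State.setVar] using this)
  obtain ⟨s₂, hs₂⟩ : ∃ s₂, s₂ = fillState s₁ 11 3 0 (fun j => powCoeff P₀ X 0 j) L := ⟨_, rfl⟩
  rw [← hs₂] at c₁
  have g2 : s₂.var 2 = L := by simp [hs₂, hs₁, fillState, State.setVar, hL]
  have g5 : s₂.var 5 = s.var 5 := by simp [hs₂, hs₁, fillState, State.setVar]
  have g7 : s₂.var 7 = X := by simp [hs₂, hs₁, fillState, State.setVar, h7]
  have g16 : s₂.var 16 = P₀ := by simp [hs₂, hs₁, fillState, State.setVar]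
  have g17 : s₂.var 17 = K := by simp [hs₂, hs₁, fillState, State.setVar, h17]
  have main := run_for (x := 10) (b := 2) (n := L) (s := s₂) (c :=
    .set 13 1 ;;
    .rep 12 2 (.ite (.le (v 10 + v 12 + 1) (v 2 / 2)) (.set 13 (v 13 * v 17)) .nop) ;;
    .rep 11 2 (.put 0 (v 10 * v 2 + v 11) (v 13 * cell 3 (v 10) (v 11))) ;;
    .rep 11 2 (.put 3 ((v 10 + 1) * v 2 + v 11)
      (v 16 * cell 3 (v 10) (v 11) -
        (1 - .equals (v 11) 0) * (v 7 * cell 3 (v 10) (v 11 - 1)))))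
    (fun k s' => (∀ j < L, s'.arr 3 (k * L + j) = powCoeff P₀ X k j) ∧
      ∀ i < k, ∀ j < L, s'.arr 0 (i * L + j) = K ^ (t - i) * powCoeff P₀ X i j) g2
    ⟨fun j hj => by
      have := block_apply (f := s₁.arr 3) (base := 0) hj (fun j => powCoeff P₀ X 0 j)
      rw [zero_add] at this
      simp [hs₂, fillState, State.setVar, this], fun i hi => absurd hi (by omega)⟩ (by
    rintro i hi s' fr h10 ⟨ih₁, ih₂⟩
    obtain ⟨s₃, hs₃⟩ : ∃ s₃, s₃ = Cmd.run (.set 13 1 ;;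
      .rep 12 2 (.ite (.le (v 10 + v 12 + 1) (v 2 / 2)) (.set 13 (v 13 * v 17)) .nop)) s' := ⟨_, rfl⟩
    have fr₃ : Frame _ s' s₃ := hs₃ ▸ Cmd.frame _ s'
    have m13 : s₃.var 13 = K ^ (t - i) := hs₃ ▸ run_multiplier ((fr.1 2 rfl).trans g2) ht h10
      ((fr.1 17 rfl).trans g17) hK (by rw [fr.1 5 rfl, g5]; exact hKQ)
    have m2 : s₃.var 2 = L := (fr₃.1 2 rfl).trans ((fr.1 2 rfl).trans g2)
    have m5 : s₃.var 5 = s.var 5 := (fr₃.1 5 rfl).trans ((fr.1 5 rfl).trans g5)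
    have m7 : s₃.var 7 = X := (fr₃.1 7 rfl).trans ((fr.1 7 rfl).trans g7)
    have m10 : s₃.var 10 = i := (fr₃.1 10 rfl).trans h10
    have m16 : s₃.var 16 = P₀ := (fr₃.1 16 rfl).trans ((fr.1 16 rfl).trans g16)
    have n3 : s₃.arr 3 = s'.arr 3 := fr₃.2 3 rfl
    have n0 : s₃.arr 0 = s'.arr 0 := fr₃.2 0 rfl
    have c₃ := run_for_put (x := 11) (b := 2) (a := 0) (s := s₃) (n := L)
      (idx := v 10 * v 2 + v 11) (e := v 13 * cell 3 (v 10) (v 11)) (i * L)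
      (fun j => K ^ (t - i) * powCoeff P₀ X i j) m2 (by norm_num)
      (fun j hj => by simp [fillState, m10, m2])
      (fun j hj => by simp [fillState, cell, m10, m2, m13, n3, ih₁ j hj])
      (fun j hj => by
        rw [m5, abs_mul, abs_of_nonneg (by positivity : 0 ≤ K ^ (t - i))]
        refine lt_of_le_of_lt ?_ hQ
        have h₁ : K ^ (t - i) ≤ K ^ L := pow_le_pow_right₀ hK (by omega)
        exact mul_le_mul h₁ (hpc i hi.le j) (abs_nonneg _) (by positivity))
    obtain ⟨s₄, hs₄⟩ : ∃ s₄, s₄ = fillState s₃ 11 0 (i * L)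
      (fun j => K ^ (t - i) * powCoeff P₀ X i j) L := ⟨_, rfl⟩
    rw [← hs₄] at c₃
    have p2 : s₄.var 2 = L := by simp [hs₄, fillState, m2]
    have p5 : s₄.var 5 = s.var 5 := by simp [hs₄, fillState, m5]
    have p7 : s₄.var 7 = X := by simp [hs₄, fillState, m7]
    have p10 : s₄.var 10 = i := by simp [hs₄, fillState, m10]
    have p16 : s₄.var 16 = P₀ := by simp [hs₄, fillState, m16]
    have q3 : s₄.arr 3 = s'.arr 3 := by simp [hs₄, fillState, n3]
    have q0 : s₄.arr 0 = block (s'.arr 0) (i * L) L (fun j => K ^ (t - i) * powCoeff P₀ X i j) := by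
      simp [hs₄, fillState, n0]
    have c₄ := run_for_put (x := 11) (b := 2) (a := 3) (s := s₄) (n := L)
      (idx := (v 10 + 1) * v 2 + v 11) (e := v 16 * cell 3 (v 10) (v 11) -
        (1 - .equals (v 11) 0) * (v 7 * cell 3 (v 10) (v 11 - 1))) (((i + 1 : ℕ) : ℤ) * L)
      (fun j => powCoeff P₀ X (i + 1) j) p2 (by norm_num)
      (fun j hj => by simp [fillState, p10, p2])
      (fun j hj => by
        have e₁ := block_cell_ne (s'.arr 3) (fun j => powCoeff P₀ X (i + 1) j) hj hj.le
          (by omega : i ≠ i + 1)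
        rw [ih₁ j hj] at e₁
        push_cast at e₁
        -- For `j = 0` the program reads the cell before row `i`; the factor `1 - .equals (v 11) 0`
        -- discards its content.
        cases j with
        | zero =>
          push_cast at e₁
          simp [fillState, cell, p10, p2, p7, p16, q3, powCoeff_succ_zero]
          left
          simpa using e₁
        | succ j =>
          have e₂ := block_cell_ne (s'.arr 3) (fun j => powCoeff P₀ X (i + 1) j)
            (by omega : j < L) (by omega : j + 1 ≤ L) (by omega : i ≠ i + 1)
          rw [ih₁ j (by omega)] at e₂
          push_cast at e₁ e₂
          have h0 : ¬ ((j : ℤ) + 1 = 0) := by omega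
          simp [fillState, cell, p10, p2, p7, p16, q3, powCoeff_succ_succ, h0, e₁, e₂])
      (fun j hj => by rw [p5]; exact hpcQ (i + 1) hi j)
    change (∀ j < L, ((Cmd.rep 11 2 _).run ((Cmd.rep 11 2 _).run (Cmd.run (.set 13 1 ;;
      .rep 12 2 _) s'))).arr 3 _ = _) ∧ ∀ l < i + 1, ∀ j < L,
      ((Cmd.rep 11 2 _).run ((Cmd.rep 11 2 _).run (Cmd.run (.set 13 1 ;; .rep 12 2 _) s'))).arr 0 _ = _
    rw [← hs₃, c₃, c₄]
    refine ⟨fun j hj => ?_, fun l hl j hj => ?_⟩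
    · have := block_apply (f := s₄.arr 3) (base := ((i + 1 : ℕ) : ℤ) * L) hj
        (fun j => powCoeff P₀ X (i + 1) j)
      simpa [fillState] using this
    · have e : (fillState s₄ 11 3 (((i + 1 : ℕ) : ℤ) * L) (fun j => powCoeff P₀ X (i + 1) j) L).arr 0
          = s₄.arr 0 := by simp [fillState]
      rw [e, q0]
      rcases eq_or_ne l i with rfl | h
      · rw [block_apply hj]
      · rw [block_cell_ne _ _ hj le_rfl h]
        exact ih₂ l (by omega) j hj)
  intro i hi j hj
  rw [← main.2 i hi j hj, ← c₁, ← r₁]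
  rfl

theorem run_poly {s : State} {L : ℕ} {X : ℤ} {h : ℕ → ℤ} (hL : s.var 2 = L) (h7 : s.var 7 = X)
    (hX : 1 ≤ X) (h0 : ∀ j < L, s.arr 0 j = h j * X ^ j) (hXQ : X ^ L < s.var 5)
    (hhQ : ∀ j < L, |h j| < s.var 5) : ∀ j < L, (polyCmd.run s).arr 5 j = h j := by
  have hpQ : ∀ k ≤ L, |X ^ k| < s.var 5 := fun k hk => by
    rw [abs_of_nonneg (by positivity)]
    exact lt_of_le_of_lt (pow_le_pow_right₀ hX hk) hXQ
  have hcl : clamp (s.var 5) 1 = 1 := clamp_eq (by simpa using hpQ 0 (by omega))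
  have hs : (Cmd.set 13 1).run s = s.setVar 13 1 := by simp [Cmd.run, hcl]
  have main := run_for (x := 11) (b := 2) (n := L) (s := s.setVar 13 1)
    (c := .put 5 (v 11) (.get 0 (v 11) / v 13) ;; .set 13 (v 13 * v 7))
    (fun k s' => s'.var 13 = X ^ k ∧ ∀ j < k, s'.arr 5 j = h j) (by simpa [State.setVar] using hL)
    (by simp [State.setVar]) (by
    rintro k hk s' fr h11 ⟨ih₁, ih₂⟩
    have g5 : s'.var 5 = s.var 5 := (fr.1 5 rfl).trans (by simp [State.setVar])
    have g7 : s'.var 7 = X := (fr.1 7 rfl).trans (by simpa [State.setVar] using h7)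
    have b0 : s'.arr 0 = s.arr 0 := (fr.2 0 rfl).trans (by simp [State.setVar])
    have e₁ : clamp (s.var 5) (h k * X ^ k / X ^ k) = h k := by
      rw [Int.mul_ediv_cancel _ (by positivity), clamp_eq (hhQ k hk)]
    have e₂ : clamp (s.var 5) (X ^ k * X) = X ^ (k + 1) := by
      rw [← pow_succ, clamp_eq (hpQ _ hk)]
    refine ⟨?_, fun j hj => ?_⟩
    · simp [Cmd.run, State.setVar, State.setArr, g5, g7, ih₁, e₂]
    · rcases Nat.lt_or_ge j k with hjk | hjk
      · have : (j : ℤ) ≠ k := by omega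
        simp [Cmd.run, State.setVar, State.setArr, h11, this, ih₂ j hjk]
      · obtain rfl : j = k := by omega
        simp [Cmd.run, State.setVar, State.setArr, h11, g5, b0, h0 j hk, ih₁, e₁])
  change ∀ j < L, ((Cmd.rep 11 2 _).run ((Cmd.set 13 1).run s)).arr 5 j = h j
  rw [hs]
  exact main.2

end LogCost

/-! ### Newton coefficients of the squared polynomial. -/

namespace LogCost

/-- The table of forward differences of the function that agrees with `f` on `0, …, n - 1` and
vanishes from `n` on. -/
def diffTable (n : ℕ) (f : ℤ → ℤ) : ℕ → ℕ → ℤ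
  | 0, x => if x < n then f x else 0
  | i + 1, x => diffTable n f i (x + 1) - diffTable n f i x

theorem diffTable_of_le (n : ℕ) (f : ℤ → ℤ) (i : ℕ) {x : ℕ} (hx : n ≤ x) :
    diffTable n f i x = 0 := by
  induction i generalizing x with
  | zero => simp [diffTable, hx]
  | succ i ih => rw [diffTable, ih hx, ih (by omega), sub_zero]

/-- The difference of order `i` at `x` only involves values up to `x + i`, so inside this triangle
the truncation at `n` is not felt. -/
theorem diffTable_eq {n : ℕ} (f : ℤ → ℤ) {i x : ℕ} (h : x + i < n) :
    diffTable n f i x = (fwdDiff (1 : ℤ))^[i] f x := by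
  induction i generalizing x with
  | zero => simpa [diffTable] using fun h' : n ≤ x => absurd h' (by omega)
  | succ i ih =>
    rw [diffTable, ih (by omega), ih (by omega), Function.iterate_succ_apply', fwdDiff]
    push_cast
    rfl

theorem abs_diffTable_le {n : ℕ} {f : ℤ → ℤ} {Y : ℤ} (hY : 0 ≤ Y) (hf : ∀ x < n, |f x| ≤ Y)
    (i x : ℕ) : |diffTable n f i x| ≤ 2 ^ i * Y := by
  induction i generalizing x with
  | zero =>
    rw [diffTable]
    split_ifs with h
    · simpa using hf x h
    · simpa using hY
  | succ i ih =>
    rw [diffTable, pow_succ]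
    refine (abs_sub _ _).trans ?_
    linarith [ih x, ih (x + 1)]

theorem abs_sum_mul_pow_le {L k : ℕ} {h : ℕ → ℤ} {H x X : ℤ} (hh : ∀ j < L, |h j| ≤ H)
    (hx : |x| ≤ X) (hX : 1 ≤ X) (hH : 0 ≤ H) (hk : k ≤ L) :
    |∑ j ∈ Finset.range k, h j * x ^ j| ≤ L * (H * X ^ L) := by
  calc |∑ j ∈ Finset.range k, h j * x ^ j| ≤ ∑ j ∈ Finset.range k, |h j * x ^ j| :=
        Finset.abs_sum_le_sum_abs _ _
    _ ≤ ∑ _j ∈ Finset.range k, H * X ^ L := by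
        refine Finset.sum_le_sum fun j hj => ?_
        have hj := Finset.mem_range.1 hj
        rw [abs_mul, abs_pow]
        have h₁ : |x| ^ j ≤ X ^ L :=
          (pow_le_pow_left₀ (abs_nonneg _) hx j).trans (pow_le_pow_right₀ hX (by omega))
        exact mul_le_mul (hh j (by omega)) h₁ (by positivity) hH
    _ = k * (H * X ^ L) := by simp
    _ ≤ _ := by
        have : (0 : ℤ) ≤ H * X ^ L := by positivity
        have : (k : ℤ) ≤ L := by exact_mod_cast hk
        nlinarith

theorem run_evalPoly {s : State} {L x : ℕ} {h : ℕ → ℤ} {H X : ℤ} (hL : s.var 2 = L)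
    (h10 : s.var 10 = x) (h5 : ∀ j < L, s.arr 5 j = h j) (hh : ∀ j < L, |h j| ≤ H) (hH : 1 ≤ H)
    (hx : x ≤ X) (hX : 1 ≤ X) (hL0 : 1 ≤ L) (hQ : L * (H * X ^ L) < s.var 5) :
    (Cmd.run (.set 13 0 ;; .set 14 1 ;;
      .rep 11 2 (.set 13 (v 13 + .get 5 (v 11) * v 14) ;; .set 14 (v 14 * v 10))) s).var 13 =
      ∑ j ∈ Finset.range L, h j * (x : ℤ) ^ j := by
  have hxX : |(x : ℤ)| ≤ X := by rwa [abs_of_nonneg (by positivity)]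
  have hsum : ∀ k ≤ L, |∑ j ∈ Finset.range k, h j * (x : ℤ) ^ j| < s.var 5 := fun k hk =>
    (abs_sum_mul_pow_le hh hxX hX (by linarith) hk).trans_lt hQ
  have hXL : 1 ≤ X ^ L := one_le_pow₀ hX
  have hL1 : (1 : ℤ) ≤ L := by exact_mod_cast hL0
  have hpow : ∀ k ≤ L, |(x : ℤ) ^ k| < s.var 5 := fun k hk => by
    rw [abs_pow]
    refine lt_of_le_of_lt ((pow_le_pow_left₀ (abs_nonneg _) hxX k).trans
      (pow_le_pow_right₀ hX hk)) (lt_of_le_of_lt ?_ hQ)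
    nlinarith [mul_le_mul hL1 hH zero_le_one (by linarith)]
  have c₀ : clamp (s.var 5) 0 = 0 := clamp_eq (by simpa using hsum 0 (by omega))
  have c₁ : clamp (s.var 5) 1 = 1 := clamp_eq (by simpa using hpow 0 (by omega))
  obtain ⟨s₁, hs₁⟩ : ∃ s₁, s₁ = (s.setVar 13 0).setVar 14 1 := ⟨_, rfl⟩
  have r₁ : Cmd.run (.set 13 0 ;; .set 14 1) s = s₁ := by
    simp [Cmd.run, c₀, c₁, hs₁, State.setVar]
  have main := run_for (x := 11) (b := 2) (n := L) (s := s₁)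
    (c := .set 13 (v 13 + .get 5 (v 11) * v 14) ;; .set 14 (v 14 * v 10))
    (fun k s' => s'.var 13 = ∑ j ∈ Finset.range k, h j * (x : ℤ) ^ j ∧ s'.var 14 = (x : ℤ) ^ k)
    (by simpa [hs₁, State.setVar] using hL) (by simp [hs₁, State.setVar]) (by
    rintro k hk s' fr h11 ⟨ih₁, ih₂⟩
    have g5 : s'.var 5 = s.var 5 := (fr.1 5 rfl).trans (by simp [hs₁, State.setVar])
    have g10 : s'.var 10 = x := (fr.1 10 rfl).trans (by simpa [hs₁, State.setVar] using h10)
    have a5 : s'.arr 5 k = h k := by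
      rw [fr.2 5 rfl, ← h5 k hk]; simp [hs₁, State.setVar]
    have e₁ := clamp_eq (hsum (k + 1) hk)
    have e₂ := clamp_eq (hpow (k + 1) hk)
    rw [Finset.sum_range_succ] at e₁ ⊢
    rw [pow_succ] at e₂ ⊢
    constructor
    · simp [Cmd.run, State.setVar, g5, h11, ih₁, ih₂, a5, e₁]
    · simp [Cmd.run, State.setVar, g5, g10, ih₂, e₂])
  rw [← main.1, ← r₁]
  rfl

/-- The degree of the square is below `2 * L`, so its values at `0, …, 2 * L - 1` determine all
differences. The zeros stored in the second half of array `7` let `signCmd` read coefficients of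
order `j + k` without a range check. -/
theorem run_newton {s : State} {L : ℕ} {h : ℕ → ℤ} {H : ℤ} (hL0 : 1 ≤ L) (hL : s.var 2 = L)
    (h3 : s.var 3 = 2 * L) (h5 : ∀ j < L, s.arr 5 j = h j) (hh : ∀ j < L, |h j| ≤ H) (hH : 1 ≤ H)
    (hQ : 2 ^ (2 * L) * (L * (H * (2 * L) ^ L)) ^ 2 < s.var 5) :
    (∀ i < 2 * L, (newtonCmd.run s).arr 7 i =
      (fwdDiff (1 : ℤ))^[i] (fun x => (∑ j ∈ Finset.range L, h j * x ^ j) ^ 2) 0) ∧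
    (∀ i < 2 * L, |(newtonCmd.run s).arr 7 i| ≤ 2 ^ (2 * L) * (L * (H * (2 * L) ^ L)) ^ 2) ∧
    ∀ i, 2 * L ≤ i → i < 2 * (2 * L) → (newtonCmd.run s).arr 7 i = 0 := by
  have h3' : s.var 3 = (2 * L : ℕ) := by rw [h3]; push_cast; rfl
  have hX : (1 : ℤ) ≤ 2 * L := by omega
  have hXL : (1 : ℤ) ≤ (2 * L) ^ L := one_le_pow₀ hX
  set Z : ℤ := L * (H * (2 * L) ^ L) with hZ
  have hL1 : (1 : ℤ) ≤ L := by exact_mod_cast hL0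
  have hZ1 : 1 ≤ Z := by
    have : 1 ≤ H * (2 * L : ℤ) ^ L := by nlinarith
    nlinarith
  have h2p : (1 : ℤ) ≤ 2 ^ (2 * L) := one_le_pow₀ (by norm_num)
  have hZ2 : Z ≤ Z ^ 2 := by nlinarith
  have hZZ : Z ^ 2 ≤ 2 ^ (2 * L) * Z ^ 2 := le_mul_of_one_le_left (by positivity) h2p
  have hZQ : Z < s.var 5 := by linarith
  have hQ0 : 0 < s.var 5 := by linarith
  set f : ℤ → ℤ := fun x => (∑ j ∈ Finset.range L, h j * x ^ j) ^ 2 with hf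
  have hfZ : ∀ x < 2 * L, |f x| ≤ Z ^ 2 := fun x hx => by
    rw [hf, abs_pow]
    refine pow_le_pow_left₀ (abs_nonneg _) (abs_sum_mul_pow_le hh ?_ hX (by linarith) le_rfl) 2
    rw [abs_of_nonneg (by positivity)]
    exact_mod_cast hx.le
  have hD : ∀ i ≤ 2 * L, ∀ x, |diffTable (2 * L) f i x| < s.var 5 := fun i hi x => by
    refine lt_of_le_of_lt (abs_diffTable_le (by positivity) hfZ i x) (lt_of_le_of_lt ?_ hQ)
    gcongr
    norm_num
  have c₁ := run_for (x := 10) (b := 3) (n := 2 * L) (s := s) (c :=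
    .set 13 0 ;; .set 14 1 ;;
    .rep 11 2 (.set 13 (v 13 + .get 5 (v 11) * v 14) ;; .set 14 (v 14 * v 10)) ;;
    .put 6 (v 10) (v 13 * v 13)) (fun k s' => ∀ x < k, s'.arr 6 x = f x) h3'
    (fun x hx => absurd hx (by omega)) (by
    rintro k hk s' fr h10 ih x hx
    obtain ⟨s₃, hs₃⟩ : ∃ s₃, s₃ = Cmd.run (.set 13 0 ;; .set 14 1 ;;
      .rep 11 2 (.set 13 (v 13 + .get 5 (v 11) * v 14) ;; .set 14 (v 14 * v 10))) s' := ⟨_, rfl⟩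
    have fr₃ : Frame _ s' s₃ := hs₃ ▸ Cmd.frame _ s'
    have g5 : s'.var 5 = s.var 5 := fr.1 5 rfl
    have m13 : s₃.var 13 = _ := hs₃ ▸ run_evalPoly ((fr.1 2 rfl).trans hL) h10
      (fun j hj => by rw [fr.2 5 rfl, h5 j hj]) hh hH (X := 2 * L) (by exact_mod_cast hk.le) hX hL0
      (by rw [g5]; exact hZQ)
    have m5 : s₃.var 5 = s.var 5 := (fr₃.1 5 rfl).trans g5
    have m10 : s₃.var 10 = k := (fr₃.1 10 rfl).trans h10
    have n6 : s₃.arr 6 = s'.arr 6 := fr₃.2 6 rfl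
    have e₁ : clamp (s.var 5) ((∑ j ∈ Finset.range L, h j * (k : ℤ) ^ j) *
        ∑ j ∈ Finset.range L, h j * (k : ℤ) ^ j) = f k := by
      rw [← sq, clamp_eq]
      exact (hfZ k hk).trans_lt (hZZ.trans_lt hQ)
    change ((Cmd.put 6 (v 10) (v 13 * v 13)).run (Cmd.run (.set 13 0 ;; .set 14 1 ;;
      .rep 11 2 _) s')).arr 6 x = f x
    rw [← hs₃]
    rcases Nat.lt_or_ge x k with hxk | hxk
    · have : (x : ℤ) ≠ k := by omega
      simp [Cmd.run, State.setArr, m10, this, n6, ih x hxk]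
    · obtain rfl : x = k := by omega
      simp [Cmd.run, State.setArr, m10, m5, m13, e₁])
  obtain ⟨s₁, hs₁⟩ : ∃ s₁, s₁ = Cmd.run (.rep 10 3 (.set 13 0 ;; .set 14 1 ;;
    .rep 11 2 (.set 13 (v 13 + .get 5 (v 11) * v 14) ;; .set 14 (v 14 * v 10)) ;;
    .put 6 (v 10) (v 13 * v 13))) s := ⟨_, rfl⟩
  rw [← hs₁] at c₁
  have fr₁ : Frame _ s s₁ := hs₁ ▸ Cmd.frame _ s
  have d5 : s₁.var 5 = s.var 5 := fr₁.1 5 rfl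
  have d3 : s₁.var 3 = (2 * L : ℕ) := (fr₁.1 3 rfl).trans h3'
  have c0 : clamp (s.var 5) 0 = 0 := clamp_eq (by simpa using hQ0)
  obtain ⟨s₂, hs₂⟩ : ∃ s₂, s₂ = s₁.setArr 6 (2 * L : ℕ) 0 := ⟨_, rfl⟩
  have r₂ : (Cmd.put 6 (v 3) 0).run s₁ = s₂ := by
    simp only [Cmd.run, Expr.eval_var, Expr.eval_zero, d5, c0, hs₂, d3]
  -- Cell `2 * L` is a permanent zero that the last difference in each round reads; `diffTable`
  -- vanishes there as well.
  have z6 : ∀ x ≤ 2 * L, s₂.arr 6 x = diffTable (2 * L) f 0 x := fun x hx => by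
    rcases Nat.lt_or_ge x (2 * L) with h | h
    · have h' : (x : ℤ) ≠ (2 * L : ℕ) := by omega
      rw [diffTable, if_pos h, ← c₁ x h]
      simp only [hs₂, State.setArr, Function.update_self]
      rw [Function.update_of_ne h']
    · obtain rfl : x = 2 * L := by omega
      simp [hs₂, State.setArr, diffTable]
  have c₃ := run_for_put (x := 10) (b := 3) (a := 7) (s := s₂) (n := 2 * L)
    (idx := v 3 + v 10) (e := 0) (2 * L : ℕ) (fun _ => 0) (by simp [hs₂, State.setArr, d3])
    (by norm_num) (fun j hj => by simp [fillState, hs₂, State.setArr, d3])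
    (fun j hj => by simp) (fun j hj => by simpa [hs₂, State.setArr, d5] using hQ0)
  obtain ⟨s₃, hs₃⟩ : ∃ s₃, s₃ = fillState s₂ 10 7 (2 * L : ℕ) (fun _ => 0) (2 * L) := ⟨_, rfl⟩
  rw [← hs₃] at c₃
  have e5 : s₃.var 5 = s.var 5 := by simp [hs₃, hs₂, fillState, State.setArr, d5]
  have e3 : s₃.var 3 = (2 * L : ℕ) := by simp [hs₃, hs₂, fillState, State.setArr, d3]
  have main := run_for (x := 10) (b := 3) (n := 2 * L) (s := s₃) (c :=
    .put 7 (v 10) (.get 6 0) ;;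
    .rep 11 3 (.put 6 (v 11) (.get 6 (v 11 + 1) - .get 6 (v 11))))
    (fun k s' => (∀ x ≤ 2 * L, s'.arr 6 x = diffTable (2 * L) f k x) ∧
      (∀ i < k, s'.arr 7 i = diffTable (2 * L) f i 0) ∧
      ∀ i, 2 * L ≤ i → i < 2 * (2 * L) → s'.arr 7 i = 0) e3
    ⟨fun x hx => by
      rw [← z6 x hx]
      simp [hs₃, fillState, State.setVar], fun i hi => absurd hi (by omega), fun i hi hi' => by
      have := block_apply (f := s₂.arr 7) (base := (2 * L : ℕ)) (by omega : i - 2 * L < 2 * L)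
        (fun _ => 0)
      rw [show ((2 * L : ℕ) : ℤ) + (i - 2 * L : ℕ) = i by omega] at this
      simpa [hs₃, fillState, State.setVar] using this⟩ (by
    rintro k hk s' fr h10 ⟨ih₁, ih₂, ih₃⟩
    have g5 : s'.var 5 = s.var 5 := (fr.1 5 rfl).trans e5
    have g3 : s'.var 3 = (2 * L : ℕ) := (fr.1 3 rfl).trans e3
    obtain ⟨s₄, hs₄⟩ : ∃ s₄, s₄ = s'.setArr 7 k (diffTable (2 * L) f k 0) := ⟨_, rfl⟩
    have r₄ : (Cmd.put 7 (v 10) (.get 6 0)).run s' = s₄ := by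
      have h0 := ih₁ 0 (by omega)
      rw [Nat.cast_zero] at h0
      simp only [Cmd.run, Expr.eval_var, Expr.eval_get, Expr.eval_zero, h0, g5, h10,
        clamp_eq (hD k hk.le 0), hs₄]
    have g6 : s₄.arr 6 = s'.arr 6 := by simp [hs₄, State.setArr]
    have c₄ := run_for_put (x := 11) (b := 3) (a := 6) (s := s₄) (n := 2 * L)
      (idx := v 11) (e := .get 6 (v 11 + 1) - .get 6 (v 11)) 0
      (fun j => diffTable (2 * L) f (k + 1) j) (by simp [hs₄, State.setArr, g3])
      (by norm_num) (fun j hj => by simp [fillState])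
      (fun j hj => by
        -- The array is overwritten from left to right, so cells `j` and `j + 1` still hold
        -- differences of order `k` when cell `j` is replaced.
        have e₁ := block_of_le (f := s'.arr 6) (base := 0) (z := (j : ℤ) + 1) (n := j) (by omega)
          (fun j => diffTable (2 * L) f (k + 1) j)
        have e₂ := block_of_le (f := s'.arr 6) (base := 0) (z := (j : ℤ)) (n := j) (by omega)
          (fun j => diffTable (2 * L) f (k + 1) j)
        have i₁ := ih₁ (j + 1) (by omega)
        rw [Nat.cast_add, Nat.cast_one] at i₁
        rw [i₁] at e₁
        rw [ih₁ j (by omega)] at e₂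
        simp [fillState, g6, e₁, e₂]
        rfl)
      (fun j hj => by simpa [hs₄, State.setArr, g5] using hD (k + 1) hk j)
    change (∀ x ≤ 2 * L, ((Cmd.rep 11 3 _).run ((Cmd.put 7 _ _).run s')).arr 6 x = _) ∧
      (∀ i < k + 1, ((Cmd.rep 11 3 _).run ((Cmd.put 7 _ _).run s')).arr 7 i = _) ∧
      ∀ i, 2 * L ≤ i → i < 2 * (2 * L) → ((Cmd.rep 11 3 _).run ((Cmd.put 7 _ _).run s')).arr 7 i = 0
    rw [r₄, c₄]
    refine ⟨fun x hx => ?_, fun i hi => ?_, fun i hi hi' => ?_⟩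
    · rcases Nat.lt_or_ge x (2 * L) with h | h
      · have := block_apply (f := s₄.arr 6) (base := 0) h
          (fun j => diffTable (2 * L) f (k + 1) j)
        rw [zero_add] at this
        simpa [fillState] using this
      · have := block_of_le (f := s₄.arr 6) (base := 0) (z := (x : ℤ)) (n := 2 * L) (by omega)
          (fun j => diffTable (2 * L) f (k + 1) j)
        rw [g6, ih₁ x hx, diffTable_of_le _ _ _ h] at this
        rw [diffTable_of_le _ _ _ h]
        simpa [fillState, g6] using this
    · have e : (fillState s₄ 11 6 0 (fun j => diffTable (2 * L) f (k + 1) j) (2 * L)).arr 7 =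
          s₄.arr 7 := by simp [fillState]
      rw [e, hs₄]
      rcases Nat.lt_or_ge i k with h | h
      · have : (i : ℤ) ≠ k := by omega
        simp [State.setArr, this, ih₂ i h]
      · obtain rfl : i = k := by omega
        simp [State.setArr]
    · have e : (fillState s₄ 11 6 0 (fun j => diffTable (2 * L) f (k + 1) j) (2 * L)).arr 7 =
          s₄.arr 7 := by simp [fillState]
      have : (i : ℤ) ≠ k := by omega
      rw [e, hs₄]
      simp [State.setArr, this, ih₃ i hi hi'])
  have hrun : ∀ i, (newtonCmd.run s).arr 7 i = (Cmd.run (.rep 10 3 (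
    .put 7 (v 10) (.get 6 0) ;;
    .rep 11 3 (.put 6 (v 11) (.get 6 (v 11 + 1) - .get 6 (v 11))))) s₃).arr 7 i := fun i => by
    rw [← c₃, ← r₂, hs₁]; rfl
  refine ⟨fun i hi => ?_, fun i hi => ?_, fun i hi hi' => ?_⟩
  · rw [hrun, main.2.1 i hi, diffTable_eq f (by omega), Nat.cast_zero]
  · rw [hrun, main.2.1 i hi]
    refine (abs_diffTable_le (by positivity) hfZ i 0).trans ?_
    gcongr
    norm_num
  · rw [hrun, main.2.2 i hi hi']

end LogCost

/-! ### Evaluation of signs and binary search. -/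

namespace LogCost

open NewtonSeries

/-- The binomial coefficients are updated by `C(x, k + 1) = C(x, k) * (x - k) / (k + 1)`, an exact
division that also gives the correct value `0` from `k = x` on. -/
theorem run_sign {s : State} {n j x : ℕ} {a : ℕ → ℤ} {X A : ℤ} (h3 : s.var 3 = n)
    (h18 : s.var 18 = j) (h20 : s.var 20 = x) (hj : j ≤ n) (h7 : ∀ i < 2 * n, s.arr 7 i = a i)
    (ha : ∀ i, |a i| ≤ A) (hA : 1 ≤ A) (hx : x ≤ X) (hX : 1 ≤ X) (hn : 1 ≤ n)
    (hQ : n * (X ^ n * A) < s.var 5) :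
    (signCmd.run s).var 21 = if 0 < eval n a j x then 1 else 0 := by
  have hXn : 1 ≤ X ^ n := one_le_pow₀ hX
  have hn1 : (1 : ℤ) ≤ n := by exact_mod_cast hn
  have hbin : ∀ k ≤ n, (x.choose k : ℤ) ≤ X ^ n := fun k hk => by
    have h₁ : (x.choose k : ℤ) ≤ (x : ℤ) ^ k := by exact_mod_cast Nat.choose_le_pow x k
    exact h₁.trans ((pow_le_pow_left₀ (by positivity) hx k).trans (pow_le_pow_right₀ hX hk))
  have hXQ : X ^ n < s.var 5 := by
    refine lt_of_le_of_lt ?_ hQ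
    nlinarith [mul_le_mul hn1 hA zero_le_one (by linarith)]
  have hbinQ : ∀ k ≤ n, |(x.choose k : ℤ)| < s.var 5 := fun k hk => by
    rw [abs_of_nonneg (by positivity)]
    exact (hbin k hk).trans_lt hXQ
  have hsum : ∀ k ≤ n, |∑ i ∈ Finset.range k, (x.choose i : ℤ) * a (j + i)| < s.var 5 :=
      fun k hk => by
    refine lt_of_le_of_lt ?_ hQ
    calc |∑ i ∈ Finset.range k, (x.choose i : ℤ) * a (j + i)|
        ≤ ∑ i ∈ Finset.range k, |(x.choose i : ℤ) * a (j + i)| := Finset.abs_sum_le_sum_abs _ _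
      _ ≤ ∑ _i ∈ Finset.range k, X ^ n * A := by
          refine Finset.sum_le_sum fun i hi => ?_
          have hi := Finset.mem_range.1 hi
          rw [abs_mul, abs_of_nonneg (by positivity : (0 : ℤ) ≤ (x.choose i : ℤ))]
          exact mul_le_mul (hbin i (by omega)) (ha _) (abs_nonneg _) (by linarith)
      _ = k * (X ^ n * A) := by simp
      _ ≤ _ := by
          have : (0 : ℤ) ≤ X ^ n * A := by positivity
          have : (k : ℤ) ≤ n := by exact_mod_cast hk
          nlinarith
  have c₀ : clamp (s.var 5) 0 = 0 := clamp_eq (by simpa using hsum 0 (by omega))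
  have c₁ : clamp (s.var 5) 1 = 1 := clamp_eq (by simpa using hbinQ 0 (by omega))
  obtain ⟨s₁, hs₁⟩ : ∃ s₁, s₁ = (s.setVar 13 0).setVar 14 1 := ⟨_, rfl⟩
  have r₁ : Cmd.run (.set 13 0 ;; .set 14 1) s = s₁ := by
    simp [Cmd.run, c₀, c₁, hs₁, State.setVar]
  have main := run_for (x := 11) (b := 3) (n := n) (s := s₁)
    (c := .set 13 (v 13 + v 14 * .get 7 (v 18 + v 11)) ;;
      .set 14 (v 14 * (v 20 - v 11) / (v 11 + 1)))
    (fun k s' => s'.var 13 = ∑ i ∈ Finset.range k, (x.choose i : ℤ) * a (j + i) ∧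
      s'.var 14 = x.choose k)
    (by simpa [hs₁, State.setVar] using h3) (by simp [hs₁, State.setVar]) (by
    rintro k hk s' fr h11 ⟨ih₁, ih₂⟩
    have g5 : s'.var 5 = s.var 5 := (fr.1 5 rfl).trans (by simp [hs₁, State.setVar])
    have g18 : s'.var 18 = j := (fr.1 18 rfl).trans (by simpa [hs₁, State.setVar] using h18)
    have g20 : s'.var 20 = x := (fr.1 20 rfl).trans (by simpa [hs₁, State.setVar] using h20)
    have a7 : s'.arr 7 (j + k) = a (j + k) := by
      rw [fr.2 7 rfl]
      have := h7 (j + k) (by omega)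
      push_cast at this
      simpa [hs₁, State.setVar] using this
    have e₁ := clamp_eq (hsum (k + 1) hk)
    have e₂ : clamp (s.var 5) ((x.choose k : ℤ) * (x - k) / (k + 1)) = x.choose (k + 1) := by
      have : (x.choose k : ℤ) * (x - k) = x.choose (k + 1) * (k + 1) := by
        rcases Nat.lt_or_ge x k with h | h
        · rw [Nat.choose_eq_zero_of_lt h, Nat.choose_eq_zero_of_lt (by omega)]; simp
        · have := Nat.choose_succ_right_eq x k
          zify [h] at this
          exact this.symm
      rw [this, Int.mul_ediv_cancel _ (by positivity), clamp_eq (hbinQ _ hk)]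
    rw [Finset.sum_range_succ] at e₁ ⊢
    constructor
    · simp [Cmd.run, State.setVar, g5, h11, g18, ih₁, ih₂, a7, e₁]
    · simp [Cmd.run, State.setVar, g5, h11, g20, ih₂, e₂])
  have hrun : signCmd.run s = (Cmd.set 21 (.le 1 (v 13))).run (Cmd.run (.rep 11 3
      (.set 13 (v 13 + v 14 * .get 7 (v 18 + v 11)) ;;
      .set 14 (v 14 * (v 20 - v 11) / (v 11 + 1)))) s₁) := by
    rw [← r₁]; rfl
  obtain ⟨s₂, hs₂⟩ : ∃ s₂, s₂ = Cmd.run (.rep 11 3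
      (.set 13 (v 13 + v 14 * .get 7 (v 18 + v 11)) ;;
      .set 14 (v 14 * (v 20 - v 11) / (v 11 + 1)))) s₁ := ⟨_, rfl⟩
  have fr₂ : Frame _ s₁ s₂ := hs₂ ▸ Cmd.frame _ s₁
  rw [← hs₂] at main hrun
  have g5 : s₂.var 5 = s.var 5 := (fr₂.1 5 rfl).trans (by simp [hs₁, State.setVar])
  have h13 : s₂.var 13 = eval n a j x := main.1
  rw [hrun]
  by_cases h : 0 < eval n a j x
  · have h' : 1 ≤ eval n a j x := h
    simp [Cmd.run, State.setVar, h13, h, h', g5, c₁]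
  · have h' : ¬ 1 ≤ eval n a j x := h
    simp [Cmd.run, State.setVar, h13, h, h', g5, c₀]

theorem run_search {s : State} {L n j i p q : ℕ} {a : ℕ → ℤ} {X A : ℤ} (h2 : s.var 2 = L)
    (h3 : s.var 3 = n) (h18 : s.var 18 = j) (h15 : s.var 15 = i) (hp : s.arr 8 i = p)
    (hq : s.arr 8 (i + 1) = q) (hj : j ≤ n) (h7 : ∀ i < 2 * n, s.arr 7 i = a i)
    (ha : ∀ i, |a i| ≤ A) (hA : 1 ≤ A) (hpq : p ≤ q) (hqX : q ≤ X) (hX : 1 ≤ X) (hn : 1 ≤ n)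
    (hXL : X < 2 ^ L) (hQ : n * (X ^ n * A) < s.var 5)
    (hm : MonotoneOn (eval n a j) (Set.Icc p q) ∨ AntitoneOn (eval n a j) (Set.Icc p q)) :
    ∃ c : ℕ, (searchCmd.run s).var 23 = c ∧ IsCut (eval n a j) p q c := by
  have hn1 : (1 : ℤ) ≤ n := by exact_mod_cast hn
  have hXn : X ≤ X ^ n := le_self_pow₀ hX (by omega)
  have hXQ : X < s.var 5 := by
    refine lt_of_le_of_lt (hXn.trans ?_) hQ
    nlinarith [mul_le_mul hn1 hA zero_le_one (by linarith)]
  have hcl : ∀ z : ℕ, z ≤ q → clamp (s.var 5) z = z := fun z hz => clamp_eq (by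
    rw [abs_of_nonneg (by positivity)]
    exact lt_of_le_of_lt (le_trans (by exact_mod_cast hz) hqX) hXQ)
  obtain ⟨s₁, hs₁⟩ : ∃ s₁, s₁ = ((s.setVar 22 p).setVar 23 q).setVar 20 p := ⟨_, rfl⟩
  have r₁ : Cmd.run (.set 22 (.get 8 (v 15)) ;; .set 23 (.get 8 (v 15 + 1)) ;;
      .set 20 (v 22)) s = s₁ := by
    simp [Cmd.run, hs₁, State.setVar, h15, hp, hq, hcl p hpq, hcl q le_rfl]
  have sg := run_sign (s := s₁) (n := n) (j := j) (x := p) (a := a) (X := X) (A := A)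
    (by simp [hs₁, State.setVar, h3]) (by simp [hs₁, State.setVar, h18])
    (by simp [hs₁, State.setVar]) hj (fun i hi => by simp [hs₁, State.setVar, h7 i hi]) ha hA
    (le_trans (by exact_mod_cast hpq) hqX) hX hn (by simpa [hs₁, State.setVar] using hQ)
  obtain ⟨s₂, hs₂⟩ : ∃ s₂, s₂ = signCmd.run s₁ := ⟨_, rfl⟩
  have fr₂ : Frame _ s₁ s₂ := hs₂ ▸ Cmd.frame _ s₁
  rw [← hs₂] at sg
  have hb : ∀ (P : Prop) [Decidable P], clamp (s.var 5) (if P then 1 else 0) = if P then 1 else 0 :=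
    fun P _ => by
      refine clamp_eq ?_
      split_ifs <;> simp <;> linarith
  have d5 : s₂.var 5 = s.var 5 := (fr₂.1 5 rfl).trans (by simp [hs₁, State.setVar])
  obtain ⟨s₃, hs₃⟩ : ∃ s₃, s₃ = s₂.setVar 24 (if 0 < eval n a j p then 1 else 0) := ⟨_, rfl⟩
  have r₃ : (Cmd.set 24 (v 21)).run s₂ = s₃ := by
    simp only [Cmd.run, Expr.eval_var, sg, d5, hb, hs₃]
  have e5 : s₃.var 5 = s.var 5 := by simp [hs₃, State.setVar, d5]
  have e22 : s₃.var 22 = p := by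
    rw [hs₃]
    simp only [State.setVar, Function.update_of_ne (by norm_num : 22 ≠ 24)]
    rw [fr₂.1 22 rfl]; simp [hs₁, State.setVar]
  have e23 : s₃.var 23 = q := by
    rw [hs₃]
    simp only [State.setVar, Function.update_of_ne (by norm_num : 23 ≠ 24)]
    rw [fr₂.1 23 rfl]; simp [hs₁, State.setVar]
  have e2 : s₃.var 2 = L := by
    rw [hs₃]
    simp only [State.setVar, Function.update_of_ne (by norm_num : 2 ≠ 24)]
    rw [fr₂.1 2 rfl]; simp [hs₁, State.setVar, h2]
  have e3 : s₃.var 3 = n := by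
    rw [hs₃]
    simp only [State.setVar, Function.update_of_ne (by norm_num : 3 ≠ 24)]
    rw [fr₂.1 3 rfl]; simp [hs₁, State.setVar, h3]
  have e18 : s₃.var 18 = j := by
    rw [hs₃]
    simp only [State.setVar, Function.update_of_ne (by norm_num : 18 ≠ 24)]
    rw [fr₂.1 18 rfl]; simp [hs₁, State.setVar, h18]
  have e24 : s₃.var 24 = if 0 < eval n a j p then 1 else 0 := by simp [hs₃, State.setVar]
  have e7 : s₃.arr 7 = s.arr 7 := by
    rw [hs₃]; change s₂.arr 7 = _; rw [fr₂.2 7 rfl, hs₁]; rfl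
  have main := run_for (x := 12) (b := 2) (n := L) (s := s₃)
    (c := .set 20 ((v 22 + v 23) / 2) ;; signCmd ;;
      .ite (.equals (v 21) (v 24)) (.set 22 (v 20)) (.set 23 (v 20)))
    -- Every round at least halves a positive `hi - lo - 1`. After `L` rounds `X < 2 ^ L` forces `hi
    -- ≤ lo + 1`.
    (fun k s' => ∃ lo hi : ℕ, s'.var 22 = lo ∧ s'.var 23 = hi ∧ p ≤ lo ∧ lo ≤ hi ∧ hi ≤ q ∧
      ((hi : ℤ) - lo - 1) * 2 ^ k ≤ X ∧ (0 < eval n a j lo ↔ 0 < eval n a j p) ∧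
      (hi = q ∨ ¬(0 < eval n a j hi ↔ 0 < eval n a j p))) e2
    ⟨p, q, by simp [State.setVar, e22], by simp [State.setVar, e23], le_rfl, hpq, le_rfl,
      by simp; omega, Iff.rfl, Or.inl rfl⟩ (by
    rintro k hk s' fr - ⟨lo, hi, g22, g23, h₁, h₂, h₃, h₄, h₅, h₆⟩
    have g5 : s'.var 5 = s.var 5 := (fr.1 5 rfl).trans e5
    obtain ⟨m, hmid⟩ : ∃ m, m = (lo + hi) / 2 := ⟨_, rfl⟩
    obtain ⟨s₄, hs₄⟩ : ∃ s₄, s₄ = s'.setVar 20 m := ⟨_, rfl⟩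
    have r₄ : (Cmd.set 20 ((v 22 + v 23) / 2)).run s' = s₄ := by
      have : ((lo : ℤ) + hi) / 2 = m := by omega
      simp [Cmd.run, g22, g23, g5, this, hcl m (by omega), hs₄]
    have sg' := run_sign (s := s₄) (n := n) (j := j) (x := m) (a := a) (X := X) (A := A)
      (by simp [hs₄, State.setVar, fr.1 3 rfl, e3]) (by simp [hs₄, State.setVar, fr.1 18 rfl, e18])
      (by simp [hs₄, State.setVar]) hj
      (fun i hi => by simp [hs₄, State.setVar, fr.2 7 rfl, e7, h7 i hi]) ha hA
      (le_trans (by exact_mod_cast (by omega : m ≤ q)) hqX) hX hn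
      (by simpa [hs₄, State.setVar, g5] using hQ)
    obtain ⟨s₅, hs₅⟩ : ∃ s₅, s₅ = signCmd.run s₄ := ⟨_, rfl⟩
    have fr₅ : Frame _ s₄ s₅ := hs₅ ▸ Cmd.frame _ s₄
    rw [← hs₅] at sg'
    have k5 : s₅.var 5 = s.var 5 := (fr₅.1 5 rfl).trans (by simp [hs₄, State.setVar, g5])
    have k20 : s₅.var 20 = m := (fr₅.1 20 rfl).trans (by simp [hs₄, State.setVar])
    have k22 : s₅.var 22 = lo := (fr₅.1 22 rfl).trans (by simp [hs₄, State.setVar, g22])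
    have k23 : s₅.var 23 = hi := (fr₅.1 23 rfl).trans (by simp [hs₄, State.setVar, g23])
    have k24 : s₅.var 24 = if 0 < eval n a j p then 1 else 0 :=
      (fr₅.1 24 rfl).trans (by simp [hs₄, State.setVar, fr.1 24 rfl, e24])
    have htest : (Expr.equals (v 21) (v 24)).eval s₅ ≠ 0 ↔
        (0 < eval n a j m ↔ 0 < eval n a j p) := by
      simp only [Expr.eval_equals, Expr.eval_var, sg', k24]
      by_cases u : 0 < eval n a j m <;> by_cases w : 0 < eval n a j p <;> simp [u, w]
    have hpow : (0 : ℤ) < 2 ^ k := by positivity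
    change ∃ lo hi : ℕ, (State.setVar ((Cmd.ite _ _ _).run (signCmd.run ((Cmd.set 20 _).run s')))
      12 _).var 22 = lo ∧ (State.setVar ((Cmd.ite _ _ _).run (signCmd.run ((Cmd.set 20 _).run s')))
      12 _).var 23 = hi ∧ _
    rw [r₄, ← hs₅]
    by_cases h : 0 < eval n a j m ↔ 0 < eval n a j p
    · refine ⟨m, hi, ?_, ?_, by omega, by omega, h₃, ?_, h, h₆⟩
      · rw [Cmd.run, if_pos (htest.2 h)]
        simp [Cmd.run, State.setVar, k20, k5, hcl m (by omega)]
      · rw [Cmd.run, if_pos (htest.2 h)]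
        simp [Cmd.run, State.setVar, k23]
      · refine le_trans ?_ h₄
        rw [pow_succ, mul_comm (2 ^ k) (2 : ℤ), ← mul_assoc]
        exact mul_le_mul_of_nonneg_right (by omega) hpow.le
    · refine ⟨lo, m, ?_, ?_, h₁, by omega, by omega, ?_, h₅, Or.inr h⟩
      · rw [Cmd.run, if_neg (mt htest.1 h)]
        simp [Cmd.run, State.setVar, k22]
      · rw [Cmd.run, if_neg (mt htest.1 h)]
        simp [Cmd.run, State.setVar, k20, k5, hcl m (by omega)]
      · refine le_trans ?_ h₄
        rw [pow_succ, mul_comm (2 ^ k) (2 : ℤ), ← mul_assoc]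
        exact mul_le_mul_of_nonneg_right (by omega) hpow.le)
  obtain ⟨lo, hi, -, g23, h₁, h₂, h₃, h₄, h₅, h₆⟩ := main
  refine ⟨hi, ?_, isCut_of_search hm h₁ h₂ h₃ ?_ h₅ h₆⟩
  · rw [← g23, ← r₃, hs₂, ← r₁]; rfl
  · by_contra! hc
    have : (1 : ℤ) ≤ hi - lo - 1 := by omega
    have : (0 : ℤ) < 2 ^ L := by positivity
    nlinarith

end LogCost

/-! ### Separation of signs, order by order. -/

namespace LogCost

open NewtonSeries

/-- The search in cell `i` overwrites breakpoint `i + 1`. Going from right to left, the cells still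
to be searched keep both of their old ends. -/
theorem run_level {s : State} {L n j : ℕ} {a : ℕ → ℤ} {c : ℕ → ℕ} {X : ℕ} {A : ℤ}
    (h2 : s.var 2 = L) (h3 : s.var 3 = n) (h18 : s.var 18 = j) (hj : j < n)
    (h7 : ∀ i < 2 * n, s.arr 7 i = a i) (ha0 : ∀ i, n ≤ i → a i = 0)
    (ha : ∀ i, |a i| ≤ A) (hA : 1 ≤ A) (hX : 1 ≤ X) (hXL : X < 2 ^ L)
    (hQ : n * (X ^ n * A) < s.var 5) (h8 : ∀ i ≤ n + 1, s.arr 8 i = c i)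
    (hc : ∀ i ≤ n, c i ≤ c (i + 1)) (hcX : ∀ i ≤ n + 1, c i ≤ X)
    (hsep : Separates (n + 1) c (eval n a (j + 1))) :
    ∃ d : ℕ → ℕ, (∀ i < n, IsCut (eval n a j) (c i) (c (i + 1)) (d (i + 1))) ∧
      d 0 = c 0 ∧ d (n + 1) = c (n + 1) ∧ ∀ i ≤ n + 1, (Cmd.run (.rep 19 3
        (.set 15 (v 3 - 1 - v 19) ;; searchCmd ;; .put 8 (v 15 + 1) (v 23))) s).arr 8 i = d i := by
  have hn : 1 ≤ n := by omega
  have hn1 : (1 : ℤ) ≤ n := by exact_mod_cast hn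
  have hX1 : (1 : ℤ) ≤ X := by exact_mod_cast hX
  have hXn : (X : ℤ) ≤ X ^ n := le_self_pow₀ hX1 (by omega)
  have hXn1 : (1 : ℤ) ≤ X ^ n := one_le_pow₀ hX1
  have hnQ : n < s.var 5 := by
    refine lt_of_le_of_lt ?_ hQ
    have : (1 : ℤ) ≤ X ^ n * A := by nlinarith
    nlinarith
  have hXQ : X < s.var 5 := by
    refine lt_of_le_of_lt (hXn.trans ?_) hQ
    nlinarith [mul_le_mul hn1 hA zero_le_one (by linarith)]
  have main := run_for (x := 19) (b := 3) (n := n) (s := s)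
    (c := .set 15 (v 3 - 1 - v 19) ;; searchCmd ;; .put 8 (v 15 + 1) (v 23))
    (fun k s' => ∃ d : ℕ → ℕ, (∀ i < n, n ≤ i + k →
      IsCut (eval n a j) (c i) (c (i + 1)) (d (i + 1))) ∧
      ∀ i ≤ n + 1, s'.arr 8 i = if i ≤ n ∧ n < i + k then d i else c i) h3
    ⟨c, fun i hi hi' => absurd hi (by omega), fun i hi => by
      rw [if_neg (by omega)]; exact h8 i hi⟩ (by
    rintro k hk s' fr h19 ⟨d, hd₁, hd₂⟩
    obtain ⟨i, hi⟩ : ∃ i, i = n - 1 - k := ⟨_, rfl⟩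
    have g5 : s'.var 5 = s.var 5 := fr.1 5 rfl
    have g3 : s'.var 3 = n := (fr.1 3 rfl).trans h3
    obtain ⟨s₁, hs₁⟩ : ∃ s₁, s₁ = s'.setVar 15 i := ⟨_, rfl⟩
    have r₁ : (Cmd.set 15 (v 3 - 1 - v 19)).run s' = s₁ := by
      have e : (n : ℤ) - 1 - k = i := by omega
      have : clamp (s.var 5) (i : ℤ) = i := clamp_eq (by
        rw [abs_of_nonneg (by positivity)]; omega)
      simp [Cmd.run, g3, h19, g5, e, this, hs₁]
    have hp : s₁.arr 8 i = c i := by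
      have := hd₂ i (by omega)
      rw [if_neg (by omega)] at this
      simpa [hs₁, State.setVar] using this
    have hq : s₁.arr 8 (i + 1) = c (i + 1) := by
      have := hd₂ (i + 1) (by omega)
      rw [if_neg (by omega), Nat.cast_add, Nat.cast_one] at this
      simpa [hs₁, State.setVar] using this
    obtain ⟨e, he₁, he₂⟩ := run_search (s := s₁) (L := L) (n := n) (j := j) (i := i) (a := a)
      (X := X) (A := A) (by simp [hs₁, State.setVar, fr.1 2 rfl, h2])
      (by simp [hs₁, State.setVar, g3]) (by simp [hs₁, State.setVar, fr.1 18 rfl, h18])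
      (by simp [hs₁, State.setVar]) hp hq hj.le
      (fun i hi => by simp [hs₁, State.setVar, fr.2 7 rfl, h7 i hi]) ha hA (hc i (by omega))
      (by exact_mod_cast hcX (i + 1) (by omega)) hX1 hn (by exact_mod_cast hXL)
      (by simpa [hs₁, State.setVar, g5] using hQ)
      (monotoneOn_or_antitoneOn (fun x => eval_succ_sub ha0 j x) (hsep i (by omega)))
    obtain ⟨s₂, hs₂⟩ : ∃ s₂, s₂ = searchCmd.run s₁ := ⟨_, rfl⟩
    have fr₂ : Frame _ s₁ s₂ := hs₂ ▸ Cmd.frame _ s₁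
    rw [← hs₂] at he₁
    have k5 : s₂.var 5 = s.var 5 := (fr₂.1 5 rfl).trans (by simp [hs₁, State.setVar, g5])
    have k15 : s₂.var 15 = i := (fr₂.1 15 rfl).trans (by simp [hs₁, State.setVar])
    have n8 : s₂.arr 8 = s'.arr 8 := (fr₂.2 8 rfl).trans (by simp [hs₁, State.setVar])
    have hcl : clamp (s.var 5) (e : ℤ) = e := clamp_eq (by
      rw [abs_of_nonneg (by positivity)]
      refine lt_of_le_of_lt ?_ hXQ
      exact_mod_cast he₂.2.1.trans (hcX (i + 1) (by omega)))
    refine ⟨Function.update d (i + 1) e, fun l hl hl' => ?_, fun l hl => ?_⟩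
    · rcases eq_or_ne l i with rfl | h
      · rw [Function.update_self]; exact he₂
      · rw [Function.update_of_ne (by omega)]
        exact hd₁ l hl (by omega)
    · change ((Cmd.put 8 (v 15 + 1) (v 23)).run (searchCmd.run ((Cmd.set 15 _).run s'))).arr 8 l = _
      rw [r₁, ← hs₂]
      rcases eq_or_ne l (i + 1) with rfl | h
      · rw [if_pos (by omega)]
        simp [Cmd.run, State.setArr, k15, k5, he₁, hcl]
      · have h' : (l : ℤ) ≠ i + 1 := by omega
        rw [Function.update_of_ne h]
        simp only [Cmd.run, State.setArr, Expr.eval_add, Expr.eval_var, Expr.eval_one, k15,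
          Function.update_self, Function.update_of_ne h', n8]
        rw [hd₂ l hl]
        split_ifs <;> first | rfl | omega)
  obtain ⟨d, hd₁, hd₂⟩ := main
  refine ⟨fun i => if i ≤ n ∧ n < i + n then d i else c i, fun i hi => ?_, ?_, ?_, fun i hi => ?_⟩
  · dsimp only
    rw [if_pos (by omega)]
    exact hd₁ i hi (by omega)
  · simp
  · simp
  · exact hd₂ i hi

/-- Descending induction on the order of the difference, starting at order `n`, where it is zero. On
a cell where the sign of one difference is constant, the difference of the next lower order is
monotone. Each pass moves at most one more breakpoint away from `X`, which is why `n + 1` cells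
suffice. -/
theorem run_separate {s : State} {L n : ℕ} {a : ℕ → ℤ} {X : ℕ} {A : ℤ}
    (h2 : s.var 2 = L) (h3 : s.var 3 = n) (h7' : s.var 7 = X) (hn : 1 ≤ n)
    (h7 : ∀ i < 2 * n, s.arr 7 i = a i) (ha0 : ∀ i, n ≤ i → a i = 0)
    (ha : ∀ i, |a i| ≤ A) (hA : 1 ≤ A) (hX : 1 ≤ X) (hXL : X < 2 ^ L)
    (hQ : n * (X ^ n * A) < s.var 5) :
    ∃ c : ℕ → ℕ, (∀ i ≤ n + 1, (separateCmd.run s).arr 8 i = c i) ∧ c 0 = 0 ∧ c (n + 1) = X ∧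
      Separates (n + 1) c (eval n a 0) := by
  have hn1 : (1 : ℤ) ≤ n := by exact_mod_cast hn
  have hX1 : (1 : ℤ) ≤ X := by exact_mod_cast hX
  have hXn : (X : ℤ) ≤ X ^ n := le_self_pow₀ hX1 (by omega)
  have hXn1 : (1 : ℤ) ≤ X ^ n := one_le_pow₀ hX1
  have hnQ : n < s.var 5 := by
    refine lt_of_le_of_lt ?_ hQ
    have : (1 : ℤ) ≤ X ^ n * A := by nlinarith
    nlinarith
  have hXQ : X < s.var 5 := by
    refine lt_of_le_of_lt (hXn.trans ?_) hQ
    nlinarith [mul_le_mul hn1 hA zero_le_one (by linarith)]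
  have c0 : clamp (s.var 5) 0 = 0 := clamp_eq (by simp; linarith)
  have cX : clamp (s.var 5) X = X := clamp_eq (by rw [abs_of_nonneg (by positivity)]; exact hXQ)
  obtain ⟨s₁, hs₁⟩ : ∃ s₁, s₁ = s.setArr 8 0 0 := ⟨_, rfl⟩
  have r₁ : (Cmd.put 8 0 0).run s = s₁ := by simp [Cmd.run, c0, hs₁]
  have c₂ := run_for_put (x := 10) (b := 3) (a := 8) (s := s₁) (n := n)
    (idx := v 10 + 1) (e := v 7) 1 (fun _ => X) (by simp [hs₁, State.setArr, h3])
    (by norm_num) (fun j hj => by simp [fillState, add_comm])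
    (fun j hj => by simp [fillState, hs₁, State.setArr, h7'])
    (fun j hj => by
      rw [abs_of_nonneg (by positivity)]
      simpa [hs₁, State.setArr] using hXQ)
  obtain ⟨s₂, hs₂⟩ : ∃ s₂, s₂ = fillState s₁ 10 8 1 (fun _ => (X : ℤ)) n := ⟨_, rfl⟩
  rw [← hs₂] at c₂
  obtain ⟨s₃, hs₃⟩ : ∃ s₃, s₃ = s₂.setArr 8 (n + 1) X := ⟨_, rfl⟩
  have r₃ : (Cmd.put 8 (v 3 + 1) (v 7)).run s₂ = s₃ := by
    simp [Cmd.run, hs₃, hs₂, hs₁, State.setArr, fillState, h3, h7', cX]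
  have e8 : ∀ i ≤ n + 1, s₃.arr 8 i = ((if i = 0 then 0 else X : ℕ) : ℤ) := fun i hi => by
    rcases Nat.eq_zero_or_pos i with rfl | h
    · have := block_of_lt (f := s₁.arr 8) (base := 1) (z := 0) (by norm_num) n (fun _ => (X : ℤ))
      have h' : (0 : ℤ) ≠ n + 1 := by omega
      simp only [hs₃, hs₂, fillState, State.setArr, Function.update_self, Nat.cast_zero,
        Function.update_of_ne h', this]
      simp [hs₁, State.setArr]
    · rcases eq_or_ne i (n + 1) with rfl | h'
      · simp [hs₃, State.setArr]
      · have := block_apply (f := s₁.arr 8) (base := 1) (by omega : i - 1 < n) (fun _ => (X : ℤ))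
        rw [show 1 + ((i - 1 : ℕ) : ℤ) = i by omega] at this
        have h' : (i : ℤ) ≠ n + 1 := by omega
        simp only [hs₃, hs₂, fillState, State.setArr, Function.update_self,
          Function.update_of_ne h', this, if_neg h.ne']
  have e : ∀ y, y ≠ 10 → s₃.var y = s.var y := fun y hy => by
    simp [hs₃, hs₂, hs₁, State.setArr, fillState, hy]
  have main := run_for (x := 10) (b := 3) (n := n) (s := s₃)
    (c := .set 18 (v 3 - 1 - v 10) ;;
      .rep 19 3 (.set 15 (v 3 - 1 - v 19) ;; searchCmd ;; .put 8 (v 15 + 1) (v 23)))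
    (fun k s' => ∃ c : ℕ → ℕ, (∀ i ≤ n + 1, s'.arr 8 i = c i) ∧ c 0 = 0 ∧
      (∀ i, k < i → i ≤ n + 1 → c i = X) ∧ (∀ i ≤ n, c i ≤ c (i + 1)) ∧
      Separates (n + 1) c (eval n a (n - k))) (by rw [e 3 (by norm_num), h3])
    ⟨fun i => if i = 0 then 0 else X, e8, rfl, fun i hi hi' => if_neg (by omega), fun i hi => by
      dsimp only; rw [if_neg i.succ_ne_zero]; split_ifs <;> simp, fun i hi x _ _ => by simp [eval_of_le ha0 le_rfl]⟩ (by
    rintro k hk s' fr h10 ⟨c, h8, hc0, hcX, hc, hsep⟩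
    have g5 : s'.var 5 = s.var 5 := (fr.1 5 rfl).trans (e 5 (by norm_num))
    have g3 : s'.var 3 = n := (fr.1 3 rfl).trans ((e 3 (by norm_num)).trans h3)
    obtain ⟨s₄, hs₄⟩ : ∃ s₄, s₄ = s'.setVar 18 (n - 1 - k : ℕ) := ⟨_, rfl⟩
    have r₄ : (Cmd.set 18 (v 3 - 1 - v 10)).run s' = s₄ := by
      have e : (n : ℤ) - 1 - k = (n - 1 - k : ℕ) := by omega
      have : clamp (s.var 5) ((n - 1 - k : ℕ) : ℤ) = (n - 1 - k : ℕ) := clamp_eq (by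
        rw [abs_of_nonneg (by positivity)]; omega)
      simp only [Cmd.run, Expr.eval_sub, Expr.eval_var, Expr.eval_one, g3, h10, g5, e, this, hs₄]
    have hmono : ∀ i ≤ n + 1, c i ≤ X := by
      intro i hi
      rw [← hcX (n + 1) (by omega) le_rfl]
      refine Nat.decreasingInduction' (P := fun i => c i ≤ c (n + 1)) (fun l hl _ ih => ?_) hi le_rfl
      exact (hc l (by omega)).trans ih
    rw [show n - k = n - 1 - k + 1 by omega] at hsep
    obtain ⟨d, hd, hd0, hdn, hd8⟩ := run_level (s := s₄) (L := L) (n := n) (j := n - 1 - k) (a := a)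
      (c := c) (X := X) (A := A) (by
        simp [hs₄, State.setVar, fr.1 2 rfl, e 2 (by norm_num), h2])
      (by simp [hs₄, State.setVar, g3]) (by simp [hs₄, State.setVar]) (by omega)
      (fun i hi => by
        have : s₃.arr 7 = s.arr 7 := by simp [hs₃, hs₂, hs₁, State.setArr, fillState]
        simp [hs₄, State.setVar, fr.2 7 rfl, this, h7 i hi])
      ha0 ha hA hX hXL (by simpa [hs₄, State.setVar, g5] using hQ)
      (fun i hi => by simp [hs₄, State.setVar, h8 i hi]) hc hmono hsep
    refine ⟨d, fun i hi => ?_, hd0.trans hc0, fun i hi hi' => ?_, fun i hi => ?_, ?_⟩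
    · rw [← hd8 i hi, ← r₄]; rfl
    · rcases eq_or_ne i (n + 1) with rfl | h
      · rw [hdn, hcX _ (by omega) le_rfl]
      · obtain ⟨l, rfl⟩ : ∃ l, i = l + 1 := ⟨i - 1, by omega⟩
        obtain ⟨h₁, h₂, -⟩ := hd l (by omega)
        rw [hcX l (by omega) (by omega)] at h₁
        rw [hcX (l + 1) (by omega) (by omega)] at h₂
        omega
    · have h₁ : d i ≤ c i := by
        rcases i with _ | i
        · exact hd0.le
        · exact (hd i (by omega)).2.1
      refine h₁.trans ?_
      rcases eq_or_ne i n with rfl | h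
      · rw [hdn]; exact hc i le_rfl
      · exact (hd i (by omega)).1
    · rw [show n - (k + 1) = n - 1 - k by omega]
      refine separates_of_isCut hd0 fun i hi => ?_
      rcases eq_or_ne i n with rfl | h
      -- The last cell is not searched, but before this pass it is empty, both its ends being `X`.
      · have h₁ : c i = c (i + 1) := by
          rw [hcX i hk (by omega), hcX (i + 1) (by omega) le_rfl]
        rw [hdn, ← h₁]
        refine ⟨le_rfl, le_rfl, fun x hx hx' => by omega, fun x hx hx' => ?_⟩
        rw [le_antisymm hx' hx]
      · exact hd i (by omega))
  obtain ⟨c, h8, hc0, hcX, -, hsep⟩ := main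
  refine ⟨c, fun i hi => ?_, hc0, hcX _ (by omega) le_rfl, by simpa using hsep⟩
  rw [← h8 i hi, ← r₃, ← c₂, ← r₁]
  rfl

end LogCost

/-! ### Testing candidates, and the choice of the interval length. -/

namespace LogCost

/-- A tested value passes through two assignments before it arrives in variable `6`. -/
theorem clamp_clamp (Q z : ℤ) : clamp Q (clamp Q z) = clamp Q z := by
  simp [clamp]

/-- `d` is zero, or a divisor of `N` below the square root of `N`. -/
def Candidate (N d : ℤ) : Prop := 0 ≤ d ∧ (d = 0 ∨ d ∣ N ∧ d * d < N)

/-- The command does nothing to variable `6` but replace a candidate by a larger one. -/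
def Cmd.Improves (c : Cmd) : Prop :=
  ∀ s : State, Candidate (s.var 0) (s.var 6) →
    Candidate (s.var 0) ((c.run s).var 6) ∧ s.var 6 ≤ (c.run s).var 6

theorem Cmd.improves_of_writes {c : Cmd} (h : c.writes 6 = false) : c.Improves := fun s hs => by
  rw [c.run_var h]; exact ⟨hs, le_rfl⟩

theorem Cmd.Improves.seq {c₁ c₂ : Cmd} (h₁ : c₁.Improves) (h₂ : c₂.Improves)
    (h : c₁.writes 0 = false) : (c₁ ;; c₂).Improves := fun s hs => by
  have e : (c₁.run s).var 0 = s.var 0 := c₁.run_var h s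
  have i₁ := h₁ s hs
  have i₂ := h₂ (c₁.run s) (by rw [e]; exact i₁.1)
  rw [e] at i₂
  exact ⟨i₂.1, i₁.2.trans i₂.2⟩

/-- One successful round suffices, because later rounds never decrease variable `6`. -/
theorem Cmd.Improves.rep_of_hit {x b : ℕ} {c : Cmd} (hc : c.Improves) (hx : x ≠ 6)
    (h : (Cmd.rep x b c).writes 0 = false) {s : State} {n k₀ : ℕ} (hn : s.var b = n) {m : ℤ}
    (hk₀ : k₀ < n) (hs : Candidate (s.var 0) (s.var 6))
    (hit : ∀ s', Frame (.rep x b c) s s' → s'.var x = k₀ → Candidate (s'.var 0) (s'.var 6) →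
      m ≤ (c.run s').var 6) : m ≤ ((Cmd.rep x b c).run s).var 6 := by
  have hx' : 6 ≠ x := hx.symm
  have h0x : 0 ≠ x := by rintro rfl; simp [Cmd.writes] at h
  have main := run_for (x := x) (b := b) (n := n) (s := s) (c := c)
    (fun k s' => Candidate (s.var 0) (s'.var 6) ∧ (k₀ < k → m ≤ s'.var 6)) hn
    ⟨by simpa [State.setVar, hx'] using hs, fun h => absurd h (by omega)⟩ (by
    rintro k hk s' fr hkx ⟨ih₁, ih₂⟩
    have e : s'.var 0 = s.var 0 := fr.1 0 h
    have i := hc s' (by rw [e]; exact ih₁)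
    rw [e] at i
    simp only [State.setVar, Function.update_of_ne hx']
    refine ⟨i.1, fun hk' => ?_⟩
    rcases eq_or_ne k k₀ with rfl | hne
    · exact hit s' fr hkx (by rw [e]; exact ih₁)
    · exact (ih₂ (by omega)).trans i.2)
  exact main.2 hk₀

theorem Cmd.Improves.rep {x b : ℕ} {c : Cmd} (hc : c.Improves) (hx : x ≠ 6)
    (h : (Cmd.rep x b c).writes 0 = false) : (Cmd.rep x b c).Improves := fun s hs => by
  have hx' : 6 ≠ x := hx.symm
  suffices ∀ n, Candidate (s.var 0) ((forIter x c.run n s).var 6) ∧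
      s.var 6 ≤ (forIter x c.run n s).var 6 from this _
  intro n
  induction n with
  | zero => exact ⟨by simpa [forIter, State.setVar, hx'] using hs, by
      simp [forIter, State.setVar, hx']⟩
  | succ n ih =>
    have e : (forIter x c.run n s).var 0 = s.var 0 := (forIter_frame x b c s n).1 0 h
    have i := hc _ (by rw [e]; exact ih.1)
    rw [e] at i
    simp only [forIter, State.setVar, Function.update_of_ne hx']
    exact ⟨i.1, ih.2.trans i.2⟩

theorem improves_testCmd (e : Expr) : (testCmd e).Improves := fun s hs => by
  have hcl := clamp_clamp (s.var 5) (e.eval s)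
  obtain ⟨w, hw⟩ : ∃ w, w = clamp (s.var 5) (e.eval s) := ⟨_, rfl⟩
  rw [← hw] at hcl
  simp only [testCmd, Cmd.run, ← hw]
  by_cases h₁ : s.var 6 < w
  · by_cases h₂ : w ∣ s.var 0
    · by_cases h₃ : w * w < s.var 0
      · simpa [State.setVar, h₁, h₂, h₃, hcl] using
          ⟨⟨by linarith [hs.1], Or.inr ⟨h₂, h₃⟩⟩, h₁.le⟩
      · simpa [State.setVar, h₁, h₂, h₃] using hs
    · simpa [State.setVar, h₁, h₂] using hs
  · simpa [State.setVar, h₁] using hs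

theorem le_run_testCmd {e : Expr} {s : State} {m : ℤ} (he : e.eval s = m) (hm : 1 ≤ m)
    (hdvd : m ∣ s.var 0) (hlt : m * m < s.var 0) (hQ : m < s.var 5) :
    m ≤ ((testCmd e).run s).var 6 := by
  have hcl : clamp (s.var 5) m = m := clamp_eq (by rw [abs_of_nonneg (by linarith)]; exact hQ)
  have h₂ : s.var 0 % m = 0 := Int.emod_eq_zero_of_dvd hdvd
  have h₃ : m * m + 1 ≤ s.var 0 := hlt
  simp only [testCmd, Cmd.run, he, hcl]
  by_cases h₁ : s.var 6 + 1 ≤ m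
  · simp [State.setVar, h₁, h₂, h₃, hcl]
  · simp [State.setVar, h₁]
    omega

theorem improves_candidatesCmd : candidatesCmd.Improves :=
  ((improves_testCmd _).rep (by norm_num) rfl).rep (by norm_num) rfl

theorem le_run_candidatesCmd {s : State} {T L i j : ℕ} {m : ℤ} (h4 : s.var 4 = T)
    (h2 : s.var 2 = L) (hi : i < T) (hj : j < L) (he : s.var 9 + s.arr 8 i + j = m) (hm : 1 ≤ m)
    (hdvd : m ∣ s.var 0) (hlt : m * m < s.var 0) (hQ : m < s.var 5)
    (hs : Candidate (s.var 0) (s.var 6)) : m ≤ (candidatesCmd.run s).var 6 := by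
  refine ((improves_testCmd _).rep (by norm_num) rfl).rep_of_hit (by norm_num) rfl h4 hi hs
    fun s' fr h10 hs' => ?_
  refine (improves_testCmd _).rep_of_hit (by norm_num) rfl ((fr.1 2 rfl).trans h2) hj hs'
    fun s'' fr' h11 hs'' => ?_
  have e0 : s''.var 0 = s.var 0 := (fr'.1 0 rfl).trans (fr.1 0 rfl)
  have e5 : s''.var 5 = s.var 5 := (fr'.1 5 rfl).trans (fr.1 5 rfl)
  have e9 : s''.var 9 = s.var 9 := (fr'.1 9 rfl).trans (fr.1 9 rfl)
  have e10 : s''.var 10 = i := (fr'.1 10 rfl).trans h10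
  have e8 : s''.arr 8 = s.arr 8 := (fr'.2 8 rfl).trans (fr.2 8 rfl)
  exact le_run_testCmd (by simp [e9, e10, e8, h11, he]) hm (by rwa [e0]) (by rwa [e0]) (by rwa [e5])

/-- Nothing is assumed about the lattice. Intervals that do not contain the cofactor may produce
meaningless candidates, yet they cannot spoil the result. -/
theorem improves_intervalCmd : intervalCmd.Improves := by
  refine (Cmd.improves_of_writes rfl).seq ?_ rfl
  refine (Cmd.improves_of_writes rfl).seq ?_ rfl
  refine (Cmd.improves_of_writes rfl).seq ?_ rfl
  refine (Cmd.improves_of_writes rfl).seq ?_ rfl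
  exact (Cmd.improves_of_writes rfl).seq improves_candidatesCmd rfl

/-- `X` is doubled while `256 * X ^ 2 ≤ N`, that is, while `64 * (2 * X) ^ 2 ≤ N`. If this never
stopped, `X` would be `2 ^ L > N` at the end. -/
theorem run_length {s : State} {L N : ℕ} (h2 : s.var 2 = L) (h0 : s.var 0 = N) (hN : 64 ≤ N)
    (hNL : N < 2 ^ L) (hQ : N < s.var 5) :
    ∃ X : ℕ, (lengthCmd.run s).var 7 = X ∧ 1 ≤ X ∧ 64 * X ^ 2 ≤ N ∧ N < 256 * X ^ 2 := by
  have hcl : ∀ z : ℕ, z ≤ N → clamp (s.var 5) z = z := fun z hz => clamp_eq (by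
    rw [abs_of_nonneg (by positivity)]; omega)
  have r₁ : (Cmd.set 7 1).run s = s.setVar 7 1 := by
    have := hcl 1 (by omega)
    rw [Nat.cast_one] at this
    simp [Cmd.run, this]
  have main := run_for (x := 10) (b := 2) (n := L) (s := s.setVar 7 1)
    (c := .ite (.le (256 * (v 7 * v 7)) (v 0)) (.set 7 (2 * v 7)) .nop)
    (fun k s' => ∃ X : ℕ, s'.var 7 = X ∧ 1 ≤ X ∧ 64 * X ^ 2 ≤ N ∧ (N < 256 * X ^ 2 ∨ X = 2 ^ k))
    (by simpa [State.setVar] using h2)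
    ⟨1, by simp [State.setVar], le_rfl, by omega, Or.inr rfl⟩ (by
    rintro k hk s' fr - ⟨X, h7, h₁, h₂, h₃⟩
    have g5 : s'.var 5 = s.var 5 := (fr.1 5 rfl).trans (by simp [State.setVar])
    have g0 : s'.var 0 = N := (fr.1 0 rfl).trans (by simpa [State.setVar] using h0)
    have htest : (Expr.le (256 * (v 7 * v 7)) (v 0)).eval s' ≠ 0 ↔ 256 * X ^ 2 ≤ N := by
      have : 256 * ((X : ℤ) * X) ≤ N ↔ 256 * X ^ 2 ≤ N := by
        rw [sq]; exact_mod_cast Iff.rfl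
      simp [h7, g0, this]
    by_cases h : 256 * X ^ 2 ≤ N
    · refine ⟨2 * X, ?_, by omega, by nlinarith, Or.inr ?_⟩
      · have := hcl (2 * X) (by nlinarith)
        push_cast at this
        rw [Cmd.run, if_pos (htest.2 h)]
        simp [Cmd.run, State.setVar, h7, g5, this]
      · rw [h₃.resolve_left (by omega), pow_succ']
    · refine ⟨X, ?_, h₁, h₂, Or.inl (by omega)⟩
      rw [Cmd.run, if_neg (mt htest.1 h)]
      simp [Cmd.run, State.setVar, h7])
  obtain ⟨X, h7, h₁, h₂, h₃⟩ := main
  refine ⟨X, ?_, h₁, h₂, h₃.resolve_right fun h => ?_⟩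
  · rw [← h7, ← r₁]; rfl
  · subst h
    have : 1 ≤ 2 ^ L := Nat.one_le_two_pow
    nlinarith

end LogCost

/-! ### Integer roots of the polynomial, and estimates for the parameters. -/

namespace LogCost

open NewtonSeries HowgraveGraham LatticeReduction Polynomial

/-- Squaring makes the function nonnegative, so its zeros are exactly the points where it is not
positive, and roots without a change of sign are not missed. A run of zeros has at most `L - 1`
members, so a root is less than `L` steps from a breakpoint. -/
theorem run_roots {s : State} {L X y : ℕ} {h : ℕ → ℤ} {H : ℤ} (h2 : s.var 2 = L)
    (h3 : s.var 3 = 2 * L) (h7 : s.var 7 = X) (h5 : ∀ j < L, s.arr 5 j = h j)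
    (hh : ∀ j < L, |h j| ≤ H) (hH : 1 ≤ H) (hne : ∃ j < L, h j ≠ 0)
    (hy : ∑ j ∈ Finset.range L, h j * (y : ℤ) ^ j = 0) (hyX : y < X) (hXL : X < 2 ^ L)
    (hQ : 2 * L * (X ^ (2 * L) * (2 ^ (2 * L) * (L * (H * (2 * L) ^ L)) ^ 2)) < s.var 5) :
    ∃ i ≤ 2 * L, ∃ j < L, (separateCmd.run (newtonCmd.run s)).arr 8 i + j = y := by
  obtain ⟨j₀, hj₀, hne⟩ := hne
  have hL0 : 1 ≤ L := by omega
  have hL1 : (1 : ℤ) ≤ L := by exact_mod_cast hL0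
  have hX1 : (1 : ℤ) ≤ X := by exact_mod_cast (by omega : 1 ≤ X)
  obtain ⟨A, hAdef⟩ : ∃ A : ℤ, A = 2 ^ (2 * L) * (L * (H * (2 * L) ^ L)) ^ 2 := ⟨_, rfl⟩
  have hA1 : 1 ≤ A := by
    have h₁ : (1 : ℤ) ≤ (2 * L) ^ L := one_le_pow₀ (by linarith)
    have h₂ : (1 : ℤ) ≤ H * (2 * L) ^ L := one_le_mul_of_one_le_of_one_le hH h₁
    have h₃ : (1 : ℤ) ≤ (L * (H * (2 * L) ^ L)) ^ 2 :=
      one_le_pow₀ (one_le_mul_of_one_le_of_one_le hL1 h₂)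
    rw [hAdef]
    exact one_le_mul_of_one_le_of_one_le (one_le_pow₀ (by norm_num)) h₃
  rw [← hAdef] at hQ
  have hAQ : A < s.var 5 := by
    refine lt_of_le_of_lt ?_ hQ
    have h₁ : (1 : ℤ) ≤ 2 * L * X ^ (2 * L) :=
      one_le_mul_of_one_le_of_one_le (by linarith) (one_le_pow₀ hX1)
    nlinarith
  obtain ⟨n₁, n₂, n₃⟩ := run_newton hL0 h2 h3 h5 hh hH (by rw [← hAdef]; exact hAQ)
  rw [← hAdef] at n₂
  obtain ⟨s₁, hs₁⟩ : ∃ s₁, s₁ = newtonCmd.run s := ⟨_, rfl⟩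
  have fr : Frame newtonCmd s s₁ := hs₁ ▸ Cmd.frame _ _
  rw [← hs₁] at n₁ n₂ n₃ ⊢
  set P : ℤ[X] := ∑ j ∈ Finset.range L, C (h j) * Polynomial.X ^ j with hP
  have hPe : ∀ x, P.eval x = ∑ j ∈ Finset.range L, h j * x ^ j := fun x => by
    simp [hP, eval_finsetSum]
  have hPc : P.coeff j₀ = h j₀ := by
    simp [hP, coeff_X_pow, hj₀]
  have hP0 : P ≠ 0 := fun h0 => hne (by rw [← hPc, h0, coeff_zero])
  have hPd : P.natDegree ≤ L - 1 := natDegree_sum_le_of_forall_le _ _ fun j hj =>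
    (natDegree_C_mul_X_pow_le _ _).trans (by have := Finset.mem_range.1 hj; omega)
  have hP2 : (P ^ 2).natDegree < 2 * L := by
    have := natDegree_pow_le (p := P) (n := 2)
    omega
  set f : ℤ → ℤ := fun x => (∑ j ∈ Finset.range L, h j * x ^ j) ^ 2 with hf
  have hfP : ∀ x, f x = (P ^ 2).eval x := fun x => by rw [eval_pow, hPe]
  set a : ℕ → ℤ := fun i => (fwdDiff (1 : ℤ))^[i] f 0 with ha
  have ha0 : ∀ i, 2 * L ≤ i → a i = 0 := fun i hi => by
    have : f = (P ^ 2).eval := funext hfP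
    rw [ha]
    dsimp only
    rw [this, fwdDiff_iter_eq_zero_of_degree_lt (by omega)]
    rfl
  have haA : ∀ i, |a i| ≤ A := fun i => by
    rcases Nat.lt_or_ge i (2 * L) with hi | hi
    · rw [ha]; dsimp only; rw [← n₁ i hi]; exact n₂ i hi
    · rw [ha0 i hi, abs_zero]; linarith
  obtain ⟨c, h8, hc0, hcn, hsep⟩ := run_separate (s := s₁) (L := L) (n := 2 * L) (a := a) (X := X)
    (A := A) ((fr.1 2 rfl).trans h2) ((fr.1 3 rfl).trans (by rw [h3]; push_cast; rfl))
    ((fr.1 7 rfl).trans h7) (by omega) (fun i hi => by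
      rcases Nat.lt_or_ge i (2 * L) with hi' | hi'
      · exact n₁ i hi'
      · rw [ha0 i hi', n₃ i hi' hi]) ha0 haA hA1 (by omega) hXL (by
      rw [fr.1 5 rfl]; push_cast; exact hQ)
  have hev : ∀ x : ℕ, eval (2 * L) a 0 x = (P ^ 2).eval (x : ℤ) := fun x =>
    eval_zero_fwdDiff (P ^ 2) hfP hP2 x
  obtain ⟨i, hi, hciy, hzero⟩ := hsep.exists_cell (y := y) (by omega) (by omega)
    (by rw [hev, eval_pow, hPe, hy]; rfl) (fun x => by rw [hev, eval_pow]; positivity)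
  have hcard := card_zeros_le hP0 (x := c i) (y := y) fun z hz hz' => by
    have := hzero z hz hz'
    rw [hev, eval_pow] at this
    exact pow_eq_zero_iff (two_ne_zero) |>.1 this
  refine ⟨i, by omega, y - c i, by omega, ?_⟩
  rw [h8 i (by omega)]
  omega

theorem norm_row_le {L k : ℕ} {A : ℤ → ℤ} {R : ℝ} (hk : k < L) (hR : 0 ≤ R)
    (h : ∀ j < L, |(A (k * L + j) : ℝ)| ≤ R) : ‖row L A k‖ ≤ L * R := by
  have hL : (1 : ℝ) ≤ L := by exact_mod_cast (by omega : 1 ≤ L)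
  refine le_of_sq_le_sq ?_ (by positivity)
  rw [norm_sq_row A hk]
  calc ∑ j ∈ Finset.range L, (A (k * L + j) : ℝ) ^ 2 ≤ ∑ _j ∈ Finset.range L, R ^ 2 := by
        refine Finset.sum_le_sum fun j hj => ?_
        rw [← sq_abs]
        exact pow_le_pow_left₀ (abs_nonneg _) (h j (Finset.mem_range.1 hj)) 2
    _ = L * R ^ 2 := by simp
    _ ≤ (L * R) ^ 2 := by
        have : 0 ≤ R ^ 2 := by positivity
        nlinarith

/-- The modulus of the clamped arithmetic is large enough for lattice basis reduction. -/
theorem reduction_bound_lt {L : ℕ} (hL : 100 ≤ L) :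
    (3 * (L : ℝ) * (L * 2 ^ (3 * L ^ 2)) ^ (2 * L + 2)) ^ (L + 1) < 2 ^ L ^ 8 := by
  have hL2 : (L : ℝ) ≤ 2 ^ L := by exact_mod_cast L.lt_two_pow_self.le
  have h₁ : (L : ℝ) * 2 ^ (3 * L ^ 2) ≤ 2 ^ (4 * L ^ 2) := by
    calc (L : ℝ) * 2 ^ (3 * L ^ 2) ≤ 2 ^ L * 2 ^ (3 * L ^ 2) := by gcongr
      _ = 2 ^ (L + 3 * L ^ 2) := by rw [pow_add]
      _ ≤ _ := pow_le_pow_right₀ one_le_two (by nlinarith)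
  have h₂ : 3 * (L : ℝ) ≤ 2 ^ (2 * L) := by
    calc 3 * (L : ℝ) ≤ 2 ^ 2 * 2 ^ L := by gcongr; norm_num
      _ = 2 ^ (2 + L) := by rw [pow_add]
      _ ≤ _ := pow_le_pow_right₀ one_le_two (by omega)
  calc (3 * (L : ℝ) * (L * 2 ^ (3 * L ^ 2)) ^ (2 * L + 2)) ^ (L + 1)
      ≤ (2 ^ (2 * L) * (2 ^ (4 * L ^ 2)) ^ (2 * L + 2)) ^ (L + 1) := by gcongr
    _ = 2 ^ ((2 * L + 4 * L ^ 2 * (2 * L + 2)) * (L + 1)) := by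
        rw [← pow_mul, ← pow_add, ← pow_mul]
    _ < 2 ^ L ^ 8 := pow_lt_pow_right₀ one_lt_two ?_
  have h₃ : (2 * L + 4 * L ^ 2 * (2 * L + 2)) * (L + 1) ≤ (L ^ 3 + L ^ 3 * 9) * (2 * L) := by
    have h₅ : L ≤ L ^ 2 := Nat.le_self_pow (by norm_num) _
    have h₆ : 4 * L ^ 2 * (2 * L + 2) ≤ L ^ 3 * 9 := by nlinarith
    have h₇ : 2 * L ≤ L ^ 3 := by nlinarith
    exact Nat.mul_le_mul (by omega) (by omega)
  have h₄ : 100 ^ 4 ≤ L ^ 4 := Nat.pow_le_pow_left hL 4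
  nlinarith

/-- Three rounds of the reduction outweigh one factor two of the initial potential: `2 * (3 / 4) ^ 3
= 27 / 32`. -/
theorem potential_bound_lt {L : ℕ} (hL : 100 ≤ L) :
    (2 ^ (3 * L ^ 2) : ℝ) ^ (2 * L * L) * (3 / 4) ^ L ^ 8 < 1 := by
  have h₄ : 100 ^ 4 ≤ L ^ 4 := Nat.pow_le_pow_left hL 4
  have h : 3 * (6 * L ^ 4) ≤ L ^ 8 := by nlinarith
  calc (2 ^ (3 * L ^ 2) : ℝ) ^ (2 * L * L) * (3 / 4) ^ L ^ 8
      ≤ 2 ^ (6 * L ^ 4) * (3 / 4) ^ (3 * (6 * L ^ 4)) := by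
        rw [← pow_mul, show 3 * L ^ 2 * (2 * L * L) = 6 * L ^ 4 by ring]
        exact mul_le_mul_of_nonneg_left (pow_le_pow_of_le_one (by norm_num) (by norm_num) h)
          (by positivity)
    _ = (27 / 32) ^ (6 * L ^ 4) := by
        rw [pow_mul (3 / 4 : ℝ), ← mul_pow]; norm_num
    _ < 1 := pow_lt_one₀ (by norm_num) (by norm_num) (by omega)

/-- The modulus of the clamped arithmetic is large enough for root separation. -/
theorem roots_bound_lt {L X : ℕ} (hL : 100 ≤ L) (hX : X ≤ 2 ^ L) :
    2 * (L : ℤ) * (X ^ (2 * L) * (2 ^ (2 * L) *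
      (L * (L * 2 ^ (3 * L ^ 2) * (2 * L) ^ L)) ^ 2)) < 2 ^ L ^ 8 := by
  have hL2 : (L : ℤ) ≤ 2 ^ L := by exact_mod_cast L.lt_two_pow_self.le
  have hX' : (X : ℤ) ≤ 2 ^ L := by exact_mod_cast hX
  have h₂ : 2 * (L : ℤ) ≤ 2 ^ (L + 1) := by rw [pow_succ]; linarith
  calc 2 * (L : ℤ) * (X ^ (2 * L) * (2 ^ (2 * L) *
        (L * (L * 2 ^ (3 * L ^ 2) * (2 * L) ^ L)) ^ 2))
      ≤ 2 ^ (L + 1) * ((2 ^ L) ^ (2 * L) * (2 ^ (2 * L) *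
        (2 ^ L * (2 ^ L * 2 ^ (3 * L ^ 2) * (2 ^ (L + 1)) ^ L)) ^ 2)) := by gcongr
    _ = 2 ^ (L + 1 + (L * (2 * L) + (2 * L + (L + (L + 3 * L ^ 2 + (L + 1) * L)) * 2))) := by
        simp only [← pow_mul, ← pow_add]
    _ < 2 ^ L ^ 8 := pow_lt_pow_right₀ one_lt_two ?_
  have h₄ : 100 ^ 6 ≤ L ^ 6 := Nat.pow_le_pow_left hL 6
  nlinarith

end LogCost

/-! ### The search in one interval. -/

namespace LogCost

open HowgraveGraham LatticeReduction

/-- The basis is triangular, so its determinant is explicit. `SiegelReduced.norm_pow_le` and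
`parameters_lt` make the first reduced vector short enough for `sum_eq_zero_of_vanishing` with `D =
(P₀ - y) ^ t`. -/
theorem run_shortVector {s : State} {N L t : ℕ} {K P₀ X y : ℤ} (hLt : L = 2 * t) (ht : 50 ≤ t)
    (h2 : s.var 2 = L) (h4 : s.var 4 = (L ^ 8 : ℕ)) (h5 : s.var 5 = 2 ^ L ^ 8)
    (hP : s.var 0 - s.var 9 = P₀) (h7 : s.var 7 = X) (h17 : s.var 17 = K) (hK : 1 ≤ K)
    (hKN : K ≤ N ^ 2) (hNt : N < 2 ^ t) (hP0 : 1 ≤ P₀) (hPN : P₀ ≤ N) (hX : 1 ≤ X)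
    (hXN : 64 * X ^ 2 ≤ N) (hy : 0 ≤ y) (hyX : y ≤ X) (hPy : N ≤ 2 * (P₀ - y))
    (hdvd : P₀ - y ∣ K) :
    ∃ h : ℕ → ℤ, (∀ j < L, (reductionCmd.run (latticeCmd.run s)).arr 0 j = h j * X ^ j) ∧
      (∀ j < L, |h j| ≤ L * 2 ^ (3 * L ^ 2)) ∧ (∃ j < L, h j ≠ 0) ∧
      ∑ j ∈ Finset.range L, h j * y ^ j = 0 := by
  have hL : 100 ≤ L := by omega
  have hL1 : (1 : ℝ) ≤ L := by exact_mod_cast (by omega : 1 ≤ L)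
  have hNt' : (N : ℤ) < 2 ^ t := by exact_mod_cast hNt
  have hXN' : X ≤ N := by nlinarith
  have hKL : K ≤ 2 ^ L := by
    calc K ≤ (N : ℤ) ^ 2 := hKN
      _ ≤ (2 ^ t) ^ 2 := by gcongr
      _ = 2 ^ L := by rw [← pow_mul, hLt, mul_comm]
  have hPX : P₀ + X ≤ 2 ^ L := by
    calc P₀ + X ≤ 2 * 2 ^ t := by linarith
      _ = 2 ^ (t + 1) := by rw [pow_succ, mul_comm]
      _ ≤ _ := pow_le_pow_right₀ one_le_two (by omega)
  -- Bounds all entries of the basis, and thus gives the value `R = 2 ^ (3 * L ^ 2)` for the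
  -- reduction.
  have hentry : K ^ L * (P₀ + X) ^ (L + 1) ≤ 2 ^ (3 * L ^ 2) := by
    calc K ^ L * (P₀ + X) ^ (L + 1) ≤ (2 ^ L) ^ L * (2 ^ L) ^ (L + 1) := by
          have : 0 ≤ P₀ + X := by linarith
          gcongr
      _ = 2 ^ (L * L + L * (L + 1)) := by simp only [← pow_mul, ← pow_add]
      _ ≤ _ := pow_le_pow_right₀ one_le_two (by nlinarith)
  have h3 : (2 : ℤ) ^ (3 * L ^ 2) < 2 ^ L ^ 8 := pow_lt_pow_right₀ one_lt_two (by
    have h₆ : 100 ^ 6 ≤ L ^ 6 := Nat.pow_le_pow_left hL 6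
    nlinarith)
  have hlat := run_lattice (t := t) h2 (by omega) hP h7 h17 hK hP0 (by linarith)
    (by rw [h5]; exact hentry.trans_lt h3)
  obtain ⟨s₁, hs₁⟩ : ∃ s₁, s₁ = latticeCmd.run s := ⟨_, rfl⟩
  have fr : Frame latticeCmd s s₁ := hs₁ ▸ Cmd.frame _ _
  rw [← hs₁] at hlat ⊢
  have hpK : ∀ i, K ^ (t - i) ≤ K ^ L := fun i => pow_le_pow_right₀ hK (by omega)
  have habs : ∀ i < L, ∀ j < L, |s₁.arr 0 (i * L + j)| ≤ 2 ^ (3 * L ^ 2) := fun i hi j hj => by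
    rw [hlat i hi j hj, abs_mul, abs_of_nonneg (by positivity : 0 ≤ K ^ (t - i))]
    refine le_trans (mul_le_mul (hpK i) ((abs_powCoeff_le (by linarith) (by linarith) i j).trans
      (pow_le_pow_right₀ (by linarith) (by omega))) (abs_nonneg _) (by positivity)) hentry
  have habs' : ∀ i < L, ∀ j < L, |(s₁.arr 0 (i * L + j) : ℝ)| ≤ 2 ^ (3 * L ^ 2) :=
    fun i hi j hj => by exact_mod_cast habs i hi j hj
  have hdiag : ∀ i < L, s₁.arr 0 (i * L + i) = K ^ (t - i) * (-X) ^ i := fun i hi => by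
    rw [hlat i hi i hi, powCoeff_self]
  have hdiag0 : ∀ i < L, s₁.arr 0 (i * L + i) ≠ 0 := fun i hi => by
    rw [hdiag i hi]
    exact mul_ne_zero (pow_ne_zero _ (by linarith)) (pow_ne_zero _ (by linarith))
  have hgs : ∀ i < L, ‖gs (row L (s₁.arr 0)) i‖ = |(s₁.arr 0 (i * L + i) : ℝ)| := fun i hi =>
    gs_eq_of_triangular (fun i hi j hj hij => by
      rw [hlat i hi j hj, powCoeff_of_lt _ _ hij, mul_zero]) hdiag0 hi
  have hdet : gramDet (row L (s₁.arr 0)) L =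
      (K : ℝ) ^ (t * (t + 1)) * (X : ℝ) ^ (2 * t * (2 * t - 1)) := by
    rw [← prod_diag, gramDet, ← hLt]
    refine Finset.prod_congr rfl fun i hi => ?_
    have hi := Finset.mem_range.1 hi
    rw [hgs i hi, hdiag i hi, sq_abs]
    push_cast
    have : (-(X : ℝ)) ^ (i * 2) = (X : ℝ) ^ (i * 2) := Even.neg_pow ⟨i, by ring⟩ _
    rw [mul_pow, mul_pow, ← pow_mul (-(X : ℝ)), this, pow_mul]
  have hclosed : Closed L (Vanishing L X y ((P₀ - y) ^ t)) := fun w u hw hu q z hz =>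
    hw.sub_mul hu q hz
  obtain ⟨hV, hne, hnorm, hshort⟩ := run_reduction (T := L ^ 8) hclosed (by omega)
    (R := 2 ^ (3 * L ^ 2)) (one_le_pow₀ one_le_two) ((fr.1 2 rfl).trans h2) ((fr.1 4 rfl).trans h4)
    (by rw [fr.1 5 rfl, h5]; exact_mod_cast reduction_bound_lt hL)
    (fun j hj => by
      rw [← norm_ne_zero_iff, hgs j hj, abs_ne_zero]
      exact_mod_cast hdiag0 j hj)
    (fun j hj => by rw [hgs j hj]; exact habs' j hj j hj)
    (fun j hj => norm_row_le hj (by positivity) (habs' j hj))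
    (fun l hl => hclosed.congr (vanishing_powCoeff (t := t) hl hdvd) fun j hj => hlat l hl j hj)
    (potential_bound_lt hL)
  rw [hdet] at hshort
  set A := (reductionCmd.run s₁).arr 0 with hA
  obtain ⟨h, hh, hD⟩ := hV
  have hA0 : ∀ j < L, A j = h j * X ^ j := fun j hj => by simpa [rowFn] using hh j hj
  have hX0 : ∀ j, (1 : ℤ) ≤ X ^ j := fun j => one_le_pow₀ hX
  refine ⟨h, hA0, fun j hj => ?_, ?_, ?_⟩
  · have h₁ : |(A ((0 : ℕ) * L + j) : ℝ)| ≤ L * 2 ^ (3 * L ^ 2) :=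
      (abs_coord_le A (by omega) hj).trans hnorm
    rw [Nat.cast_zero, zero_mul, zero_add] at h₁
    have h₂ : |A j| ≤ L * 2 ^ (3 * L ^ 2) := by exact_mod_cast h₁
    refine le_trans ?_ h₂
    rw [hA0 j hj, abs_mul, abs_of_nonneg (by linarith [hX0 j] : 0 ≤ X ^ j)]
    exact le_mul_of_one_le_right (abs_nonneg _) (hX0 j)
  · by_contra! hc
    refine hne (row_ext (by omega) fun j => ?_)
    have := hA0 j j.2
    rw [hc j j.2, zero_mul] at this
    simp [this]
  · refine sum_eq_zero_of_vanishing (X := X) (D := (P₀ - y) ^ t)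
      (by rwa [abs_of_nonneg hy]) hD ?_
    have e : ∑ j ∈ Finset.range L, ((h j * X ^ j : ℤ) : ℝ) ^ 2 = ‖row L A 0‖ ^ 2 := by
      rw [norm_sq_row A (by omega)]
      refine Finset.sum_congr rfl fun j hj => ?_
      rw [← hA0 j (Finset.mem_range.1 hj), Nat.cast_zero, zero_mul, zero_add]
    rw [e]
    have hpar := parameters_lt (N := N) (P := ((P₀ - y : ℤ) : ℝ)) (X := X) (K := K) ht
      (by exact_mod_cast (by linarith : (0 : ℤ) < N)) (by exact_mod_cast hNt)
      (by exact_mod_cast hXN) (by exact_mod_cast (by linarith : 0 ≤ K)) (by exact_mod_cast hKN)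
      (by exact_mod_cast hPy)
    rw [← hLt] at hpar hshort
    calc (L : ℝ) ^ L * (‖row L A 0‖ ^ 2) ^ L ≤ L ^ L * (2 ^ (L * (L - 1) / 2) *
          ((K : ℝ) ^ (t * (t + 1)) * (X : ℝ) ^ (L * (L - 1)))) := by gcongr
      _ < ((P₀ - y : ℤ) : ℝ) ^ (L * L) := hpar
      _ = _ := by
        rw [Int.cast_pow, ← pow_mul]
        congr 1
        rw [hLt]; ring

theorem le_run_intervalCmd {s : State} {N L t m a X : ℕ} {K : ℤ} (hLt : L = 2 * t) (ht : 50 ≤ t)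
    (h0 : s.var 0 = N) (h2 : s.var 2 = L) (h3 : s.var 3 = 2 * L) (h4 : s.var 4 = (L ^ 8 : ℕ))
    (h5 : s.var 5 = 2 ^ L ^ 8) (h7 : s.var 7 = X) (h9 : s.var 9 = a) (h17 : s.var 17 = K)
    (hK : 1 ≤ K) (hKN : K ≤ N ^ 2) (hNt : N < 2 ^ t) (hX : 1 ≤ X) (hXN : 64 * X ^ 2 ≤ N)
    (ham : a ≤ m) (hmX : m < a + X) (hm : 1 ≤ m) (hmN : 2 * m ≤ N) (hdvdK : (N : ℤ) - m ∣ K)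
    (hdvd : m ∣ N) (hlt : m * m < N) (hs : Candidate (s.var 0) (s.var 6)) :
    m ≤ (intervalCmd.run s).var 6 := by
  have hL : 100 ≤ L := by omega
  have hXt : X < 2 ^ L := by
    calc X ≤ N := by nlinarith
      _ < 2 ^ t := hNt
      _ ≤ _ := Nat.pow_le_pow_right two_pos (by omega)
  have e : (N : ℤ) - a - ((m - a : ℕ) : ℤ) = N - m := by omega
  obtain ⟨h, h0', hle, hne, hsum⟩ := run_shortVector (N := N) (t := t) (K := K) (P₀ := N - a) (X := X)
    (y := (m - a : ℕ)) hLt ht h2 h4 h5 (by rw [h0, h9]) h7 h17 hK hKN hNt (by omega) (by omega)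
    (by exact_mod_cast hX) (by exact_mod_cast hXN) (by positivity) (by omega) (by rw [e]; omega)
    (by rwa [e])
  obtain ⟨s₁, hs₁⟩ : ∃ s₁, s₁ = reductionCmd.run (latticeCmd.run s) := ⟨_, rfl⟩
  have fr₁ : Frame (latticeCmd ;; reductionCmd) s s₁ :=
    hs₁ ▸ Cmd.frame (latticeCmd ;; reductionCmd) s
  rw [← hs₁] at h0'
  have hbig := roots_bound_lt hL hXt.le
  have hX1 : (1 : ℤ) ≤ X := by exact_mod_cast hX
  have hL1 : (1 : ℤ) ≤ L := by exact_mod_cast (by omega : 1 ≤ L)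
  have h3L : (3 : ℕ) * L ^ 2 + L < L ^ 8 := by
    have h₆ : 100 ^ 6 ≤ L ^ 6 := Nat.pow_le_pow_left hL 6
    nlinarith
  have hXL : (X : ℤ) ^ L < 2 ^ L ^ 8 := by
    calc (X : ℤ) ^ L ≤ (2 ^ L) ^ L := by gcongr; exact_mod_cast hXt.le
      _ = 2 ^ (L * L) := by rw [pow_mul]
      _ < _ := pow_lt_pow_right₀ one_lt_two (by nlinarith)
  have hH : (L : ℤ) * 2 ^ (3 * L ^ 2) < 2 ^ L ^ 8 := by
    calc (L : ℤ) * 2 ^ (3 * L ^ 2) ≤ 2 ^ L * 2 ^ (3 * L ^ 2) := by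
          gcongr; exact_mod_cast L.lt_two_pow_self.le
      _ = 2 ^ (3 * L ^ 2 + L) := by rw [pow_add, mul_comm]
      _ < _ := pow_lt_pow_right₀ one_lt_two h3L
  have g5 : s₁.var 5 = 2 ^ L ^ 8 := (fr₁.1 5 rfl).trans h5
  have hpoly := run_poly (s := s₁) (h := h) ((fr₁.1 2 rfl).trans h2) ((fr₁.1 7 rfl).trans h7) hX1 h0'
    (by rw [g5]; exact hXL) (fun j hj => by rw [g5]; exact (hle j hj).trans_lt hH)
  obtain ⟨s₂, hs₂⟩ : ∃ s₂, s₂ = polyCmd.run s₁ := ⟨_, rfl⟩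
  have fr₂ : Frame polyCmd s₁ s₂ := hs₂ ▸ Cmd.frame _ _
  rw [← hs₂] at hpoly
  obtain ⟨i, hi, j, hj, hij⟩ := run_roots (s := s₂) (y := m - a) ((fr₂.1 2 rfl).trans ((fr₁.1 2 rfl).trans h2))
    ((fr₂.1 3 rfl).trans ((fr₁.1 3 rfl).trans h3)) ((fr₂.1 7 rfl).trans ((fr₁.1 7 rfl).trans h7))
    hpoly hle (one_le_mul_of_one_le_of_one_le hL1 (one_le_pow₀ one_le_two)) hne hsum (by omega) hXt
    (by rw [fr₂.1 5 rfl, g5]; exact hbig)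
  obtain ⟨s₃, hs₃⟩ : ∃ s₃, s₃ = separateCmd.run (newtonCmd.run s₂) := ⟨_, rfl⟩
  have fr₃ : Frame (newtonCmd ;; separateCmd) s₂ s₃ :=
    hs₃ ▸ Cmd.frame (newtonCmd ;; separateCmd) s₂
  rw [← hs₃] at hij
  have k : ∀ x, (latticeCmd ;; reductionCmd).writes x = false → polyCmd.writes x = false →
      (newtonCmd ;; separateCmd).writes x = false → s₃.var x = s.var x := fun x u₁ u₂ u₃ =>
    (fr₃.1 x u₃).trans ((fr₂.1 x u₂).trans (fr₁.1 x u₁))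
  have hrun : intervalCmd.run s = candidatesCmd.run s₃ := by
    rw [hs₃, hs₂, hs₁]; rfl
  rw [hrun]
  refine le_run_candidatesCmd (T := L ^ 8) (L := L) ((k 4 rfl rfl rfl).trans h4)
    ((k 2 rfl rfl rfl).trans h2) (i := i) ?_ hj ?_ (by exact_mod_cast hm) ?_ ?_ ?_ ?_
  -- The breakpoint may have index `2 * L`, one too many for a loop bounded by variable `3`; so
  -- variable `4` bounds the loop over breakpoints.
  · have : L ≤ L ^ 2 := Nat.le_self_pow two_ne_zero L
    exact hi.trans_lt (lt_of_le_of_lt (by linarith) h3L)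
  · rw [k 9 rfl rfl rfl, h9]; omega
  · rw [k 0 rfl rfl rfl, h0]; exact_mod_cast hdvd
  · rw [k 0 rfl rfl rfl, h0]; exact_mod_cast hlt
  · rw [k 5 rfl rfl rfl, h5]
    refine lt_of_lt_of_le (b := 2 ^ t) ?_ (pow_le_pow_right₀ one_le_two (by omega))
    exact_mod_cast (by omega : m < 2 ^ t)
  · rwa [k 0 rfl rfl rfl, k 6 rfl rfl rfl]

end LogCost

/-! ### The search over all intervals. -/

namespace LogCost

/-- The result cannot exceed `m`, since variable `6` only ever holds candidates. It is at least `m`,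
since one round of the loop meets `m`. -/
theorem run_cofactorCmd {s : State} {N M m L t : ℕ} (hLt : L = 2 * t) (ht : 50 ≤ t)
    (h0 : s.var 0 = N) (h1 : s.var 1 = M) (h2 : s.var 2 = L) (h3 : s.var 3 = 2 * L)
    (h4 : s.var 4 = (L ^ 8 : ℕ)) (h5 : s.var 5 = 2 ^ L ^ 8) (hM : 1 ≤ M) (hMN : M ≤ N)
    (hNt : N < 2 ^ t) (hm : 1 ≤ m) (hmN : 2 * m ≤ N) (hdvdK : (N : ℤ) - m ∣ M * N)
    (hdvd : m ∣ N) (hlt : m * m < N) (hbest : ∀ d, d ∣ N → d * d < N → d ≤ m) :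
    (cofactorCmd.run s).var 6 = m := by
  have hNL : N < 2 ^ L := hNt.trans_le (Nat.pow_le_pow_right two_pos (by omega))
  have hLQ : (2 : ℤ) ^ L ≤ 2 ^ L ^ 8 := pow_le_pow_right₀ one_le_two (Nat.le_self_pow (by norm_num) L)
  have hNQ : (N : ℤ) < 2 ^ L ^ 8 := lt_of_lt_of_le (by exact_mod_cast hNL) hLQ
  have hK1 : (1 : ℤ) ≤ M * N := by
    exact_mod_cast Nat.mul_pos hM (by omega : 0 < N)
  have hKN : (M : ℤ) * N ≤ N ^ 2 := by
    rw [sq]; exact_mod_cast Nat.mul_le_mul_right N hMN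
  have hKQ : clamp (s.var 5) ((M : ℤ) * N) = M * N := clamp_eq (by
    rw [abs_of_nonneg (by linarith), h5]
    refine lt_of_le_of_lt hKN (lt_of_lt_of_le ?_ hLQ)
    rw [hLt, mul_comm, pow_mul]
    exact_mod_cast Nat.pow_lt_pow_left hNt two_ne_zero)
  have c0 : clamp (s.var 5) 0 = 0 := clamp_eq (by rw [h5]; simp)
  obtain ⟨s₁, hs₁⟩ : ∃ s₁, s₁ = (s.setVar 6 0).setVar 17 (M * N) := ⟨_, rfl⟩
  have r₁ : Cmd.run (.set 6 0 ;; .set 17 (v 1 * v 0)) s = s₁ := by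
    simp [Cmd.run, State.setVar, hs₁, c0, h0, h1, hKQ]
  have hv : ∀ x, x ≠ 6 → x ≠ 17 → s₁.var x = s.var x := fun x h₁ h₂ => by
    simp [hs₁, State.setVar, h₁, h₂]
  obtain ⟨s₂, hs₂⟩ : ∃ s₂, s₂ = lengthCmd.run s₁ := ⟨_, rfl⟩
  have fr₂ : Frame lengthCmd s₁ s₂ := hs₂ ▸ Cmd.frame _ _
  have k0 : s₂.var 0 = N := (fr₂.1 0 rfl).trans ((hv 0 (by norm_num) (by norm_num)).trans h0)
  have k2 : s₂.var 2 = L := (fr₂.1 2 rfl).trans ((hv 2 (by norm_num) (by norm_num)).trans h2)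
  have k3 : s₂.var 3 = 2 * L := (fr₂.1 3 rfl).trans ((hv 3 (by norm_num) (by norm_num)).trans h3)
  have k4 : s₂.var 4 = (L ^ 8 : ℕ) :=
    (fr₂.1 4 rfl).trans ((hv 4 (by norm_num) (by norm_num)).trans h4)
  have k5 : s₂.var 5 = 2 ^ L ^ 8 := (fr₂.1 5 rfl).trans ((hv 5 (by norm_num) (by norm_num)).trans h5)
  have k6 : s₂.var 6 = 0 := (fr₂.1 6 rfl).trans (by simp [hs₁, State.setVar])
  have k17 : s₂.var 17 = M * N := (fr₂.1 17 rfl).trans (by simp [hs₁, State.setVar])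
  have hcand : Candidate (s₂.var 0) (s₂.var 6) := by rw [k6]; exact ⟨le_rfl, Or.inl rfl⟩
  have hmi : (1 : ℤ) ≤ m := by exact_mod_cast hm
  have hdvd' : (m : ℤ) ∣ N := by exact_mod_cast hdvd
  have hlt' : (m : ℤ) * m < N := by exact_mod_cast hlt
  have hmQ : (m : ℤ) < 2 ^ L ^ 8 := by omega
  have himp₀ : (Cmd.set 9 (v 8 * v 7) ;; intervalCmd).Improves :=
    (Cmd.improves_of_writes rfl).seq improves_intervalCmd rfl
  have himp : (testCmd (v 8) ;; .set 9 (v 8 * v 7) ;; intervalCmd).Improves :=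
    (improves_testCmd _).seq himp₀ rfl
  have hrun : cofactorCmd.run s =
      (Cmd.rep 8 2 (testCmd (v 8) ;; .set 9 (v 8 * v 7) ;; intervalCmd)).run s₂ := by
    rw [hs₂, ← r₁]; rfl
  rw [hrun]
  refine le_antisymm ?_ ?_
  · obtain ⟨⟨hz, h⟩, -⟩ := himp.rep (x := 8) (b := 2) (by norm_num) rfl s₂ hcand
    rw [k0] at h
    obtain ⟨d, hd⟩ := Int.eq_ofNat_of_zero_le hz
    rw [hd] at h ⊢
    rcases h with h | ⟨h₁, h₂⟩
    · rw [h]; positivity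
    · exact_mod_cast hbest d (by exact_mod_cast h₁) (by exact_mod_cast h₂)
  · by_cases hN : 64 ≤ N
    · obtain ⟨X, h7, hX, hXN, hNX⟩ := run_length (s := s₁) (L := L) (N := N)
        ((hv 2 (by norm_num) (by norm_num)).trans h2) ((hv 0 (by norm_num) (by norm_num)).trans h0)
        hN hNL (by rw [hv 5 (by norm_num) (by norm_num), h5]; exact hNQ)
      rw [← hs₂] at h7
      -- From `m ^ 2 < N < 256 * X ^ 2`. So `m` lies in one of the first 16 intervals, and the loop
      -- runs through `L ≥ 100` of them.
      have hmX : m < 16 * X := by nlinarith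
      have hdm := Nat.div_add_mod' m X
      have hmod := Nat.mod_lt m (by omega : 0 < X)
      have hquot : m / X < 16 := (Nat.div_lt_iff_lt_mul (by omega)).2 hmX
      refine himp.rep_of_hit (by norm_num) rfl k2 (k₀ := m / X) (by omega) hcand
        fun s' fr h8 hs' => ?_
      obtain ⟨s₃, hs₃⟩ : ∃ s₃, s₃ = (testCmd (v 8)).run s' := ⟨_, rfl⟩
      have fr₃ : Frame (testCmd (v 8)) s' s₃ := hs₃ ▸ Cmd.frame _ _
      have hs₃' := (improves_testCmd (v 8) s' hs').1
      rw [← hs₃, ← fr₃.1 0 rfl] at hs₃'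
      have l5 : s₃.var 5 = 2 ^ L ^ 8 := (fr₃.1 5 rfl).trans ((fr.1 5 rfl).trans k5)
      have l8 : s₃.var 8 = (m / X : ℕ) := (fr₃.1 8 rfl).trans h8
      have l7 : s₃.var 7 = X := (fr₃.1 7 rfl).trans ((fr.1 7 rfl).trans h7)
      obtain ⟨s₄, hs₄⟩ : ∃ s₄, s₄ = s₃.setVar 9 (m / X * X : ℕ) := ⟨_, rfl⟩
      have r₄ : (Cmd.set 9 (v 8 * v 7)).run s₃ = s₄ := by
        have : clamp (2 ^ L ^ 8) ((m / X : ℕ) * X : ℤ) = (m / X * X : ℕ) := by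
          rw [← Nat.cast_mul, clamp_eq]
          rw [abs_of_nonneg (by positivity)]
          refine lt_of_le_of_lt ?_ hmQ
          exact_mod_cast Nat.div_mul_le_self m X
        simp only [Cmd.run, Expr.eval_mul, Expr.eval_var, l8, l7, l5, this, hs₄]
      have w : ∀ x, x ≠ 9 → (testCmd (v 8)).writes x = false →
          (Cmd.rep 8 2 (testCmd (v 8) ;; .set 9 (v 8 * v 7) ;; intervalCmd)).writes x = false →
          s₄.var x = s₂.var x := fun x h₁ h₂ h₃ => by
        rw [← fr.1 x h₃, ← fr₃.1 x h₂]; simp [hs₄, State.setVar, h₁]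
      have hrun' : (testCmd (v 8) ;; .set 9 (v 8 * v 7) ;; intervalCmd).run s' =
          intervalCmd.run s₄ := by
        rw [← r₄, hs₃]; rfl
      rw [hrun']
      refine le_run_intervalCmd (N := N) (t := t) (a := m / X * X) (X := X) (K := M * N) hLt ht
        ((w 0 (by norm_num) rfl rfl).trans k0) ((w 2 (by norm_num) rfl rfl).trans k2)
        ((w 3 (by norm_num) rfl rfl).trans k3) ((w 4 (by norm_num) rfl rfl).trans k4)
        ((w 5 (by norm_num) rfl rfl).trans k5) ((w 7 (by norm_num) rfl rfl).trans h7)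
        (by simp [hs₄, State.setVar]) ((w 17 (by norm_num) rfl rfl).trans k17) hK1 hKN hNt hX
        hXN (Nat.div_mul_le_self m X) (by omega) hm hmN hdvdK hdvd hlt ?_
      simpa [hs₄, State.setVar] using hs₃'
    -- For `N < 64` there is no admissible `X`. Then `m` is so small that it occurs as an interval
    -- number, and these are tested too.
    · have hm8 : m < 8 := by nlinarith
      refine himp.rep_of_hit (by norm_num) rfl k2 (k₀ := m) (by omega) hcand fun s' fr h8 hs' => ?_
      have e0 : s'.var 0 = N := (fr.1 0 rfl).trans k0
      have e5 : s'.var 5 = 2 ^ L ^ 8 := (fr.1 5 rfl).trans k5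
      have i₁ := improves_testCmd (v 8) s' hs'
      refine (le_run_testCmd (e := v 8) (s := s') (m := m) (by simpa using h8) hmi
        (by rwa [e0]) (by rwa [e0]) (by rwa [e5])).trans ?_
      refine (himp₀ ((testCmd (v 8)).run s') ?_).2
      have : ((testCmd (v 8)).run s').var 0 = s'.var 0 := (testCmd (v 8)).run_var rfl s'
      rw [this]
      exact i₁.1

/-! ### The whole program -/

/-- The program runs from `s` to `s'` at cost at most `t`. -/
def ExecWithin (t : ℕ) (c : Prog) (s s' : State) : Prop := ∃ u ≤ t, Exec c s s' u

theorem ExecWithin.seq {t₁ t₂ : ℕ} {c₁ c₂ : Prog} {s s' s'' : State} (h₁ : ExecWithin t₁ c₁ s s')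
    (h₂ : ExecWithin t₂ c₂ s' s'') : ExecWithin (t₁ + t₂) (.seq c₁ c₂) s s'' := by
  obtain ⟨u₁, hu₁, e₁⟩ := h₁
  obtain ⟨u₂, hu₂, e₂⟩ := h₂
  exact ⟨_, by omega, Exec.seq e₁ e₂⟩

theorem ExecWithin.mono {t t' : ℕ} {c : Prog} {s s' : State} (h : ExecWithin t c s s')
    (ht : t ≤ t') : ExecWithin t' c s s' :=
  let ⟨u, hu, e⟩ := h
  ⟨u, hu.trans ht, e⟩

theorem exists_execWithin_assign (x : ℕ) (e : Expr) :
    ∃ A, ∀ B s, State.Bounded B s →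
      ExecWithin (A * (B + 1) ^ 2) (.assign x e) s (s.setVar x (e.eval s)) := by
  obtain ⟨A, hA⟩ := e.exists_cost_le
  obtain ⟨W, hW⟩ := e.exists_bits_le
  refine ⟨A + W + 1, fun B s h => ⟨_, ?_, Exec.assign _ _ _⟩⟩
  have := hA B s h
  have := hW B s h
  have : W * (B + 1) ≤ W * (B + 1) ^ 2 := Nat.mul_le_mul_left _ (Nat.le_self_pow (by norm_num) _)
  nlinarith

theorem execWithin_loop {e : Expr} {c : Prog} {n B A : ℕ} {S : ℕ → State} (hn : n ≤ B)
    (hstep : ∀ k < n, e.eval (S k) ≠ 0 ∧ ExecWithin (A * (B + 1) ^ 2) c (S k) (S (k + 1)))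
    (hend : e.eval (S n) = 0) (hcost : ∀ k ≤ n, e.cost (S k) ≤ A * (B + 1) ^ 2) :
    ExecWithin ((2 * A + 1) * (B + 1) ^ 3) (.loop e c) (S 0) (S n) := by
  refine ExecWithin.mono (exec_loop hstep hend hcost) ?_
  have h₁ : 1 ≤ (B + 1) ^ 2 := Nat.one_le_pow _ _ (by omega)
  calc (n + 1) * (2 * (A * (B + 1) ^ 2) + 1)
      ≤ (B + 1) * (2 * (A * (B + 1) ^ 2) + (B + 1) ^ 2) := by gcongr
    _ = _ := by ring

/-- The bit length of variable `0`, by repeated halving: variable `2` is increased twice as much. -/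
def bitsProg : Prog :=
  .seq (.assign 2 (.const 100)) (.seq (.assign 6 (v 0))
    (.loop (v 6) (.seq (.assign 2 (v 2 + 2)) (.assign 6 (v 6 / 2)))))

theorem State.setVar_swap (s : State) {x y : ℕ} (h : x ≠ y) (a b a' : ℤ) :
    ((s.setVar x a).setVar y b).setVar x a' = (s.setVar x a').setVar y b := by
  simp only [State.setVar]
  rw [Function.update_comm h, Function.update_idem, Function.update_comm h.symm]

theorem State.setVar_idem (s : State) (x : ℕ) (a b : ℤ) :
    (s.setVar x a).setVar x b = s.setVar x b := by
  simp [State.setVar]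

/-- With `L = 100 + 2 * N.size` and `t = L / 2 = 50 + N.size`, both `50 ≤ t` and `N < 2 ^ t` hold.
-/
theorem exec_bitsProg : ∃ A, ∀ (N B : ℕ) (s : State), s.Bounded B → s.var 0 = N →
    100 + 2 * N.size ≤ B →
    ExecWithin (A * (B + 1) ^ 3) bitsProg s ((s.setVar 2 (100 + 2 * N.size : ℕ)).setVar 6 0) ∧
      ((s.setVar 2 (100 + 2 * N.size : ℕ)).setVar 6 0).Bounded B := by
  obtain ⟨A₁, h₁⟩ := exists_execWithin_assign 2 (.const 100)
  obtain ⟨A₂, h₂⟩ := exists_execWithin_assign 6 (v 0)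
  obtain ⟨A₃, h₃⟩ := exists_execWithin_assign 2 (v 2 + 2)
  obtain ⟨A₄, h₄⟩ := exists_execWithin_assign 6 (v 6 / 2)
  obtain ⟨A₅, h₅⟩ := (v 6).exists_cost_le
  refine ⟨A₁ + A₂ + (2 * (A₃ + A₄ + A₅) + 1), fun N B s hs h0 hB => ?_⟩
  have hb2 : ∀ k ≤ N.size, bits ((100 + 2 * k : ℕ) : ℤ) ≤ B := fun k hk =>
    (bits_natCast_le _).trans (by omega)
  have hb6 : ∀ k, bits ((N / 2 ^ k : ℕ) : ℤ) ≤ B := fun k => by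
    refine (bits_mono (b := N) ?_).trans (h0 ▸ hs.1 0)
    rw [abs_of_nonneg (by positivity), abs_of_nonneg (by positivity)]
    exact_mod_cast Nat.div_le_self _ _
  let S : ℕ → State := fun k => (s.setVar 2 (100 + 2 * k : ℕ)).setVar 6 (N / 2 ^ k : ℕ)
  have hS : ∀ k ≤ N.size, (S k).Bounded B := fun k hk =>
    (hs.setVar 2 (hb2 k hk)).setVar 6 (hb6 k)
  have hend : N / 2 ^ N.size = 0 := Nat.div_eq_of_lt N.lt_size_self
  have hSend : S N.size = (s.setVar 2 (100 + 2 * N.size : ℕ)).setVar 6 0 := by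
    simp only [S, hend, Nat.cast_zero]
  have loop : ExecWithin _ (.loop (v 6) (.seq (.assign 2 (v 2 + 2)) (.assign 6 (v 6 / 2))))
      (S 0) (S N.size) := execWithin_loop (A := A₃ + A₄ + A₅) (B := B) (by omega)
    (fun k hk => by
      have hpos : 0 < N / 2 ^ k := Nat.div_pos (Nat.lt_size.1 hk) (by positivity)
      have h6 : (S k).var 6 = (N / 2 ^ k : ℕ) := by simp [S, State.setVar]
      refine ⟨by rw [Expr.eval_var, h6]; exact_mod_cast hpos.ne', ?_⟩
      have e₁ := h₃ B _ (hS k hk.le)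
      have r₁ : (S k).setVar 2 ((v 2 + 2).eval (S k)) =
          (s.setVar 2 (100 + 2 * (k + 1) : ℕ)).setVar 6 (N / 2 ^ k : ℕ) := by
        rw [State.setVar_swap _ (by norm_num)]
        congr 2
      rw [r₁] at e₁
      have e₂ := h₄ B _ ((hs.setVar 2 (hb2 (k + 1) hk)).setVar 6 (hb6 k))
      have r₂ : ((s.setVar 2 (100 + 2 * (k + 1) : ℕ)).setVar 6 (N / 2 ^ k : ℕ)).setVar 6
          ((v 6 / 2).eval ((s.setVar 2 (100 + 2 * (k + 1) : ℕ)).setVar 6 (N / 2 ^ k : ℕ))) =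
          S (k + 1) := by
        rw [State.setVar_idem]
        congr 1
        simp only [State.setVar, Expr.eval_div, Expr.eval_var, Expr.eval_two, Function.update_self]
        rw [pow_succ, ← Nat.div_div_eq_div_mul]
        push_cast
        rfl
      rw [r₂] at e₂
      refine (e₁.seq e₂).mono ?_
      rw [add_mul, add_mul]
      omega)
    (by rw [hSend]; simp [State.setVar])
    (fun k hk => (h₅ B _ (hS k hk)).trans (by rw [add_mul]; omega))
  have e₁ := h₁ B s hs
  have r₁ : s.setVar 2 ((Expr.const 100).eval s) = s.setVar 2 (100 + 2 * 0 : ℕ) := rfl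
  rw [r₁] at e₁
  have e₂ := h₂ B _ (hs.setVar 2 (hb2 0 (by omega)))
  have r₂ : (s.setVar 2 (100 + 2 * 0 : ℕ)).setVar 6
      ((v 0).eval (s.setVar 2 (100 + 2 * 0 : ℕ))) = S 0 := by
    simp [S, State.setVar, h0]
  rw [r₂] at e₂
  rw [hSend] at loop
  refine ⟨(e₁.seq (e₂.seq loop)).mono ?_, by rw [← hSend]; exact hS _ le_rfl⟩
  have hp : (B + 1) ^ 2 ≤ (B + 1) ^ 3 := Nat.pow_le_pow_right (by omega) (by norm_num)
  have := Nat.mul_le_mul_left A₁ hp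
  have := Nat.mul_le_mul_left A₂ hp
  simp only [add_mul]
  omega

/-- Doubling, as many times as variable `4` says. -/
def powProg : Prog :=
  .seq (.assign 5 1) (.seq (.assign 6 0)
    (.loop (.le (v 6 + 1) (v 4)) (.seq (.assign 5 (v 5 + v 5)) (.assign 6 (v 6 + 1)))))

theorem bits_two_pow_le (k : ℕ) : bits (2 ^ k) ≤ k + 1 := by
  rw [bits_le_iff, abs_of_nonneg (by positivity)]
  exact pow_lt_pow_right₀ one_lt_two (by omega)

theorem exec_powProg : ∃ A, ∀ (T B : ℕ) (s : State), s.Bounded B → s.var 4 = T →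
    T + 1 ≤ B →
    ExecWithin (A * (B + 1) ^ 3) powProg s ((s.setVar 5 (2 ^ T)).setVar 6 T) ∧
      ((s.setVar 5 (2 ^ T)).setVar 6 T).Bounded B := by
  obtain ⟨A₁, h₁⟩ := exists_execWithin_assign 5 1
  obtain ⟨A₂, h₂⟩ := exists_execWithin_assign 6 0
  obtain ⟨A₃, h₃⟩ := exists_execWithin_assign 5 (v 5 + v 5)
  obtain ⟨A₄, h₄⟩ := exists_execWithin_assign 6 (v 6 + 1)
  obtain ⟨A₅, h₅⟩ := (Expr.le (v 6 + 1) (v 4)).exists_cost_le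
  refine ⟨A₁ + A₂ + (2 * (A₃ + A₄ + A₅) + 1), fun T B s hs h4 hB => ?_⟩
  have hb5 : ∀ k ≤ T, bits (2 ^ k) ≤ B := fun k hk => (bits_two_pow_le k).trans (by omega)
  have hb6 : ∀ k ≤ T, bits (k : ℤ) ≤ B := fun k hk => (bits_natCast_le _).trans (by omega)
  let S : ℕ → State := fun k => (s.setVar 5 (2 ^ k)).setVar 6 k
  have hS : ∀ k ≤ T, (S k).Bounded B := fun k hk =>
    (hs.setVar 5 (hb5 k hk)).setVar 6 (hb6 k hk)
  have htest : ∀ k, (Expr.le (v 6 + 1) (v 4)).eval (S k) = if k < T then 1 else 0 := fun k => by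
    have : (k : ℤ) + 1 ≤ T ↔ k < T := by omega
    simp [S, State.setVar, h4, this]
  have loop : ExecWithin _ (.loop (.le (v 6 + 1) (v 4))
      (.seq (.assign 5 (v 5 + v 5)) (.assign 6 (v 6 + 1)))) (S 0) (S T) :=
    execWithin_loop (A := A₃ + A₄ + A₅) (B := B) (by omega) (fun k hk => by
      refine ⟨by simp [htest, hk], ?_⟩
      have e₁ := h₃ B _ (hS k hk.le)
      have r₁ : (S k).setVar 5 ((v 5 + v 5).eval (S k)) =
          (s.setVar 5 (2 ^ (k + 1))).setVar 6 k := by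
        rw [State.setVar_swap _ (by norm_num)]
        congr 2
        simp [S, State.setVar]
        ring
      rw [r₁] at e₁
      have e₂ := h₄ B _ ((hs.setVar 5 (hb5 (k + 1) hk)).setVar 6 (hb6 k hk.le))
      have r₂ : ((s.setVar 5 (2 ^ (k + 1))).setVar 6 k).setVar 6
          ((v 6 + 1).eval ((s.setVar 5 (2 ^ (k + 1))).setVar 6 k)) = S (k + 1) := by
        rw [State.setVar_idem]
        simp [S, State.setVar]
      rw [r₂] at e₂
      refine (e₁.seq e₂).mono ?_
      rw [add_mul, add_mul]
      omega) (by simp [htest])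
    (fun k hk => (h₅ B _ (hS k hk)).trans (by rw [add_mul]; omega))
  have e₁ := h₁ B s hs
  have r₁ : s.setVar 5 ((1 : Expr).eval s) = s.setVar 5 (2 ^ 0) := rfl
  rw [r₁] at e₁
  have e₂ := h₂ B _ (hs.setVar 5 (hb5 0 (by omega)))
  have r₂ : (s.setVar 5 (2 ^ 0)).setVar 6 ((0 : Expr).eval (s.setVar 5 (2 ^ 0))) = S 0 := rfl
  rw [r₂] at e₂
  refine ⟨(e₁.seq (e₂.seq loop)).mono ?_, hS _ le_rfl⟩
  have hp : (B + 1) ^ 2 ≤ (B + 1) ^ 3 := Nat.pow_le_pow_right (by omega) (by norm_num)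
  have := Nat.mul_le_mul_left A₁ hp
  have := Nat.mul_le_mul_left A₂ hp
  simp only [add_mul]
  omega

/-- The parameters, the search for the cofactor and the division by the cofactor. -/
def factorProg : Prog :=
  .seq bitsProg (.seq (.assign 3 (2 * v 2))
    (.seq (.assign 4 (v 2 * v 2 * v 2 * v 2 * v 2 * v 2 * v 2 * v 2))
      (.seq powProg (.seq cofactorCmd.toProg (.assign 0 (v 0 / v 6))))))

theorem exec_factorProg : ∃ A k, ∀ N M m L : ℕ, L = 100 + 2 * N.size → 1 ≤ M → M ≤ N → 1 ≤ m →
    2 * m ≤ N → N - m ∣ M * N → m ∣ N → m * m < N → (∀ d, d ∣ N → d * d < N → d ≤ m) →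
    ∃ t ≤ A * (L ^ 8 + 2) ^ k, Outputs factorProg [(N : ℤ), (M : ℤ)] (N / m : ℕ) t := by
  obtain ⟨A₁, h₁⟩ := exec_bitsProg
  obtain ⟨A₂, h₂⟩ := exists_execWithin_assign 3 (2 * v 2)
  obtain ⟨A₃, h₃⟩ := exists_execWithin_assign 4 (v 2 * v 2 * v 2 * v 2 * v 2 * v 2 * v 2 * v 2)
  obtain ⟨A₄, h₄⟩ := exec_powProg
  obtain ⟨A₅, k, h₅⟩ := cofactorCmd.exec_toProg (by decide)
  obtain ⟨A₆, h₆⟩ := exists_execWithin_assign 0 (v 0 / v 6)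
  refine ⟨A₁ + A₂ + A₃ + A₄ + A₅ + A₆, k + 3,
    fun N M m L hL hM hMN hm hmN hdvdK hdvd hlt hbest => ?_⟩
  -- The bit length of `Q = 2 ^ L ^ 8`, which also bounds all loop lengths.
  obtain ⟨B, hB⟩ : ∃ B, B = L ^ 8 + 1 := ⟨_, rfl⟩
  have hLB : L ≤ L ^ 8 := Nat.le_self_pow (by norm_num) L
  have h2LB : 2 * L ≤ L ^ 8 := by
    calc 2 * L ≤ L ^ 2 := by nlinarith
      _ ≤ L ^ 8 := Nat.pow_le_pow_right (by omega) (by norm_num)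
  have hbN : bits (N : ℤ) ≤ N.size := by simp [bits]
  have hbM : bits (M : ℤ) ≤ N.size := le_trans (bits_mono (by
    rw [abs_of_nonneg (by positivity), abs_of_nonneg (by positivity)]
    exact_mod_cast hMN)) hbN
  have hb0 : bits 0 = 0 := rfl
  have hs₀ : (State.init [(N : ℤ), (M : ℤ)]).Bounded B := by
    refine ⟨fun x => ?_, fun a i => ?_⟩
    · rcases x with _ | _ | x
      · exact hbN.trans (by omega)
      · exact hbM.trans (by omega)
      · exact (le_of_eq hb0).trans (by omega)
    · exact (le_of_eq hb0).trans (by omega)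
  obtain ⟨e₁, b₁⟩ := h₁ N B _ hs₀ rfl (by omega)
  rw [← hL] at e₁ b₁
  obtain ⟨s₁, hs₁⟩ : ∃ s₁, s₁ = ((State.init [(N : ℤ), (M : ℤ)]).setVar 2 L).setVar 6 0 := ⟨_, rfl⟩
  rw [← hs₁] at e₁ b₁
  have e₂ := h₂ B s₁ b₁
  have r₂ : (2 * v 2).eval s₁ = ((2 * L : ℕ) : ℤ) := by
    simp [hs₁, State.setVar]
  rw [r₂] at e₂
  have b₂ : (s₁.setVar 3 (2 * L : ℕ)).Bounded B :=
    b₁.setVar 3 ((bits_natCast_le _).trans (by omega))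
  obtain ⟨s₂, hs₂⟩ : ∃ s₂, s₂ = s₁.setVar 3 (2 * L : ℕ) := ⟨_, rfl⟩
  rw [← hs₂] at e₂ b₂
  have e₃ := h₃ B s₂ b₂
  have r₃ : (v 2 * v 2 * v 2 * v 2 * v 2 * v 2 * v 2 * v 2).eval s₂ = ((L ^ 8 : ℕ) : ℤ) := by
    simp [hs₂, hs₁, State.setVar]
    ring
  rw [r₃] at e₃
  have b₃ : (s₂.setVar 4 (L ^ 8 : ℕ)).Bounded B :=
    b₂.setVar 4 ((bits_natCast_le _).trans (by omega))
  obtain ⟨s₃, hs₃⟩ : ∃ s₃, s₃ = s₂.setVar 4 (L ^ 8 : ℕ) := ⟨_, rfl⟩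
  rw [← hs₃] at e₃ b₃
  obtain ⟨e₄, b₄⟩ := h₄ (L ^ 8) B s₃ b₃ (by simp [hs₃, State.setVar]) (by omega)
  obtain ⟨s₄, hs₄⟩ : ∃ s₄, s₄ = (s₃.setVar 5 (2 ^ L ^ 8)).setVar 6 (L ^ 8 : ℕ) := ⟨_, rfl⟩
  rw [← hs₄] at e₄ b₄
  have k0 : s₄.var 0 = N := by simp [hs₄, hs₃, hs₂, hs₁, State.setVar, State.init]
  have k1 : s₄.var 1 = M := by simp [hs₄, hs₃, hs₂, hs₁, State.setVar, State.init]
  have k2 : s₄.var 2 = L := by simp [hs₄, hs₃, hs₂, hs₁, State.setVar]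
  have k3 : s₄.var 3 = 2 * L := by simp [hs₄, hs₃, hs₂, State.setVar]
  have k4 : s₄.var 4 = (L ^ 8 : ℕ) := by simp [hs₄, hs₃, State.setVar]
  have k5 : s₄.var 5 = 2 ^ L ^ 8 := by simp [hs₄, State.setVar]
  have hready : State.Ready B s₄ := ⟨b₄, by rw [k5]; positivity, fun b hb hb' => by
    interval_cases b
    · rw [k2]; exact_mod_cast (by omega : L ≤ B)
    · rw [k3]; exact_mod_cast (by omega : 2 * L ≤ B)
    · rw [k4]; exact_mod_cast (by omega : L ^ 8 ≤ B)⟩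
  obtain ⟨b₅, e₅⟩ := h₅ B s₄ hready
  have hc : (cofactorCmd.run s₄).var 6 = m := run_cofactorCmd (t := 50 + N.size) (by omega) (by omega)
    k0 k1 k2 k3 k4 k5 hM hMN (N.lt_size_self.trans_le (Nat.pow_le_pow_right two_pos (by omega)))
    hm hmN (by
      have : ((N - m : ℕ) : ℤ) ∣ ((M * N : ℕ) : ℤ) := by exact_mod_cast hdvdK
      rwa [Nat.cast_sub (by omega), Nat.cast_mul] at this) hdvd hlt hbest
  have hc0 : (cofactorCmd.run s₄).var 0 = N := (cofactorCmd.run_var rfl s₄).trans k0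
  have e₆ := h₆ B _ b₅
  have r₆ : (v 0 / v 6).eval (cofactorCmd.run s₄) = (N / m : ℕ) := by simp [hc, hc0]
  rw [r₆] at e₆
  obtain ⟨t, ht, hex⟩ := e₁.seq (e₂.seq (e₃.seq (e₄.seq (ExecWithin.seq e₅ e₆))))
  refine ⟨t, ht.trans ?_, _, hex, by simp [State.setVar]⟩
  rw [show L ^ 8 + 2 = B + 1 by omega]
  have l₂ : (B + 1) ^ 2 ≤ (B + 1) ^ (k + 3) := Nat.pow_le_pow_right (by omega) (by omega)
  have l₃ : (B + 1) ^ 3 ≤ (B + 1) ^ (k + 3) := Nat.pow_le_pow_right (by omega) (by omega)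
  have l₅ : (B + 1) ^ k ≤ (B + 1) ^ (k + 3) := Nat.pow_le_pow_right (by omega) (by omega)
  have := Nat.mul_le_mul_left A₁ l₃
  have := Nat.mul_le_mul_left A₂ l₂
  have := Nat.mul_le_mul_left A₃ l₂
  have := Nat.mul_le_mul_left A₄ l₃
  have := Nat.mul_le_mul_left A₅ l₅
  have := Nat.mul_le_mul_left A₆ l₂
  simp only [add_mul]
  omega

theorem size_le_log {N : ℕ} (hN : N ≠ 0) : (N.size : ℝ) ≤ 1 + 2 * Real.log N := by
  obtain ⟨n, hn⟩ : ∃ n, N.size = n + 1 :=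
    ⟨N.size - 1, by have := Nat.size_pos.2 (Nat.pos_of_ne_zero hN); omega⟩
  have h₁ : 2 ^ n ≤ N := Nat.lt_size.1 (by omega)
  have h₂ : (n : ℝ) * Real.log 2 ≤ Real.log N := by
    rw [← Real.log_pow]
    exact Real.log_le_log (by positivity) (by exact_mod_cast h₁)
  have h₃ := Real.log_two_gt_d9
  have h₄ : (n : ℝ) * (1 / 2) ≤ n * Real.log 2 := by gcongr; linarith
  rw [hn]
  push_cast
  linarith

end LogCost

/-! ### The theorem. -/

theorem mainTheorem1 :
    ∃ (c : LogCost.Prog) (q : Polynomial ℝ),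
      ∀ N p M : ℕ,
        Squarefree N →
        3 ≤ ArithmeticFunction.cardDistinctFactors N →
        IsGreatest {r : ℕ | r.Prime ∧ r ∣ N} p →
        Real.sqrt (N : ℝ) < (p : ℝ) →
        (M = Nat.totient N ∨ M = ArithmeticFunction.carmichael N) →
        ∃ t : ℕ, LogCost.Outputs c [(N : ℤ), (M : ℤ)] (p : ℤ) t ∧
          (t : ℝ) ≤ q.eval (Real.log (N : ℝ)) := by
  obtain ⟨A, k, h⟩ := LogCost.exec_factorProg
  refine ⟨LogCost.factorProg,
    -- `102 + 4 * log N` bounds `L = 100 + 2 * N.size`, by `size_le_log`.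
    .C (A : ℝ) * ((.C 102 + .C 4 * .X) ^ 8 + .C 2) ^ k,
    fun N p M hsq hω hp hlt hM => ?_⟩
  have hN0 : N ≠ 0 := hsq.ne_zero
  have hNpos : 0 < N := Nat.pos_of_ne_zero hN0
  obtain ⟨hpp, hpN⟩ := hp.1
  have hNp : N < p ^ 2 := by
    have := (Real.sqrt_lt' (by exact_mod_cast hpp.pos)).1 hlt
    exact_mod_cast this
  -- If `p = 2`, then `N < 4` is even, so `N = 2`, which has too few prime factors.
  have h2 : p ≠ 2 := by
    rintro rfl
    obtain ⟨c, hc⟩ := hpN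
    have : N = 2 := by omega
    rw [this, ArithmeticFunction.cardDistinctFactors_apply_prime Nat.prime_two] at hω
    omega
  have hMp : p - 1 ∣ M := by
    rcases hM with rfl | rfl
    · exact Cofactor.pred_dvd_totient hpp hpN
    · exact Cofactor.pred_dvd_carmichael hpp h2 hpN
  have hMt : M ∣ N.totient := by
    rcases hM with rfl | rfl
    · exact dvd_rfl
    · exact ArithmeticFunction.carmichael_dvd_totient N
  have htot : 0 < N.totient := Nat.totient_pos.2 hNpos
  have hM1 : 1 ≤ M := Nat.pos_of_dvd_of_pos hMt htot
  have hMN : M ≤ N := (Nat.le_of_dvd htot hMt).trans N.totient_le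
  obtain ⟨m, hm⟩ : ∃ m, m = N / p := ⟨_, rfl⟩
  have hmp : m * p = N := by rw [hm]; exact Nat.div_mul_cancel hpN
  have hm1 : 1 ≤ m := by
    rw [hm]; exact Nat.div_pos (Nat.le_of_dvd hNpos hpN) hpp.pos
  have hmltp : m < p := by nlinarith
  obtain ⟨t, ht, hout⟩ := h N M m _ rfl hM1 hMN hm1 (by nlinarith [hpp.two_le])
    (hm ▸ Cofactor.sub_dvd_mul hpN hMp) ⟨p, hmp.symm⟩ (by nlinarith)
    (fun d hd hd' => hm ▸ Cofactor.le_of_dvd_of_sq_lt hN0 hpp hpN hNp hd hd')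
  refine ⟨t, ?_, ?_⟩
  · rwa [← hmp, Nat.mul_div_cancel_left _ hm1, hmp] at hout
  · have hs := LogCost.size_le_log hN0
    have ht' : (t : ℝ) ≤ A * ((100 + 2 * N.size : ℝ) ^ 8 + 2) ^ k := by exact_mod_cast ht
    simp only [Polynomial.eval_mul, Polynomial.eval_pow, Polynomial.eval_add, Polynomial.eval_C,
      Polynomial.eval_X]
    have hle : (100 + 2 * N.size : ℝ) ≤ 102 + 4 * Real.log N := by linarith
    have hu : (0 : ℝ) ≤ 100 + 2 * N.size := by positivity
    refine ht'.trans ?_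
    generalize (100 + 2 * N.size : ℝ) = u, (102 + 4 * Real.log N : ℝ) = w at *
    gcongr
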